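/- \textbf{Conventions.} Let $F$ be a field of characteristic $2$ and let $Q$ be a Hurwitz algebra over $F$ of dimension $2$ or $4$, i.e. a unital, not necessarily associative algebra with a multiplicative quadratic form (norm) $q$ whose polar form $q(x,y)=q(x+y)-q(x)-q(y)$ is nondegenerate. $Q$ is \emph{split} if $q(x)=0$ for some $x\neq0$. Put $\bar x=q(x,1)1-x$. For $0\neq\alpha\in F$, $C=\mathrm{CD}(Q,\alpha)$ is the superalgebra $C=Q\oplus Qu_0$, $C_{\bar0}=Q$, $C_{\bar1}=Qu_0$, with product $$(a+bu_0)(c+du_0)=(ac-\alpha\bar d b)+(da+b\bar c)u_0 ,$$ and norm $q(a+bu_0)=q(a)+\alpha q(b)$. The decomposition $C=C_{\bar0}\oplus C_{\bar1}$ is the \emph{main grading}. A grading $\Gamma$ on the superalgebra $C$ by a group $H$ is a decomposition $C=\bigoplus_{h\in H}C^h$ with $C^gC^h\subseteq C^{gh}$ and $C^h=(C^h\cap C_{\bar0})\oplus(C^h\cap C_{\bar1})$; it is \emph{nontrivial} if $C\neq C^e$. Its \emph{universal grading group} $G$ is the group generated by the support $\{h: C^h\ne0\}$ with the relations $s_1s_2=s_3$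 whenever $0\neq C^{s_1}C^{s_2}\subseteq C^{s_3}$; $\Gamma$ is regarded as a $G$-grading, and $G$ is described up to isomorphism. A \emph{canonical basis} of an eight-dimensional algebra is a basis $e_1,e_2,u_1,u_2,u_3,v_1,v_2,v_3$ such that $e_1,e_2$ are orthogonal idempotents, $e_1u_i=u_i=u_ie_2$, $e_2v_i=v_i=v_ie_1$, $e_2u_i=u_ie_1=e_1v_i=v_ie_2=0$, $u_iv_j=-\delta_{ij}e_1$, $v_iu_j=-\delta_{ij}e_2$, $u_i^2=v_i^2=0$, and $u_iu_{i+1}=-u_{i+1}u_i=v_{i+2}$, $v_iv_{i+1}=-v_{i+1}v_i=u_{i+2}$ (indices modulo $3$). In dimension four a canonical basis is $e_1,e_2,u_1,v_1$, with the corresponding products. \textbf{Statement.} Let $\Gamma$ be a nontrivial grading on the superalgebra $C=\mathrm{CD}(Q,\alpha)$ by a group, and let $G$ be its universal grading group. \textbf{If $\dim Q=2$}, then either $G=\mathbb Z_2$ and $\Gamma$ is the main grading, or $G=\mathbb Z$, $Q$ is split, and there is a canonical basis of $C$ with $C^0=C_{\bar0}=\langle e_1,e_2\rangle$, $C_{\bar1}=\langle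 u_1,v_1\rangle$, $C^1=\langle u_1\rangle$, $C^{-1}=\langle v_1\rangle$. \textbf{If $\dim Q=4$}, one of the following holds. (i) $G=\mathbb Z_2^2$ and there are $w,v\in C_{\bar0}$, $u\in C_{\bar1}$ with $q(w,1)\ne0$, $q(v,1)=q(v,w)=0$, $q(v)\neq0$, $q(u)\ne0$ such that, with $K=F1+Fw$, $$C^{(\bar0,\bar0)}=K,\quad C^{(\bar1,\bar0)}=Kv,\quad C^{(\bar0,\bar1)}=Ku,\quad C^{(\bar1,\bar1)}=K(vu).$$ (ii) $G=\mathbb Z_2$ and $\Gamma$ is either the main grading, or, for some $w,v,u$ and $K$ as in (i), $C^{\bar0}=K\oplus Ku$, $C^{\bar1}=Kv\oplus K(vu)$. (iii) $Q$ is split, there is a canonical basis of $C$ with $C_{\bar0}=\langle e_1,e_2,u_3,v_3\rangle$, $C_{\bar1}=\langle u_1,u_2,v_1,v_2\rangle$, consisting of homogeneous elements with $\deg e_1=\deg e_2=0$, $\deg v_i=-\deg u_i$, and one of: (a) $G=\mathbb Z^2$, $(\deg u_1,\deg u_2,\deg u_3)=((1,0),(0,1),(-1,-1))$; (b) $G=\mathbb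 Z$, $(\deg u_1,\deg u_2,\deg u_3)=(1,-1,0)$ or $(0,-1,1)$ ($3$-gradings); (c) $G=\mathbb Z$, $(\deg u_1,\deg u_2,\deg u_3)=(1,1,-2)$ or $(-2,1,1)$ ($5$-gradings); (d) $G=\mathbb Z_3$, $(\deg u_1,\deg u_2,\deg u_3)=(\bar1,\bar1,\bar1)$; (e) $G=\mathbb Z_4$, $(\deg u_1,\deg u_2,\deg u_3)=(\bar1,\bar1,\bar2)$ or $(\bar2,\bar1,\bar1)$; (f) $G=\mathbb Z\times\mathbb Z_2$, $(\deg u_1,\deg u_2,\deg u_3)=((0,\bar1),(1,\bar0),(-1,\bar1))$ or $((-1,\bar1),(1,\bar0),(0,\bar1))$. -/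

import Mathlib

/-! ### Hurwitz algebras and the Cayley-Dickson doubling process -/

/-- `q` makes the unital (not necessarily associative) `F`-algebra `Q` a Hurwitz algebra: it is
multiplicative and its polar form is nondegenerate. (Nondegeneracy of the polar form is regularity
of `q`, except in dimension one and characteristic two, a dimension that is not used below.) -/
structure IsHurwitzNorm {F Q : Type*} [Field F] [NonAssocRing Q] [Module F Q]
    (q : QuadraticForm F Q) : Prop where
  map_mul : ∀ x y : Q, q (x * y) = q x * q y
  nondegenerate : ∀ x : Q, (∀ y : Q, QuadraticMap.polar q x y = 0) → x = 0

/-- A Hurwitz algebra is split if its norm has a nonzero isotropic vector. -/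
def IsSplitNorm {F Q : Type*} [Field F] [NonAssocRing Q] [Module F Q]
    (q : QuadraticForm F Q) : Prop :=
  ∃ x : Q, x ≠ 0 ∧ q x = 0

/-- The canonical involution `x ↦ q(x,1) 1 - x`. -/
def hurwitzConj {F Q : Type*} [Field F] [NonAssocRing Q] [Module F Q]
    (q : QuadraticForm F Q) (x : Q) : Q :=
  QuadraticMap.polar q x 1 • (1 : Q) - x

/-- The underlying space of `CD(Q, α) = Q ⊕ Qu`; the pair `(a, b)` stands for `a + bu`. -/
def CD {F Q : Type*} [Field F] [NonAssocRing Q] [Module F Q]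
    (_q : QuadraticForm F Q) (_α : F) : Type _ := Q × Q

namespace CD

variable {F Q : Type*} [Field F] [NonAssocRing Q] [Module F Q]
  {q : QuadraticForm F Q} {α : F}

instance : AddCommGroup (CD q α) := inferInstanceAs (AddCommGroup (Q × Q))

instance : Module F (CD q α) := inferInstanceAs (Module F (Q × Q))

instance : One (CD q α) := ⟨((1 : Q), (0 : Q))⟩

/-- `(a + bu)(c + du) = (ac - α d̄ b) + (da + b c̄)u`. -/
instance : Mul (CD q α) :=
  ⟨fun x y => (x.1 * y.1 - α • (hurwitzConj q y.2 * x.2), y.2 * x.1 + x.2 * hurwitzConj q y.1)⟩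

theorem hurwitzConj_add (q : QuadraticForm F Q) (x y : Q) :
    hurwitzConj q (x + y) = hurwitzConj q x + hurwitzConj q y := by
  simp only [hurwitzConj, QuadraticMap.polar_add_left, add_smul]
  abel

theorem hurwitzConj_zero (q : QuadraticForm F Q) : hurwitzConj q (0 : Q) = 0 := by
  simp [hurwitzConj]

instance : NonUnitalNonAssocRing (CD q α) :=
  { (inferInstance : AddCommGroup (CD q α)), (inferInstance : Mul (CD q α)) with
    left_distrib := fun x y z => by
      refine Prod.ext ?_ ?_
      · change x.1 * (y.1 + z.1) - α • (hurwitzConj q (y.2 + z.2) * x.2) =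
          (x.1 * y.1 - α • (hurwitzConj q y.2 * x.2)) +
            (x.1 * z.1 - α • (hurwitzConj q z.2 * x.2))
        rw [hurwitzConj_add, mul_add, add_mul, smul_add]
        abel
      · change (y.2 + z.2) * x.1 + x.2 * hurwitzConj q (y.1 + z.1) =
          (y.2 * x.1 + x.2 * hurwitzConj q y.1) + (z.2 * x.1 + x.2 * hurwitzConj q z.1)
        rw [hurwitzConj_add, mul_add, add_mul]
        abel
    right_distrib := fun x y z => by
      refine Prod.ext ?_ ?_
      · change (x.1 + y.1) * z.1 - α • (hurwitzConj q z.2 * (x.2 + y.2)) =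
          (x.1 * z.1 - α • (hurwitzConj q z.2 * x.2)) +
            (y.1 * z.1 - α • (hurwitzConj q z.2 * y.2))
        rw [mul_add, add_mul, smul_add]
        abel
      · change z.2 * (x.1 + y.1) + (x.2 + y.2) * hurwitzConj q z.1 =
          (z.2 * x.1 + x.2 * hurwitzConj q z.1) + (z.2 * y.1 + y.2 * hurwitzConj q z.1)
        rw [mul_add, add_mul]
        abel
    zero_mul := fun x => by
      refine Prod.ext ?_ ?_
      · change (0 : Q) * x.1 - α • (hurwitzConj q x.2 * (0 : Q)) = 0
        simp
      · change x.2 * (0 : Q) + (0 : Q) * hurwitzConj q x.1 = 0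
        simp
    mul_zero := fun x => by
      refine Prod.ext ?_ ?_
      · change x.1 * (0 : Q) - α • (hurwitzConj q (0 : Q) * x.2) = 0
        simp [hurwitzConj_zero]
      · change (0 : Q) * x.1 + x.2 * hurwitzConj q (0 : Q) = 0
        simp [hurwitzConj_zero] }

/-- The norm `a + bu ↦ q(a) + α q(b)` of `CD(Q, α)`, so that `u` has norm `α`. -/
noncomputable def norm (q : QuadraticForm F Q) (α : F) : QuadraticForm F (CD q α) :=
  QuadraticMap.prod q (α • q)

/-- The main `ℤ/2`-grading: the even part is `Q`, the odd part is `Qu`. -/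
def main (q : QuadraticForm F Q) (α : F) (i : ZMod 2) : Submodule F (CD q α) :=
  if i = 0 then LinearMap.range (LinearMap.inl F Q Q) else LinearMap.range (LinearMap.inr F Q Q)

end CD

/-! ### Group gradings and universal grading groups -/

/-- `A` is a grading of the algebra `C` by the group `G`. -/
structure IsGroupGrading {F C G : Type*} [Field F] [NonUnitalNonAssocRing C] [Module F C]
    [Group G] (A : G → Submodule F C) : Prop where
  indep : iSupIndep A
  iSup_eq_top : ⨆ g, A g = ⊤
  mul_mem : ∀ g h : G, ∀ x ∈ A g, ∀ y ∈ A h, x * y ∈ A (g * h)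

/-- `A` is a grading by the group `G` of the superalgebra `C` with main grading `M`: a group
grading each of whose components is the sum of its even and its odd part. -/
structure IsSuperGrading {F C G : Type*} [Field F] [NonUnitalNonAssocRing C] [Module F C]
    [Group G] (M : ZMod 2 → Submodule F C) (A : G → Submodule F C) : Prop
    extends IsGroupGrading A where
  compatible : ∀ g : G, A g = (A g ⊓ M 0) ⊔ (A g ⊓ M 1)

/-- The defining relations `s₁ s₂ = s₃`, whenever `0 ≠ A^{s₁} A^{s₂} ⊆ A^{s₃}`, between the elements
of the support. -/
def universalRels {F C G : Type*} [Field F] [NonUnitalNonAssocRing C] [Module F C]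
    (A : G → Submodule F C) : Set (FreeGroup {s : G // A s ≠ ⊥}) :=
  {r | ∃ s₁ s₂ s₃ : {s : G // A s ≠ ⊥},
    (∃ x ∈ A s₁, ∃ y ∈ A s₂, x * y ≠ 0) ∧ (∀ x ∈ A s₁, ∀ y ∈ A s₂, x * y ∈ A s₃) ∧
    r = FreeGroup.of s₁ * FreeGroup.of s₂ * (FreeGroup.of s₃)⁻¹}

/-- The universal grading group: generated by the support, with the relations above. -/
abbrev UniversalGroup {F C G : Type*} [Field F] [NonUnitalNonAssocRing C] [Module F C]
    (A : G → Submodule F C) : Type _ :=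
  PresentedGroup (universalRels A)

/-- The grading by the universal grading group that `A` induces: `A^s` is placed in the degree
given by the class of `s`. -/
def universalGrading {F C G : Type*} [Field F] [NonUnitalNonAssocRing C] [Module F C]
    (A : G → Submodule F C) (t : UniversalGroup A) : Submodule F C :=
  ⨆ (s : {s : G // A s ≠ ⊥}) (_ : (PresentedGroup.of s : UniversalGroup A) = t), A s

/-- The universal grading group of `A` is `M` (written additively) and, under this identification,
the grading by its universal grading group is `X`. -/
def HasUniversalForm {F C G M : Type*} [Field F] [NonUnitalNonAssocRing C] [Module F C]
    [AddGroup M] (A : G → Submodule F C) (X : M → Submodule F C) : Prop :=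
  ∃ φ : UniversalGroup A ≃* Multiplicative M,
    ∀ m : M, universalGrading A (φ.symm (Multiplicative.ofAdd m)) = X m

/-! ### Canonical bases -/

/-- `e₁, e₂, u₁, v₁` is a canonical basis of a split quaternion algebra. -/
structure IsCanonicalBasis₄ (F : Type*) {C : Type*} [Field F] [NonUnitalNonAssocRing C]
    [Module F C] (e₁ e₂ u₁ v₁ : C) : Prop where
  linearIndependent : LinearIndependent F ![e₁, e₂, u₁, v₁]
  span_eq_top : Submodule.span F {e₁, e₂, u₁, v₁} = ⊤
  row_e₁ : e₁ * e₁ = e₁ ∧ e₁ * e₂ = 0 ∧ e₁ * u₁ = u₁ ∧ e₁ * v₁ = 0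
  row_e₂ : e₂ * e₁ = 0 ∧ e₂ * e₂ = e₂ ∧ e₂ * u₁ = 0 ∧ e₂ * v₁ = v₁
  row_u₁ : u₁ * e₁ = 0 ∧ u₁ * e₂ = u₁ ∧ u₁ * u₁ = 0 ∧ u₁ * v₁ = -e₁
  row_v₁ : v₁ * e₁ = v₁ ∧ v₁ * e₂ = 0 ∧ v₁ * u₁ = -e₂ ∧ v₁ * v₁ = 0

/-- `e₁, e₂, u₁, u₂, u₃, v₁, v₂, v₃` is a canonical basis of a split Cayley algebra. -/
structure IsCanonicalBasis₈ (F : Type*) {C : Type*} [Field F] [NonUnitalNonAssocRing C]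
    [Module F C] (e₁ e₂ u₁ u₂ u₃ v₁ v₂ v₃ : C) : Prop where
  linearIndependent : LinearIndependent F ![e₁, e₂, u₁, u₂, u₃, v₁, v₂, v₃]
  span_eq_top : Submodule.span F {e₁, e₂, u₁, u₂, u₃, v₁, v₂, v₃} = ⊤
  row_e₁ : e₁ * e₁ = e₁ ∧ e₁ * e₂ = 0 ∧ e₁ * u₁ = u₁ ∧ e₁ * u₂ = u₂ ∧ e₁ * u₃ = u₃ ∧
    e₁ * v₁ = 0 ∧ e₁ * v₂ = 0 ∧ e₁ * v₃ = 0
  row_e₂ : e₂ * e₁ = 0 ∧ e₂ * e₂ = e₂ ∧ e₂ * u₁ = 0 ∧ e₂ * u₂ = 0 ∧ e₂ * u₃ = 0 ∧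
    e₂ * v₁ = v₁ ∧ e₂ * v₂ = v₂ ∧ e₂ * v₃ = v₃
  row_u₁ : u₁ * e₁ = 0 ∧ u₁ * e₂ = u₁ ∧ u₁ * u₁ = 0 ∧ u₁ * u₂ = v₃ ∧ u₁ * u₃ = -v₂ ∧
    u₁ * v₁ = -e₁ ∧ u₁ * v₂ = 0 ∧ u₁ * v₃ = 0
  row_u₂ : u₂ * e₁ = 0 ∧ u₂ * e₂ = u₂ ∧ u₂ * u₁ = -v₃ ∧ u₂ * u₂ = 0 ∧ u₂ * u₃ = v₁ ∧
    u₂ * v₁ = 0 ∧ u₂ * v₂ = -e₁ ∧ u₂ * v₃ = 0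
  row_u₃ : u₃ * e₁ = 0 ∧ u₃ * e₂ = u₃ ∧ u₃ * u₁ = v₂ ∧ u₃ * u₂ = -v₁ ∧ u₃ * u₃ = 0 ∧
    u₃ * v₁ = 0 ∧ u₃ * v₂ = 0 ∧ u₃ * v₃ = -e₁
  row_v₁ : v₁ * e₁ = v₁ ∧ v₁ * e₂ = 0 ∧ v₁ * u₁ = -e₂ ∧ v₁ * u₂ = 0 ∧ v₁ * u₃ = 0 ∧
    v₁ * v₁ = 0 ∧ v₁ * v₂ = u₃ ∧ v₁ * v₃ = -u₂
  row_v₂ : v₂ * e₁ = v₂ ∧ v₂ * e₂ = 0 ∧ v₂ * u₁ = 0 ∧ v₂ * u₂ = -e₂ ∧ v₂ * u₃ = 0 ∧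
    v₂ * v₁ = -u₃ ∧ v₂ * v₂ = 0 ∧ v₂ * v₃ = u₁
  row_v₃ : v₃ * e₁ = v₃ ∧ v₃ * e₂ = 0 ∧ v₃ * u₁ = 0 ∧ v₃ * u₂ = 0 ∧ v₃ * u₃ = -e₂ ∧
    v₃ * v₁ = u₂ ∧ v₃ * v₂ = -u₁ ∧ v₃ * v₃ = 0

/-- The decomposition in which the members of the finite family `b` are homogeneous, `b i` having
degree `d i`: the component of degree `m` is spanned by the `b i` with `d i = m`. -/
def gradingOfDegrees (F : Type*) {C M : Type*} [Field F] [NonUnitalNonAssocRing C] [Module F C]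
    {n : ℕ} (b : Fin n → C) (d : Fin n → M) (m : M) : Submodule F C :=
  Submodule.span F {x | ∃ i, d i = m ∧ x = b i}

/-! ### Gradings attached to an iterated doubling -/

/-- The subspace `K = F1 + Fw`. -/
def planeOf (F : Type*) {C : Type*} [Field F] [NonUnitalNonAssocRing C] [One C] [Module F C]
    (w : C) : Submodule F C :=
  Submodule.span F {1, w}

/-- The subspace `Kx`, that is the set of all products `kx` with `k ∈ K = F1 + Fw`. The set of
products is closed under the linear operations, so the span adds nothing. -/
def planeMul (F : Type*) {C : Type*} [Field F] [NonUnitalNonAssocRing C] [One C] [Module F C]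
    (w x : C) : Submodule F C :=
  Submodule.span F {y | ∃ k ∈ planeOf F w, y = k * x}

/-- The elements `w, v, u` of `CD(Q, α)` describe an iterated doubling `C = Q ⊕ Qu`, `Q = K ⊕ Kv`,
`K = F1 + Fw` over a field of characteristic two: `w ∈ Q` has nonzero trace (so that `K` is a
two-dimensional Hurwitz subalgebra), `v ∈ Q` is nonisotropic and orthogonal to `K`, and `u ∈ C₁`
is nonisotropic. -/
structure IsDoubling {F Q : Type*} [Field F] [NonAssocRing Q] [Module F Q]
    (q : QuadraticForm F Q) (α : F) (w v u : CD q α) : Prop where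
  w_mem : w ∈ CD.main q α 0
  w_trace : QuadraticMap.polar (CD.norm q α) w 1 ≠ 0
  v_mem : v ∈ CD.main q α 0
  v_trace : QuadraticMap.polar (CD.norm q α) v 1 = 0
  v_orthogonal : QuadraticMap.polar (CD.norm q α) v w = 0
  v_norm : CD.norm q α v ≠ 0
  u_mem : u ∈ CD.main q α 1
  u_norm : CD.norm q α u ≠ 0

/-- The `(ℤ/2)²`-grading with components `K`, `Kv`, `Ku`, `K(vu)` in the degrees
`(0,0)`, `(1,0)`, `(0,1)`, `(1,1)`. -/
def doublingGrading (F : Type*) {C : Type*} [Field F] [NonUnitalNonAssocRing C] [One C]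
    [Module F C] (w v u : C) (m : ZMod 2 × ZMod 2) : Submodule F C :=
  if m = (0, 0) then planeOf F w
  else if m = (1, 0) then planeMul F w v
  else if m = (0, 1) then planeMul F w u
  else planeMul F w (v * u)

/-- Its coarsening `C⁰ = K ⊕ Ku`, `C¹ = Kv ⊕ K(vu)`. -/
def doublingCoarsening (F : Type*) {C : Type*} [Field F] [NonUnitalNonAssocRing C] [One C]
    [Module F C] (w v u : C) (m : ZMod 2) : Submodule F C :=
  if m = 0 then planeOf F w ⊔ planeMul F w u
  else planeMul F w v ⊔ planeMul F w (v * u)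

/-! Since `Q` has dimension 2 or 4 it is associative, so the norm n of C = CD(Q, α) is again
multiplicative and every x in C satisfies x² = n(x,1)x − n(x)1. Comparing homogeneous components in
this equation shows that elements of degree g ≠ 1 have trace zero, that they are isotropic unless g²
= 1, and that C^g is orthogonal to C^h unless gh = 1. Hence the polar form pairs the even parts of
C^g and C^(g⁻¹) with each other, and likewise the odd parts (`IsSuperGrading.exists_polar_eq_one`).

Everything now turns on whether the even part of C^1 contains an isotropic element of nonzero trace.
If it does not, then no nonzero element that is homogeneous for both gradings is isotropic
(`norm_ne_zero_of_homogeneous`). Either all of the even part has degree 1, and a dimension count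
yields the main grading, or, in dimension eight, a trace-one w of degree 1, an even v of another
degree and an odd u display C as an iterated doubling (`hasUniversalForm_doubling`).

If it does, rescaling gives a homogeneous idempotent e of trace one and norm zero. The orthogonal
complement of F1 + Fe is U ⊕ V, where U and V are the Peirce components of e and 1 − e; both are
totally isotropic, they are dual to each other, and UU ⊆ V. In dimension eight, homogeneous u₁, u₂,
u₃ in U with n(u₁u₂, u₃) = 1 generate a canonical basis (`exists_isHomogeneousTriple`), and their
degrees commute and have product 1. Only the coincidences g_i = 1, g_i = g_j and g_i² = 1 still
matter; after possibly interchanging u₁ and u₂, a case analysis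
(`IsHomogeneousTriple.classification`) leaves the main grading, a doubling, or one of the ten
systems of degrees. In dimension four a single pair u, v takes the place of the triple.

The universal group is identified by `hasUniversalForm_of_homogeneous`: it suffices to know which
spanning homogeneous pieces share a degree and which of their products are nonzero. The grading
group is never assumed abelian. -/

open QuadraticMap (polar)

/-! ### Homogeneous projections and a criterion for the universal group -/

theorem IsGroupGrading.exists_projection {F C G : Type*} [Field F] [NonUnitalNonAssocRing C]
    [Module F C] [Group G] {A : G → Submodule F C} (hA : IsGroupGrading A) :
    ∃ P : G → C →ₗ[F] C, (∀ g x, P g x ∈ A g) ∧ (∀ g, ∀ x ∈ A g, P g x = x) ∧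
      ∀ g h, ∀ x ∈ A g, g ≠ h → P h x = 0 := by
  classical
  have hint := DirectSum.isInternal_submodule_of_iSupIndep_of_iSup_eq_top hA.indep hA.iSup_eq_top
  let e := LinearEquiv.ofBijective (DirectSum.coeLinearMap A) hint
  have key : ∀ g, ∀ x (hx : x ∈ A g), e.symm x = DirectSum.lof F G (fun g => A g) g ⟨x, hx⟩ := by
    intro g x hx
    rw [LinearEquiv.symm_apply_eq]
    exact (DirectSum.coeLinearMap_lof A g ⟨x, hx⟩).symm
  refine ⟨fun g => (A g).subtype ∘ₗ DirectSum.component F G (fun g => A g) g ∘ₗ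
    e.symm.toLinearMap, ?_, ?_, ?_⟩
  · intro g x
    simp
  · intro g x hx
    simp [key g x hx, DirectSum.component.lof_self]
  · intro g h x hx hgh
    simp [key g x hx, DirectSum.component.of, hgh]

theorem IsGroupGrading.eq_of_mem_of_mem {F C G : Type*} [Field F] [NonUnitalNonAssocRing C]
    [Module F C] [Group G] {A : G → Submodule F C} (hA : IsGroupGrading A) {g h : G} {x : C}
    (hx : x ≠ 0) (hg : x ∈ A g) (hh : x ∈ A h) : g = h := by
  obtain ⟨P, -, hP, hP0⟩ := hA.exists_projection
  by_contra hne
  exact hx ((hP h x hh).symm.trans (hP0 g h x hg hne))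

/-- The projection to degree g fixes the pieces placed in degree g and kills the others, so
homogeneous pieces that span the algebra already determine every component. -/
theorem IsGroupGrading.component_eq_iSup {F C G ι : Type*} [Field F] [NonUnitalNonAssocRing C]
    [Module F C] [Group G] {A : G → Submodule F C} (hA : IsGroupGrading A)
    {B : ι → Submodule F C} {deg : ι → G} (hB : ∀ i, B i ≤ A (deg i)) (htop : ⨆ i, B i = ⊤)
    (g : G) : A g = ⨆ i, ⨆ (_ : deg i = g), B i := by
  apply le_antisymm
  · obtain ⟨P, -, hP, hP0⟩ := hA.exists_projection
    have key : ∀ y, P g y ∈ ⨆ i, ⨆ (_ : deg i = g), B i := by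
      intro y
      have hy : y ∈ ⨆ i, B i := htop ▸ Submodule.mem_top
      induction hy using Submodule.iSup_induction' with
      | mem i y hy =>
        by_cases h : deg i = g
        · rw [← h, hP _ y (hB i hy), h]
          exact Submodule.mem_iSup_of_mem i (Submodule.mem_iSup_of_mem h hy)
        · rw [hP0 _ _ y (hB i hy) h]
          exact zero_mem _
      | zero => simp
      | add y z _ _ hy hz => rw [map_add]; exact add_mem hy hz
    intro x hx
    rw [← hP g x hx]
    exact key x
  · refine iSup_le fun i => iSup_le fun h => ?_
    rw [← h]
    exact hB i

theorem exists_mul_ne_zero_of_iSup {F C ι κ : Type*} [Field F] [NonUnitalNonAssocRing C]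
    [Module F C] {B : ι → Submodule F C} {D : κ → Submodule F C} {x y : C}
    (hx : x ∈ ⨆ i, B i) (hy : y ∈ ⨆ j, D j) (hxy : x * y ≠ 0) :
    ∃ i j, ∃ a ∈ B i, ∃ b ∈ D j, a * b ≠ 0 := by
  by_contra! hcon
  apply hxy
  induction hx using Submodule.iSup_induction' with
  | mem i x hx =>
    clear hxy
    induction hy using Submodule.iSup_induction' with
    | mem j y hy => exact hcon i j x hx y hy
    | zero => simp
    | add y z _ _ hy hz => rw [mul_add, hy, hz, add_zero]
  | zero => simp
  | add x z _ _ hx hz =>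
    rw [add_mul]
    by_cases h1 : x * y = 0 <;> by_cases h2 : z * y = 0 <;> simp_all

/-- A criterion for identifying the universal grading group: `A` is spanned by the homogeneous
subspaces `B i`, and `M` is presented by the relations that their products give. -/
theorem hasUniversalForm_of_homogeneous {F C G M ι : Type*} [Field F] [NonUnitalNonAssocRing C]
    [Module F C] [Group G] [AddGroup M] {A : G → Submodule F C} {X : M → Submodule F C}
    (hA : IsGroupGrading A) (B : ι → Submodule F C) (deg : ι → G) (d : ι → M)
    (hB : ∀ i, B i ≤ A (deg i)) (hne : ∀ i, B i ≠ ⊥) (htop : ⨆ i, B i = ⊤)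
    (hX : ∀ m, X m = ⨆ i, ⨆ (_ : d i = m), B i)
    (hker : ∀ i j, deg i = deg j ↔ d i = d j)
    (hrel : ∀ i j, (∃ x ∈ B i, ∃ y ∈ B j, x * y ≠ 0) →
      ∃ k, deg i * deg j = deg k ∧ d i + d j = d k)
    (hlift : ∀ w : ι → UniversalGroup A, (∀ i j, deg i = deg j → w i = w j) →
      (∀ i j k, (∃ x ∈ B i, ∃ y ∈ B j, x * y ≠ 0) → deg i * deg j = deg k → w i * w j = w k) →
      ∃ f : Multiplicative M →* UniversalGroup A, ∀ i, f (Multiplicative.ofAdd (d i)) = w i)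
    (hgen : ∀ m, m ∈ AddSubgroup.closure (Set.range d)) :
    HasUniversalForm A X := by
  have hAB := hA.component_eq_iSup hB htop
  -- By bilinearity a nonzero product of two components comes from a nonzero product of two pieces
  -- inside them, so the defining relations of the universal group can be checked on pieces.
  have hmul : ∀ i j k, (∃ x ∈ A (deg i), ∃ y ∈ A (deg j), x * y ≠ 0) →
      (∀ x ∈ A (deg i), ∀ y ∈ A (deg j), x * y ∈ A (deg k)) → d i + d j = d k := by
    rintro i j k ⟨x, hx, y, hy, hxy⟩ hk
    have hdeg : deg i * deg j = deg k :=
      hA.eq_of_mem_of_mem hxy (hA.mul_mem _ _ x hx y hy) (hk x hx y hy)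
    rw [hAB, iSup_subtype'] at hx hy
    obtain ⟨i', j', hij⟩ := exists_mul_ne_zero_of_iSup hx hy hxy
    obtain ⟨l, hl, hdl⟩ := hrel _ _ hij
    rw [← (hker _ _).1 i'.2, ← (hker _ _).1 j'.2, hdl]
    apply (hker _ _).1
    rw [← hl, i'.2, j'.2, hdeg]
  have hsupp : ∀ s : {s : G // A s ≠ ⊥}, ∃ i, deg i = s := by
    rintro ⟨s, hs⟩
    by_contra! hcon
    apply hs
    rw [hAB]
    simp [hcon]
  choose idx hidx using hsupp
  have hAne : ∀ i, A (deg i) ≠ ⊥ := fun i h => hne i (le_bot_iff.1 (h ▸ hB i))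
  let σ : ι → {s : G // A s ≠ ⊥} := fun i => ⟨deg i, hAne i⟩
  have hσ : ∀ i, d (idx (σ i)) = d i := fun i => (hker _ _).1 (hidx (σ i))
  have hσ' : ∀ s, σ (idx s) = s := fun s => Subtype.ext (hidx s)
  -- The degrees in `M` respect the defining relations, which gives a homomorphism from the
  -- universal group to `M`; the map supplied by `hlift` will be its inverse.
  have hr : ∀ r ∈ universalRels A,
      FreeGroup.lift (fun s => Multiplicative.ofAdd (d (idx s))) r = 1 := by
    rintro r ⟨s₁, s₂, s₃, h1, h2, rfl⟩
    rw [← hidx s₁, ← hidx s₂] at h1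
    rw [← hidx s₁, ← hidx s₂, ← hidx s₃] at h2
    have := hmul _ _ _ h1 h2
    simp [← ofAdd_add, this]
  let f : UniversalGroup A →* Multiplicative M := PresentedGroup.toGroup hr
  have hf : ∀ s, f (PresentedGroup.of s) = Multiplicative.ofAdd (d (idx s)) :=
    fun s => PresentedGroup.toGroup.of hr
  obtain ⟨k, hk⟩ := hlift (fun i => PresentedGroup.of (σ i))
    (fun i j hij => by congr 1; exact Subtype.ext hij) (by
      rintro i j l ⟨x, hx, y, hy, hxy⟩ hl
      have : (FreeGroup.of (σ i) * FreeGroup.of (σ j) * (FreeGroup.of (σ l))⁻¹) ∈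
          universalRels A :=
        ⟨σ i, σ j, σ l, ⟨x, hB i hx, y, hB j hy, hxy⟩,
          fun x hx y hy => by
            change x * y ∈ A (deg l)
            exact hl ▸ hA.mul_mem _ _ x hx y hy, rfl⟩
      have h1 := PresentedGroup.one_of_mem this
      rw [map_mul, map_mul, map_inv, mul_inv_eq_one] at h1
      exact h1)
  have hkf : k.comp f = MonoidHom.id _ := by
    apply PresentedGroup.ext
    intro s
    simp only [MonoidHom.comp_apply, hf, hk, hσ', MonoidHom.id_apply]
  have hfk' : ∀ m : M, f (k (Multiplicative.ofAdd m)) = Multiplicative.ofAdd m := by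
    intro m
    induction hgen m using AddSubgroup.closure_induction with
    | mem x hx =>
      obtain ⟨i, rfl⟩ := hx
      rw [hk, hf, hσ]
    | zero => simp
    | add x y _ _ hx hy => rw [ofAdd_add, map_mul, map_mul, hx, hy]
    | neg x _ hx => rw [ofAdd_neg, map_inv, map_inv, hx]
  have hfk : f.comp k = MonoidHom.id _ := MonoidHom.ext fun m => hfk' m.toAdd
  refine ⟨MonoidHom.toMulEquiv f k hkf hfk, fun m => ?_⟩
  change universalGrading A (k (Multiplicative.ofAdd m)) = X m
  rw [hX]
  apply le_antisymm
  · refine iSup_le fun s => iSup_le fun hs => ?_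
    have hm : d (idx s) = m := by
      have := congrArg f hs
      rw [hf, hfk'] at this
      exact Multiplicative.ofAdd.injective this
    rw [hAB]
    refine iSup_le fun i => iSup_le fun hi => ?_
    refine le_iSup₂_of_le i ?_ le_rfl
    rw [← hm]
    exact (hker _ _).1 (hi.trans (hidx s).symm)
  · refine iSup_le fun i => iSup_le fun hi => ?_
    refine le_iSup₂_of_le (σ i) ?_ (hB i)
    rw [← hi, hk]

/-! ### Identities in Hurwitz algebras, and associativity in dimensions 2 and 4 -/

theorem add_self_of_charTwo (F : Type*) {C : Type*} [Field F] [CharP F 2] [AddCommGroup C]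
    [Module F C] (x : C) : x + x = 0 := by
  have : (1 + 1 : F) • x = 0 := by rw [CharTwo.add_self_eq_zero, zero_smul]
  rwa [add_smul, one_smul] at this

theorem neg_of_charTwo (F : Type*) {C : Type*} [Field F] [CharP F 2] [AddCommGroup C]
    [Module F C] (x : C) : -x = x :=
  neg_eq_of_add_eq_zero_left (add_self_of_charTwo F x)

theorem polar_self_of_charTwo {F C : Type*} [Field F] [CharP F 2] [AddCommGroup C]
    [Module F C] (n : QuadraticForm F C) (x : C) : polar n x x = 0 := by
  rw [QuadraticMap.polar_self, two_nsmul, CharTwo.add_self_eq_zero]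

/-- Families with a diagonal nonsingular Gram matrix are linearly independent. -/
theorem linearIndependent_of_polar {F C ι : Type*} [Field F] [AddCommGroup C] [Module F C]
    [Fintype ι] (n : QuadraticForm F C) (x y : ι → C) (h0 : ∀ i j, i ≠ j → polar n (x i) (y j) = 0)
    (h1 : ∀ i, polar n (x i) (y i) ≠ 0) : LinearIndependent F x := by
  rw [Fintype.linearIndependent_iff]
  intro c hc j
  have h2 : n.polarBilin (∑ i, c i • x i) (y j) = 0 := by rw [hc]; simp
  rw [map_sum, LinearMap.sum_apply, Finset.sum_eq_single j] at h2
  · simp only [map_smul, LinearMap.smul_apply, smul_eq_mul, QuadraticMap.polarBilin_apply_apply,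
      mul_eq_zero] at h2
    exact h2.resolve_right (h1 j)
  · intro i _ hij
    simp [h0 i j hij]
  · simp

namespace IsHurwitzNorm

section Basic

variable {F C : Type*} [Field F] [NonAssocRing C] [Module F C] {n : QuadraticForm F C}

theorem eq_of_polar (hn : IsHurwitzNorm n) {x y : C} (h : ∀ z, polar n x z = polar n y z) :
    x = y := by
  rw [← sub_eq_zero]
  apply hn.nondegenerate
  intro z
  rw [QuadraticMap.polar_sub_left, h, sub_self]

theorem map_one [Nontrivial C] (hn : IsHurwitzNorm n) : n 1 = 1 := by
  by_contra h
  have h0 : n 1 = 0 := by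
    have := hn.map_mul 1 1
    rw [mul_one] at this
    by_contra h0
    exact h (mul_left_cancel₀ h0 (by rw [← this, mul_one]))
  have hz : ∀ x, n x = 0 := fun x => by
    rw [← mul_one x, hn.map_mul, h0, mul_zero]
  exact one_ne_zero (hn.nondegenerate 1 fun y => by simp [polar, hz])

theorem polar_mul_left (hn : IsHurwitzNorm n) (x y z : C) :
    polar n (x * y) (x * z) = n x * polar n y z := by
  simp only [polar, ← mul_add, hn.map_mul]
  ring

theorem polar_mul_right (hn : IsHurwitzNorm n) (x y z : C) :
    polar n (y * x) (z * x) = polar n y z * n x := by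
  simp only [polar, ← add_mul, hn.map_mul]
  ring

/-- The full linearisation of n(xy) = n(x)n(y), from which the adjoint formulas and the alternative
laws all follow. -/
theorem polar_mul_add (hn : IsHurwitzNorm n) (x y z t : C) :
    polar n (x * y) (z * t) + polar n (z * y) (x * t) = polar n x z * polar n y t := by
  have h := hn.polar_mul_left (x + z) y t
  have h1 := hn.polar_mul_left x y t
  have h2 := hn.polar_mul_left z y t
  rw [add_mul, add_mul, QuadraticMap.polar_add_left, QuadraticMap.polar_add_right,
    QuadraticMap.polar_add_right, h1, h2, QuadraticMap.map_add n x z] at h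
  linear_combination h


theorem polar_mul_conj_left [IsScalarTower F C C] (hn : IsHurwitzNorm n) (x y z : C) :
    polar n (x * y) z = polar n y (hurwitzConj n x * z) := by
  have h := hn.polar_mul_add x y 1 z
  rw [one_mul, one_mul] at h
  simp only [hurwitzConj, sub_mul, smul_mul_assoc, one_mul, QuadraticMap.polar_sub_right,
    QuadraticMap.polar_smul_right, smul_eq_mul]
  linear_combination h

theorem polar_mul_conj_right [SMulCommClass F C C] (hn : IsHurwitzNorm n) (x y z : C) :
    polar n (x * y) z = polar n x (z * hurwitzConj n y) := by
  have h := hn.polar_mul_add x y z 1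
  rw [mul_one, mul_one] at h
  simp only [hurwitzConj, mul_sub, mul_smul_comm, mul_one, QuadraticMap.polar_sub_right,
    QuadraticMap.polar_smul_right, smul_eq_mul]
  rw [QuadraticMap.polar_comm n x (z * y)]
  linear_combination h

/-- Left alternativity combined with the quadratic equation of x; nondegeneracy reduces it to the
linearised composition law with one entry equal to 1. -/
theorem mul_mul_left (hn : IsHurwitzNorm n) (x y : C) :
    x * (x * y) = polar n x 1 • (x * y) - n x • y := by
  apply hn.eq_of_polar
  intro z
  have h := hn.polar_mul_add x (x * y) 1 z
  rw [one_mul, one_mul, hn.polar_mul_left] at h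
  simp only [QuadraticMap.polar_sub_left, QuadraticMap.polar_smul_left, smul_eq_mul]
  linear_combination h

theorem mul_mul_right (hn : IsHurwitzNorm n) (x y : C) :
    y * x * x = polar n x 1 • (y * x) - n x • y := by
  apply hn.eq_of_polar
  intro z
  have h := hn.polar_mul_add (y * x) x z 1
  rw [mul_one, mul_one, QuadraticMap.polar_comm n (z * x), hn.polar_mul_right] at h
  simp only [QuadraticMap.polar_sub_left, QuadraticMap.polar_smul_left, smul_eq_mul]
  linear_combination h

theorem mul_self (hn : IsHurwitzNorm n) (x : C) : x * x = polar n x 1 • x - n x • 1 := by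
  simpa using hn.mul_mul_left x 1

theorem mul_mul_left_add (hn : IsHurwitzNorm n) (x y z : C) :
    x * (y * z) + y * (x * z) =
      polar n x 1 • (y * z) + polar n y 1 • (x * z) - polar n x y • z := by
  have h := hn.mul_mul_left (x + y) z
  have hx := hn.mul_mul_left x z
  have hy := hn.mul_mul_left y z
  simp only [add_mul, mul_add, QuadraticMap.polar_add_left, QuadraticMap.map_add n x y,
    add_smul, smul_add] at h
  rw [hx, hy] at h
  linear_combination (norm := module) h

theorem mul_mul_right_add (hn : IsHurwitzNorm n) (x y z : C) :
    z * x * y + z * y * x =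
      polar n x 1 • (z * y) + polar n y 1 • (z * x) - polar n x y • z := by
  have h := hn.mul_mul_right (x + y) z
  have hx := hn.mul_mul_right x z
  have hy := hn.mul_mul_right y z
  simp only [add_mul, mul_add, QuadraticMap.polar_add_left, QuadraticMap.map_add n x y,
    add_smul, smul_add] at h
  rw [hx, hy] at h
  linear_combination (norm := module) h

theorem mul_add_mul (hn : IsHurwitzNorm n) (x y : C) :
    x * y + y * x = polar n x 1 • y + polar n y 1 • x - polar n x y • 1 := by
  simpa using hn.mul_mul_left_add x y 1

theorem map_conj [Nontrivial C] (hn : IsHurwitzNorm n) (x : C) : n (hurwitzConj n x) = n x := by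
  rw [hurwitzConj, sub_eq_add_neg, QuadraticMap.map_add n, QuadraticMap.map_neg,
    QuadraticMap.map_smul, hn.map_one, QuadraticMap.polar_neg_right,
    QuadraticMap.polar_smul_left, QuadraticMap.polar_comm n 1 x]
  simp

theorem exists_trace_ne_zero [Nontrivial C] (hn : IsHurwitzNorm n) : ∃ w, polar n w 1 ≠ 0 := by
  by_contra! h
  exact one_ne_zero (hn.nondegenerate 1 fun y => by rw [QuadraticMap.polar_comm, h])

/-- The associator of a Hurwitz algebra vanishes as soon as it does on a triple of the form
`w, v, wv`, where `1, w, v, wv` span; it does so by the alternative laws. -/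
theorem mul_assoc_of_span [IsScalarTower F C C] [SMulCommClass F C C] (hn : IsHurwitzNorm n)
    {w v : C} (hspan : Submodule.span F {1, w, v, w * v} = ⊤) (x y z : C) :
    x * y * z = x * (y * z) := by
  let f : C → C → C → C := fun x y z => x * y * z - x * (y * z)
  have f12 : ∀ x z, f x x z = 0 := fun x z => by
    simp only [f]
    rw [hn.mul_mul_left, hn.mul_self, sub_mul, smul_mul_assoc, smul_mul_assoc, one_mul, sub_self]
  have f23 : ∀ x z, f x z z = 0 := fun x z => by
    simp only [f]
    rw [hn.mul_mul_right, hn.mul_self, mul_sub, mul_smul_comm, mul_smul_comm, mul_one, sub_self]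
  have add1 : ∀ x x' y z, f (x + x') y z = f x y z + f x' y z := fun x x' y z => by
    simp only [f, add_mul]; abel
  have add2 : ∀ x y y' z, f x (y + y') z = f x y z + f x y' z := fun x y y' z => by
    simp only [f, add_mul, mul_add]; abel
  have add3 : ∀ x y z z', f x y (z + z') = f x y z + f x y z' := fun x y z z' => by
    simp only [f, mul_add]; abel
  have smul1 : ∀ (a : F) x y z, f (a • x) y z = a • f x y z := fun a x y z => by
    simp only [f, smul_mul_assoc, smul_sub]
  have smul2 : ∀ (a : F) x y z, f x (a • y) z = a • f x y z := fun a x y z => by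
    simp only [f, smul_mul_assoc, mul_smul_comm, smul_sub]
  have smul3 : ∀ (a : F) x y z, f x y (a • z) = a • f x y z := fun a x y z => by
    simp only [f, mul_smul_comm, smul_sub]
  have s12 : ∀ x y z, f x y z = 0 → f y x z = 0 := fun x y z h => by
    have := f12 (x + y) z
    simpa [add1, add2, f12, h] using this
  have s23 : ∀ x y z, f x y z = 0 → f x z y = 0 := fun x y z h => by
    have := f23 x (y + z)
    simpa [add2, add3, f23, h] using this
  have s13 : ∀ x y z, f x y z = 0 → f z y x = 0 :=
    fun x y z h => s12 _ _ _ (s23 _ _ _ (s12 _ _ _ h))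
  have f13 : ∀ x y, f x y x = 0 := fun x y => s23 _ _ _ (f12 x y)
  have o1 : ∀ y z, f 1 y z = 0 := fun y z => by simp [f]
  -- Alternativity lets the last two arguments be exchanged, after which both bracketings of w, wv,
  -- v reduce by the quadratic equations of w and v.
  have key : f w v (w * v) = 0 := by
    apply s23
    simp only [f]
    rw [hn.mul_mul_left, hn.mul_mul_right v w, sub_mul, smul_mul_assoc, smul_mul_assoc,
      hn.mul_mul_right v w, hn.mul_self v, mul_sub, mul_smul_comm, mul_smul_comm,
      hn.mul_mul_left, hn.mul_self w]
    module
  have span : ∀ x, ∃ a b c d : F, x = a • 1 + b • w + c • v + d • (w * v) := by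
    intro x
    have hx : x ∈ Submodule.span F {1, w, v, w * v} := hspan ▸ Submodule.mem_top
    simp only [Submodule.mem_span_insert, Submodule.mem_span_singleton] at hx
    obtain ⟨a, _, ⟨b, _, ⟨c, _, ⟨d, rfl⟩, rfl⟩, rfl⟩, rfl⟩ := hx
    exact ⟨a, b, c, d, by abel⟩
  have h1 : ∀ z, f w v z = 0 := fun z => by
    obtain ⟨a, b, c, d, rfl⟩ := span z
    simp only [add3, smul3, key, f13, f23, s13 _ _ _ (o1 v w), smul_zero, add_zero]
  have h2 : ∀ z, f w (w * v) z = 0 := fun z => by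
    obtain ⟨a, b, c, d, rfl⟩ := span z
    simp only [add3, smul3, s23 _ _ _ key, f13, f23, s13 _ _ _ (o1 _ _), smul_zero, add_zero]
  have h3 : ∀ z, f v (w * v) z = 0 := fun z => by
    obtain ⟨a, b, c, d, rfl⟩ := span z
    simp only [add3, smul3, s13 _ _ _ (s23 _ _ _ key), f13, f23, s13 _ _ _ (o1 _ _), smul_zero,
      add_zero]
  have h4 : f x y z = 0 := by
    obtain ⟨a, b, c, d, rfl⟩ := span x
    obtain ⟨a', b', c', d', rfl⟩ := span y
    simp only [add1, add2, smul1, smul2, h1, h2, h3, s12 _ _ _ (h1 _), s12 _ _ _ (h2 _),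
      s12 _ _ _ (h3 _), f12, o1, s12 _ _ _ (o1 _ _), smul_zero, add_zero]
  exact sub_eq_zero.1 h4

end Basic

section CharTwo

variable {F C : Type*} [Field F] [CharP F 2] [NonAssocRing C] [Module F C] {n : QuadraticForm F C}

/-- In characteristic two the polar form is alternating, so the Gram matrix of 1, w is antidiagonal;
this is why the coefficient of 1 is read off from w and that of w from 1. -/
theorem exists_orthogonal_sub {w : C}
    (hw : polar n w 1 ≠ 0) (x : C) : ∃ a b : F, polar n (x - (a • 1 + b • w)) 1 = 0 ∧
      polar n (x - (a • 1 + b • w)) w = 0 := by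
  refine ⟨polar n x w / polar n w 1, polar n x 1 / polar n w 1, ?_, ?_⟩ <;>
  · simp only [QuadraticMap.polar_sub_left, QuadraticMap.polar_add_left,
      QuadraticMap.polar_smul_left, polar_self_of_charTwo, smul_eq_mul,
      QuadraticMap.polar_comm n 1 w]
    field_simp
    ring

theorem exists_orthogonal_of_not_le {w : C}
    (hw : polar n w 1 ≠ 0) {S : Submodule F C} (h1 : 1 ∈ S) (hwS : w ∈ S)
    (hS : ¬ S ≤ Submodule.span F {1, w}) :
    ∃ x ∈ S, x ≠ 0 ∧ polar n x 1 = 0 ∧ polar n x w = 0 := by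
  obtain ⟨x, hx, hx'⟩ := SetLike.not_le_iff_exists.1 hS
  obtain ⟨a, b, ha, hb⟩ := exists_orthogonal_sub hw x
  refine ⟨_, sub_mem hx (add_mem (S.smul_mem a h1) (S.smul_mem b hwS)), ?_, ha, hb⟩
  intro h
  apply hx'
  rw [sub_eq_zero.1 h]
  exact Submodule.mem_span_pair.2 ⟨a, b, rfl⟩

/-- The orthogonal complement of a nondegenerate proper plane is nondegenerate and nonzero; if the
norm vanished on it, so would its polar form. -/
theorem exists_anisotropic_orthogonal (hn : IsHurwitzNorm n) {w : C}
    (hw : polar n w 1 ≠ 0) (hS : Submodule.span F {1, w} ≠ ⊤) :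
    ∃ v, polar n v 1 = 0 ∧ polar n v w = 0 ∧ n v ≠ 0 := by
  obtain ⟨x, -, hx0, hx1, hxw⟩ := exists_orthogonal_of_not_le hw (S := ⊤) trivial trivial
    (fun h => hS (top_le_iff.1 h))
  obtain ⟨y, hy⟩ : ∃ y, polar n x y ≠ 0 := by
    by_contra! h
    exact hx0 (hn.nondegenerate x h)
  obtain ⟨a, b, ha, hb⟩ := exists_orthogonal_sub hw y
  set z := y - (a • 1 + b • w) with hz
  have hxz : polar n x z ≠ 0 := by
    simpa [hz, QuadraticMap.polar_sub_right, QuadraticMap.polar_add_right,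
      QuadraticMap.polar_smul_right, hx1, hxw] using hy
  by_contra! h
  apply hxz
  have h1 := h (x + z) (by rw [QuadraticMap.polar_add_left, hx1, ha, add_zero])
    (by rw [QuadraticMap.polar_add_left, hxw, hb, add_zero])
  rw [QuadraticMap.map_add n, h x hx1 hxw, h z ha hb] at h1
  simpa using h1

theorem finrank_span_one_pair {w : C}
    (hw : polar n w 1 ≠ 0) : Module.finrank F (Submodule.span F {1, w}) = 2 := by
  have hli : LinearIndependent F ![1, w] := by
    apply linearIndependent_of_polar n ![1, w] ![w, 1]
    · intro i j hij
      fin_cases i <;> fin_cases j <;> simp_all [CharTwo.two_eq_zero]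
    · intro i
      fin_cases i <;> simp_all [QuadraticMap.polar_comm n 1 w]
  have := finrank_span_eq_card hli
  rwa [Matrix.range_cons, Matrix.range_cons, Matrix.range_empty, Set.union_empty,
    Set.singleton_union, Fintype.card_fin] at this

variable [IsScalarTower F C C]

/-- The planes F1 + Fw and Fv + F(wv) are orthogonal, and each has an antidiagonal Gram matrix, the
second with entry n(w,1)n(v). The dual family is therefore w, 1, wv, v up to scalars. -/
theorem span_one_pair_mul_eq_top (hn : IsHurwitzNorm n)
    (h4 : Module.finrank F C = 4) {w v : C} (hw : polar n w 1 ≠ 0) (hv1 : polar n v 1 = 0)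
    (hvw : polar n v w = 0) (hv : n v ≠ 0) : Submodule.span F {1, w, v, w * v} = ⊤ := by
  have e1 : polar n (w * v) 1 = 0 := by
    rw [hn.polar_mul_conj_left, mul_one, hurwitzConj, QuadraticMap.polar_sub_right,
      QuadraticMap.polar_smul_right, hv1, hvw, smul_zero, sub_zero]
  have e2 : polar n (w * v) w = 0 := by
    have := hn.polar_mul_left w v 1
    rwa [mul_one, hv1, mul_zero] at this
  have e3 : polar n (w * v) v = polar n w 1 * n v := by
    have := hn.polar_mul_right v w 1
    rwa [one_mul] at this
  have hli : LinearIndependent F ![1, w, v, w * v] := by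
    apply linearIndependent_of_polar n ![1, w, v, w * v] ![w, 1, w * v, v]
    · intro i j hij
      fin_cases i <;> fin_cases j <;>
        first
        | exact absurd rfl hij
        | simp [e1, e2, hv1, hvw, QuadraticMap.polar_comm n 1 v, QuadraticMap.polar_comm n w v,
            QuadraticMap.polar_comm n 1 (w * v), QuadraticMap.polar_comm n w (w * v),
            CharTwo.two_eq_zero]
    · intro i
      fin_cases i <;> simp [e3, hw, hv, QuadraticMap.polar_comm n 1 w,
        QuadraticMap.polar_comm n v (w * v)]
  have : FiniteDimensional F C := Module.finite_of_finrank_pos (by omega)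
  have := hli.span_eq_top_of_card_eq_finrank' (by simp [h4])
  rwa [Matrix.range_cons, Matrix.range_cons, Matrix.range_cons, Matrix.range_cons,
    Matrix.range_empty, Set.union_empty, Set.singleton_union, Set.singleton_union,
    Set.singleton_union] at this

theorem mul_assoc_of_finrank [SMulCommClass F C C] (hn : IsHurwitzNorm n)
    (hd : Module.finrank F C = 2 ∨ Module.finrank F C = 4) (x y z : C) :
    x * y * z = x * (y * z) := by
  have : Nontrivial C := by
    apply Module.nontrivial_of_finrank_pos (R := F)
    omega
  obtain ⟨w, hw⟩ := hn.exists_trace_ne_zero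
  have h2 := finrank_span_one_pair hw
  rcases hd with hd | hd
  · have : FiniteDimensional F C := Module.finite_of_finrank_pos (by omega)
    have htop := Submodule.eq_top_of_finrank_eq (h2.trans hd.symm)
    -- In dimension two 1 and w already span, so w can serve as v as well.
    refine hn.mul_assoc_of_span (w := w) (v := w) (top_le_iff.1 ?_) x y z
    rw [← htop]
    exact Submodule.span_mono (by grind)
  · obtain ⟨v, hv1, hvw, hv⟩ := hn.exists_anisotropic_orthogonal hw (by
      intro h
      rw [h, finrank_top] at h2
      omega)
    exact hn.mul_assoc_of_span (hn.span_one_pair_mul_eq_top hd hw hv1 hvw hv) x y z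

end CharTwo

end IsHurwitzNorm

/-! ### The doubled algebra as a Hurwitz superalgebra -/

namespace CD

section

variable {F Q : Type*} [Field F] [NonAssocRing Q] [Module F Q] {q : QuadraticForm F Q} {α : F}

/-- The element `a + bu` of `CD(Q, α)`. -/
def mk (a b : Q) : CD q α := (a, b)

/-- The even coordinate of an element of `CD(Q, α)`. -/
def fst (x : CD q α) : Q := Prod.fst x

/-- The odd coordinate of an element of `CD(Q, α)`. -/
def snd (x : CD q α) : Q := Prod.snd x

theorem ext {x y : CD q α} (h1 : x.fst = y.fst) (h2 : x.snd = y.snd) : x = y := Prod.ext h1 h2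

@[simp] theorem fst_mk (a b : Q) : (mk a b : CD q α).fst = a := rfl
@[simp] theorem snd_mk (a b : Q) : (mk a b : CD q α).snd = b := rfl
@[simp] theorem fst_zero : (0 : CD q α).fst = 0 := rfl
@[simp] theorem snd_zero : (0 : CD q α).snd = 0 := rfl
@[simp] theorem fst_one : (1 : CD q α).fst = 1 := rfl
@[simp] theorem snd_one : (1 : CD q α).snd = 0 := rfl
@[simp] theorem fst_add (x y : CD q α) : (x + y).fst = x.fst + y.fst := rfl
@[simp] theorem snd_add (x y : CD q α) : (x + y).snd = x.snd + y.snd := rfl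
@[simp] theorem fst_smul (a : F) (x : CD q α) : (a • x).fst = a • x.fst := rfl
@[simp] theorem snd_smul (a : F) (x : CD q α) : (a • x).snd = a • x.snd := rfl

@[simp] theorem fst_mul (x y : CD q α) :
    (x * y).fst = x.fst * y.fst - α • (hurwitzConj q y.snd * x.snd) := rfl

@[simp] theorem snd_mul (x y : CD q α) :
    (x * y).snd = y.snd * x.fst + x.snd * hurwitzConj q y.fst := rfl

theorem norm_apply (x : CD q α) : norm q α x = q x.fst + α * q x.snd := rfl

theorem polar_norm (x y : CD q α) :
    polar (norm q α) x y = polar q x.fst y.fst + α * polar q x.snd y.snd := by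
  simp only [polar, norm_apply, fst_add, snd_add]
  ring

theorem hurwitzConj_smul (a : F) (x : Q) : hurwitzConj q (a • x) = a • hurwitzConj q x := by
  simp only [hurwitzConj, QuadraticMap.polar_smul_left, smul_eq_mul, mul_smul, smul_sub]

theorem hurwitzConj_one [CharP F 2] : hurwitzConj q (1 : Q) = 1 := by
  rw [hurwitzConj, polar_self_of_charTwo, zero_smul, zero_sub, neg_of_charTwo F]

instance [CharP F 2] : NonAssocRing (CD q α) :=
  { (inferInstance : NonUnitalNonAssocRing (CD q α)), (inferInstance : One (CD q α)) with
    one_mul := fun x => by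
      apply ext
      · simp
      · simp
    mul_one := fun x => by
      apply ext
      · simp [hurwitzConj_zero]
      · simp [hurwitzConj_one] }

instance [IsScalarTower F Q Q] [SMulCommClass F Q Q] : IsScalarTower F (CD q α) (CD q α) :=
  ⟨fun a x y => by
    apply ext
    · simp only [smul_eq_mul, fst_mul, fst_smul, snd_smul]
      rw [smul_mul_assoc, mul_smul_comm, smul_sub, smul_comm α a]
    · simp only [smul_eq_mul, snd_mul, fst_smul, snd_smul]
      rw [smul_mul_assoc, mul_smul_comm, smul_add]⟩

instance [IsScalarTower F Q Q] [SMulCommClass F Q Q] : SMulCommClass F (CD q α) (CD q α) :=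
  ⟨fun a x y => by
    apply ext
    · simp only [smul_eq_mul, fst_mul, fst_smul, snd_smul]
      rw [hurwitzConj_smul, smul_mul_assoc, mul_smul_comm, smul_sub, smul_comm α a]
    · simp only [smul_eq_mul, snd_mul, fst_smul, snd_smul]
      rw [hurwitzConj_smul, smul_mul_assoc, mul_smul_comm, smul_add]⟩

/-- In the norm of a product, the cross terms q(ac, d̄b) and q(da, bc̄) cancel. They agree because
conjugation gives the adjoints of multiplications and d(ac) = (da)c; associativity of `Q` is used
only here. -/
theorem isHurwitzNorm_norm [IsScalarTower F Q Q] [SMulCommClass F Q Q] [Nontrivial Q]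
    (hq : IsHurwitzNorm q) (hassoc : ∀ x y z : Q, x * y * z = x * (y * z)) (hα : α ≠ 0)
    [CharP F 2] : IsHurwitzNorm (norm q α) where
  map_mul x y := by
    simp only [norm_apply, fst_mul, snd_mul]
    rw [sub_eq_add_neg, QuadraticMap.map_add q, QuadraticMap.map_add q (y.snd * x.fst),
      QuadraticMap.map_neg, QuadraticMap.map_smul, QuadraticMap.polar_neg_right,
      QuadraticMap.polar_smul_right]
    simp only [hq.map_mul, hq.map_conj, smul_eq_mul]
    have h1 : polar q (y.snd * x.fst) (x.snd * hurwitzConj q y.fst) =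
        polar q (x.fst * y.fst) (hurwitzConj q y.snd * x.snd) := by
      rw [← hq.polar_mul_conj_right, ← hq.polar_mul_conj_left, hassoc]
    rw [h1]
    ring
  nondegenerate x hx := by
    apply ext
    · refine hq.nondegenerate _ fun y => ?_
      simpa [polar_norm] using hx (mk y 0)
    · refine hq.nondegenerate _ fun y => ?_
      simpa [polar_norm, hα] using hx (mk 0 y)

theorem mem_main_zero (x : CD q α) : x ∈ main q α 0 ↔ x.snd = 0 := by
  rw [main, if_pos rfl]
  exact ⟨fun ⟨y, hy⟩ => hy ▸ rfl, fun h => ⟨x.fst, ext rfl h.symm⟩⟩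

theorem mem_main_one (x : CD q α) : x ∈ main q α 1 ↔ x.fst = 0 := by
  rw [main, if_neg one_ne_zero]
  exact ⟨fun ⟨y, hy⟩ => hy ▸ rfl, fun h => ⟨x.snd, ext h.symm rfl⟩⟩

theorem finrank_main_zero (q : QuadraticForm F Q) (α : F) :
    Module.finrank F (main q α 0) = Module.finrank F Q :=
  LinearEquiv.finrank_eq
    { toFun := fun x => x.1.fst
      invFun := fun y => ⟨mk y 0, (mem_main_zero _).2 rfl⟩
      map_add' := fun _ _ => rfl
      map_smul' := fun _ _ => rfl
      left_inv := fun x => Subtype.ext (ext rfl ((mem_main_zero _).1 x.2).symm)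
      right_inv := fun _ => rfl }

theorem finrank_main_one (q : QuadraticForm F Q) (α : F) :
    Module.finrank F (main q α 1) = Module.finrank F Q :=
  LinearEquiv.finrank_eq
    { toFun := fun x => x.1.snd
      invFun := fun y => ⟨mk 0 y, (mem_main_one _).2 rfl⟩
      map_add' := fun _ _ => rfl
      map_smul' := fun _ _ => rfl
      left_inv := fun x => Subtype.ext (ext ((mem_main_one _).1 x.2).symm rfl)
      right_inv := fun _ => rfl }

end

end CD

/-- The properties of the main grading of a Hurwitz superalgebra. -/
structure IsHurwitzSuper {F C : Type*} [Field F] [NonAssocRing C] [Module F C]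
    (n : QuadraticForm F C) (M : ZMod 2 → Submodule F C) : Prop extends IsHurwitzNorm n where
  one_mem : 1 ∈ M 0
  mul_mem : ∀ i j, ∀ x ∈ M i, ∀ y ∈ M j, x * y ∈ M (i + j)
  polar_eq_zero : ∀ x ∈ M 0, ∀ y ∈ M 1, polar n x y = 0
  sup_eq_top : M 0 ⊔ M 1 = ⊤
  exists_norm_ne_zero : ∃ u ∈ M 1, n u ≠ 0
  finrank_eq : Module.finrank F (M 0) = Module.finrank F (M 1)
  finrank_add : Module.finrank F C = Module.finrank F (M 0) + Module.finrank F (M 1)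

theorem CD.isHurwitzSuper_main {F Q : Type*} [Field F] [CharP F 2] [NonAssocRing Q] [Module F Q]
    [IsScalarTower F Q Q] [SMulCommClass F Q Q] {q : QuadraticForm F Q} (hq : IsHurwitzNorm q)
    (hd : Module.finrank F Q = 2 ∨ Module.finrank F Q = 4) {α : F} (hα : α ≠ 0) :
    IsHurwitzSuper (CD.norm q α) (CD.main q α) where
  toIsHurwitzNorm := by
    have : Nontrivial Q := by
      apply Module.nontrivial_of_finrank_pos (R := F)
      omega
    exact CD.isHurwitzNorm_norm hq (hq.mul_assoc_of_finrank hd) hα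
  one_mem := (CD.mem_main_zero _).2 rfl
  mul_mem := by
    refine Fin.forall_fin_two.2 ⟨Fin.forall_fin_two.2 ⟨?_, ?_⟩, Fin.forall_fin_two.2 ⟨?_, ?_⟩⟩
    · intro x hx y hy
      change x * y ∈ CD.main q α 0
      replace hx := (CD.mem_main_zero x).1 hx
      replace hy := (CD.mem_main_zero y).1 hy
      rw [CD.mem_main_zero]
      simp [hx, hy]
    · intro x hx y hy
      change x * y ∈ CD.main q α 1
      replace hx := (CD.mem_main_zero x).1 hx
      replace hy := (CD.mem_main_one y).1 hy
      rw [CD.mem_main_one]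
      simp [hx, hy]
    · intro x hx y hy
      change x * y ∈ CD.main q α 1
      replace hx := (CD.mem_main_one x).1 hx
      replace hy := (CD.mem_main_zero y).1 hy
      rw [CD.mem_main_one]
      simp [hx, hy, CD.hurwitzConj_zero]
    · intro x hx y hy
      change x * y ∈ CD.main q α 0
      replace hx := (CD.mem_main_one x).1 hx
      replace hy := (CD.mem_main_one y).1 hy
      rw [CD.mem_main_zero]
      simp [hx, hy, CD.hurwitzConj_zero]
  polar_eq_zero x hx y hy := by
    rw [CD.mem_main_zero] at hx
    rw [CD.mem_main_one] at hy
    simp [CD.polar_norm, hx, hy]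
  sup_eq_top := by
    rw [eq_top_iff]
    intro x _
    refine Submodule.mem_sup.2 ⟨CD.mk x.fst 0, (CD.mem_main_zero _).2 rfl, CD.mk 0 x.snd,
      (CD.mem_main_one _).2 rfl, ?_⟩
    apply CD.ext <;> simp
  exists_norm_ne_zero := by
    have : Nontrivial Q := by
      apply Module.nontrivial_of_finrank_pos (R := F)
      omega
    refine ⟨CD.mk 0 1, (CD.mem_main_one _).2 rfl, ?_⟩
    simpa [CD.norm_apply, hq.map_one] using hα
  finrank_eq := by rw [CD.finrank_main_zero, CD.finrank_main_one]
  finrank_add := by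
    have : FiniteDimensional F Q := Module.finite_of_finrank_pos (by omega)
    rw [CD.finrank_main_zero, CD.finrank_main_one]
    exact Module.finrank_prod (R := F) (M := Q) (M' := Q)

/-! ### Gradings of Hurwitz algebras -/

namespace IsGroupGrading

variable {F C G : Type*} [Field F] [NonAssocRing C] [Module F C] [Group G]
  {n : QuadraticForm F C} {A : G → Submodule F C}

theorem induction_on (hA : IsGroupGrading A) {p : C → Prop} (x : C)
    (mem : ∀ g, ∀ x ∈ A g, p x) (add : ∀ x y, p x → p y → p (x + y)) : p x := by
  have hx : x ∈ ⨆ g, A g := hA.iSup_eq_top ▸ Submodule.mem_top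
  induction hx using Submodule.iSup_induction' with
  | mem g y hy => exact mem g y hy
  | zero => exact mem 1 0 (zero_mem _)
  | add y z _ _ hy hz => exact add y z hy hz

/-- Comparing the components of degree h in 1 · x = x, for x of degree h, shows that the degree 1
component of the unit is a left identity, hence is the unit itself. -/
theorem one_mem (hA : IsGroupGrading A) : (1 : C) ∈ A 1 := by
  obtain ⟨P, hmem, hP, hP0⟩ := hA.exists_projection
  have key : ∀ h, ∀ x ∈ A h, ∀ y, P h (y * x) = P 1 y * x := by
    intro h x hx y
    induction y using hA.induction_on with
    | mem g y hy =>
      have hyx := hA.mul_mem _ _ y hy x hx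
      by_cases hg : g = 1
      · subst hg
        rw [hP 1 y hy, hP h _ (by simpa using hyx)]
      · rw [hP0 g 1 y hy hg, zero_mul, hP0 (g * h) h _ hyx (by simpa using hg)]
    | add y z hy hz => rw [add_mul, map_add, map_add, add_mul, hy, hz]
  have key2 : ∀ x, P 1 1 * x = x := by
    intro x
    induction x using hA.induction_on with
    | mem h x hx => rw [← key h x hx, one_mul, hP h x hx]
    | add y z hy hz => rw [mul_add, hy, hz]
  have := key2 1
  rw [mul_one] at this
  rw [← this]
  exact hmem 1 1

/-- The degree g component of x² = n(x,1)x − n(x)1 is n(x,1)x = 0, because g² ≠ g and the unit has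
degree 1. -/
theorem trace_eq_zero (hA : IsGroupGrading A) (hn : IsHurwitzNorm n) {g : G} (hg : g ≠ 1) {x : C}
    (hx : x ∈ A g) : polar n x 1 = 0 := by
  obtain ⟨P, hmem, hP, hP0⟩ := hA.exists_projection
  have h := congrArg (P g) (hn.mul_self x)
  rw [map_sub, map_smul, map_smul, hP g x hx, hP0 1 g 1 hA.one_mem hg.symm,
    hP0 (g * g) g _ (hA.mul_mem _ _ x hx x hx) (by simpa using hg), smul_zero, sub_zero] at h
  rcases smul_eq_zero.1 h.symm with h | h
  · exact h
  · simp [h]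

/-- This is the degree 1 component of the same quadratic equation: the trace term is gone, and x²
lies in degree g² ≠ 1. -/
theorem norm_eq_zero [Nontrivial C] (hA : IsGroupGrading A) (hn : IsHurwitzNorm n) {g : G}
    (hg : g * g ≠ 1) {x : C} (hx : x ∈ A g) : n x = 0 := by
  obtain ⟨P, hmem, hP, hP0⟩ := hA.exists_projection
  have hg1 : g ≠ 1 := by
    rintro rfl
    simp at hg
  have h := congrArg (P 1) (hn.mul_self x)
  rw [hA.trace_eq_zero hn hg1 hx, zero_smul, zero_sub, map_neg, map_smul,
    hP 1 1 hA.one_mem, hP0 (g * g) 1 _ (hA.mul_mem _ _ x hx x hx) hg] at h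
  rcases smul_eq_zero.1 (neg_eq_zero.1 h.symm) with h | h
  · exact h
  · exact absurd h one_ne_zero

theorem conj_mem (hA : IsGroupGrading A) (hn : IsHurwitzNorm n) {g : G} {x : C} (hx : x ∈ A g) :
    hurwitzConj n x ∈ A g := by
  rw [hurwitzConj]
  by_cases hg : g = 1
  · subst hg
    exact sub_mem ((A 1).smul_mem _ hA.one_mem) hx
  · rw [hA.trace_eq_zero hn hg hx, zero_smul, zero_sub]
    exact neg_mem hx

/-- The polar form of x and y is the trace of xȳ, an element of degree gh. -/
theorem polar_eq_zero [SMulCommClass F C C] (hA : IsGroupGrading A) (hn : IsHurwitzNorm n)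
    {g h : G} (hgh : g * h ≠ 1) {x y : C} (hx : x ∈ A g) (hy : y ∈ A h) : polar n x y = 0 := by
  have h1 : polar n 1 (x * hurwitzConj n y) = 0 := by
    rw [QuadraticMap.polar_comm]
    exact hA.trace_eq_zero hn hgh (hA.mul_mem _ _ x hx _ (hA.conj_mem hn hy))
  rwa [← hn.polar_mul_conj_right, one_mul, QuadraticMap.polar_comm] at h1

end IsGroupGrading

namespace IsSuperGrading

variable {F C G : Type*} [Field F] [NonAssocRing C] [Module F C] [Group G]
  {n : QuadraticForm F C} {M : ZMod 2 → Submodule F C} {A : G → Submodule F C}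

/-- By nondegeneracy something pairs nontrivially with x; compatibility of the two gradings splits
it into pieces homogeneous for both, and the pieces of the wrong parity are orthogonal to x. -/
theorem exists_polar_ne_zero (hA : IsSuperGrading M A) (hM : IsHurwitzSuper n M) {i : ZMod 2}
    {x : C} (hxi : x ∈ M i) (h0 : x ≠ 0) : ∃ g, ∃ y ∈ A g, y ∈ M i ∧ polar n x y ≠ 0 := by
  by_contra! hcon
  apply h0
  apply hM.nondegenerate
  have key : ∀ h j, ∀ y ∈ A h, y ∈ M j → polar n x y = 0 := by
    intro h j y hy hyj
    by_cases hij : j = i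
    · subst hij
      exact hcon h y hy hyj
    · have h01 : ∀ i j : ZMod 2, j ≠ i → (i = 0 ∧ j = 1) ∨ (i = 1 ∧ j = 0) := by decide
      rcases h01 i j hij with ⟨rfl, rfl⟩ | ⟨rfl, rfl⟩
      · exact hM.polar_eq_zero x hxi y hyj
      · rw [QuadraticMap.polar_comm]
        exact hM.polar_eq_zero y hyj x hxi
  intro y
  induction y using hA.induction_on with
  | mem h y hy =>
    rw [hA.compatible h] at hy
    obtain ⟨a, ⟨ha, ha'⟩, b, ⟨hb, hb'⟩, rfl⟩ := Submodule.mem_sup.1 hy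
    rw [QuadraticMap.polar_add_right, key h 0 a ha ha', key h 1 b hb hb', add_zero]
  | add y z hy hz => rw [QuadraticMap.polar_add_right, hy, hz, add_zero]

/-- Only the inverse degree can pair nontrivially with degree g, so each nonzero x has a partner
there of the same parity. -/
theorem exists_polar_eq_one [SMulCommClass F C C] (hA : IsSuperGrading M A)
    (hM : IsHurwitzSuper n M) {g : G} {i : ZMod 2} {x : C} (hx : x ∈ A g) (hxi : x ∈ M i)
    (h0 : x ≠ 0) : ∃ y ∈ A g⁻¹, y ∈ M i ∧ polar n x y = 1 := by
  obtain ⟨h, y, hy, hyi, hxy⟩ := hA.exists_polar_ne_zero hM hxi h0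
  have hgh : g * h = 1 := by
    by_contra hgh
    exact hxy (hA.polar_eq_zero hM.toIsHurwitzNorm hgh hx hy)
  obtain rfl := eq_inv_of_mul_eq_one_right hgh
  refine ⟨(polar n x y)⁻¹ • y, Submodule.smul_mem _ _ hy, Submodule.smul_mem _ _ hyi, ?_⟩
  rw [QuadraticMap.polar_smul_right, smul_eq_mul, inv_mul_cancel₀ hxy]

end IsSuperGrading

/-! ### Gradings without zero divisors -/

theorem exists_hom_of_zpow_eq_one {W : Type*} [Group W] (k : ℕ) {w : W} (hw : w ^ k = 1) :
    ∃ f : Multiplicative (ZMod k) →* W, ∀ m : ℤ, f (Multiplicative.ofAdd (m : ZMod k)) = w ^ m := by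
  let f := ZMod.lift k ⟨zmultiplesHom (Additive W) (Additive.ofMul w), by
    rw [zmultiplesHom_apply, natCast_zsmul, ← ofMul_pow, hw, ofMul_one]⟩
  refine ⟨AddMonoidHom.toMultiplicativeLeft f, fun m => ?_⟩
  change (f (m : ZMod k)).toMul = w ^ m
  simp [f]

theorem exists_hom_prod {W M N : Type*} [Group W] [AddGroup M] [AddGroup N]
    (f : Multiplicative M →* W) (g : Multiplicative N →* W)
    (hfg : ∀ m n, Commute (f m) (g n)) : ∃ k : Multiplicative (M × N) →* W, ∀ m n,
      k (Multiplicative.ofAdd (m, n)) = f (Multiplicative.ofAdd m) * g (Multiplicative.ofAdd n) :=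
  ⟨(MonoidHom.noncommCoprod f g hfg).comp (MulEquiv.prodMultiplicative M N).toMonoidHom,
    fun _ _ => rfl⟩

/-- When no product of two components is zero, the defining relations contain the whole addition
table of `M`, so a compatible assignment of degrees is already a homomorphism. -/
theorem hasUniversalForm_of_mul_ne_zero {F C G M : Type*} [Field F] [NonUnitalNonAssocRing C]
    [Module F C] [Group G] [AddGroup M] {A : G → Submodule F C}
    (hA : IsGroupGrading A) {X : M → Submodule F C} (deg : Multiplicative M →* G)
    (hdeg : Function.Injective deg) (hX : ∀ m, X m ≤ A (deg (Multiplicative.ofAdd m)))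
    (htop : ⨆ m, X m = ⊤) (hne : ∀ m m', ∃ x ∈ X m, ∃ y ∈ X m', x * y ≠ 0) :
    HasUniversalForm A X := by
  refine hasUniversalForm_of_homogeneous hA X (fun m => deg (Multiplicative.ofAdd m)) id hX ?_ htop
    ?_ ?_ ?_ ?_ ?_
  · intro m h
    obtain ⟨x, hx, y, hy, hxy⟩ := hne m m
    rw [h, Submodule.mem_bot] at hx
    simp [hx] at hxy
  · intro m
    simp
  · intro i j
    exact hdeg.eq_iff
  · intro i j _
    exact ⟨i + j, by rw [ofAdd_add, map_mul], rfl⟩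
  · intro w _ hw
    have hmul : ∀ i j, w i * w j = w (i + j) := fun i j =>
      hw i j _ (hne i j) (by rw [ofAdd_add, map_mul])
    exact ⟨MonoidHom.mk' (fun m => w m.toAdd) fun a b => (hmul _ _).symm, fun i => rfl⟩
  · intro m
    exact AddSubgroup.subset_closure ⟨m, rfl⟩

theorem injective_of_ofAdd_one_ne {G : Type*} [Group G] (f : Multiplicative (ZMod 2) →* G)
    (hf : f (Multiplicative.ofAdd 1) ≠ 1) : Function.Injective f := by
  rw [injective_iff_map_eq_one]
  intro a ha
  induction a using Multiplicative.rec with | _ a => ?_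
  have : ∀ a : ZMod 2, a ≠ 1 → a = 0 := by decide
  rw [this a (by rintro rfl; exact hf ha)]
  rfl

theorem ZMod.forall_two {p : ZMod 2 → Prop} : (∀ i, p i) ↔ p 0 ∧ p 1 := Fin.forall_fin_two

theorem ZMod.eq_zero_or_one_of_two (i : ZMod 2) : i = 0 ∨ i = 1 := by
  revert i
  decide

section

variable {F C G : Type*} [Field F] [NonAssocRing C] [Module F C] [Group G]
  {n : QuadraticForm F C} {M : ZMod 2 → Submodule F C} {A : G → Submodule F C}

theorem mul_ne_zero_of_norm (hn : IsHurwitzNorm n) {x y : C} (hx : n x ≠ 0) (hy : n y ≠ 0) :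
    x * y ≠ 0 := fun h => by
  have := hn.map_mul x y
  rw [h, QuadraticMap.map_zero] at this
  exact mul_ne_zero hx hy this.symm

/-- An anisotropic odd element forces g² = 1, and together with 1 it shows that no product of the
two components vanishes. -/
theorem hasUniversalForm_main [Nontrivial C] (hA : IsGroupGrading A) (hM : IsHurwitzSuper n M)
    {g : G} (hg : g ≠ 1) (h0 : M 0 ≤ A 1) (h1 : M 1 ≤ A g) : HasUniversalForm A M := by
  obtain ⟨u, hu, hnu⟩ := hM.exists_norm_ne_zero
  have hg2 : g * g = 1 := by
    by_contra h
    exact hnu (hA.norm_eq_zero hM.toIsHurwitzNorm h (h1 hu))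
  obtain ⟨f, hf⟩ := exists_hom_of_zpow_eq_one 2 (w := g) (by rw [pow_two, hg2])
  have hf1 : f (Multiplicative.ofAdd 1) = g := by simpa using hf 1
  have helt : ∀ i, ∃ x ∈ M i, n x ≠ 0 := ZMod.forall_two.2
    ⟨⟨1, hM.one_mem, by rw [hM.map_one]; exact one_ne_zero⟩, ⟨u, hu, hnu⟩⟩
  refine hasUniversalForm_of_mul_ne_zero hA f (injective_of_ofAdd_one_ne f (by rwa [hf1]))
      ?_ ?_ ?_
  · rw [ZMod.forall_two]
    refine ⟨?_, ?_⟩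
    · rw [ofAdd_zero, map_one]
      exact h0
    · rw [hf1]
      exact h1
  · rw [eq_top_iff, ← hM.sup_eq_top]
    exact sup_le (le_iSup M 0) (le_iSup M 1)
  · intro i j
    obtain ⟨x, hx, hx'⟩ := helt i
    obtain ⟨y, hy, hy'⟩ := helt j
    exact ⟨x, hx, y, hy, mul_ne_zero_of_norm hM.toIsHurwitzNorm hx' hy'⟩

/-- The generators `1, v, u, vu` of the components of `doublingGrading`. -/
def doublingGenerator (v u : C) (m : ZMod 2 × ZMod 2) : C :=
  if m = (0, 0) then 1 else if m = (1, 0) then v else if m = (0, 1) then u else v * u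

theorem planeMul_one (w : C) : planeMul F w 1 = planeOf F w := by
  have : {y | ∃ k ∈ planeOf F w, y = k * 1} = (planeOf F w : Set C) := by
    ext y
    simp
  rw [planeMul, this, Submodule.span_eq]

theorem doublingGrading_eq (w v u : C) (m : ZMod 2 × ZMod 2) :
    doublingGrading F w v u m = planeMul F w (doublingGenerator v u m) := by
  rw [doublingGrading, doublingGenerator]
  split_ifs
  · rw [planeMul_one]
  all_goals rfl

theorem doublingCoarsening_eq (w v u : C) (m : ZMod 2) :
    doublingCoarsening F w v u m =
      doublingGrading F w v u (m, 0) ⊔ doublingGrading F w v u (m, 1) := by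
  rcases ZMod.eq_zero_or_one_of_two m with rfl | rfl <;> simp [doublingCoarsening, doublingGrading]

theorem mul_mem_planeMul {w k : C} (hk : k ∈ planeOf F w) (x : C) : k * x ∈ planeMul F w x :=
  Submodule.subset_span ⟨k, hk, rfl⟩

theorem one_mem_planeOf (w : C) : 1 ∈ planeOf F w := Submodule.subset_span (by simp)

theorem self_mem_planeOf (w : C) : w ∈ planeOf F w := Submodule.subset_span (by simp)

theorem mem_planeMul_self (w x : C) : x ∈ planeMul F w x := by
  simpa using mul_mem_planeMul (one_mem_planeOf (F := F) w) x

theorem planeOf_le (hA : IsGroupGrading A) {w : C} (hw : w ∈ A 1) : planeOf F w ≤ A 1 := by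
  rw [planeOf, Submodule.span_le, Set.insert_subset_iff, Set.singleton_subset_iff]
  exact ⟨hA.one_mem, hw⟩

theorem planeMul_le (hA : IsGroupGrading A) {w x : C} {g : G} (hw : w ∈ A 1) (hx : x ∈ A g) :
    planeMul F w x ≤ A g := by
  rw [planeMul, Submodule.span_le]
  rintro _ ⟨k, hk, rfl⟩
  have := hA.mul_mem _ _ k (planeOf_le hA hw hk) x hx
  rwa [one_mul] at this

variable [CharP F 2] [SMulCommClass F C C]

/-- The eight products of 1, w with 1, v, u, vu have a block Gram matrix: inside a block n(kx, k'x)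
= n(k,k')n(x), and distinct blocks are orthogonal. The map `deg` need not be injective for this. -/
theorem iSup_doublingGrading [Nontrivial C] (hA : IsGroupGrading A) (hM : IsHurwitzSuper n M)
    (h8 : Module.finrank F C = 8) {w v u : C} (deg : Multiplicative (ZMod 2 × ZMod 2) →* G)
    (hdeg : deg (Multiplicative.ofAdd (1, 0)) ≠ 1)
    (hw : w ∈ A 1) (hw0 : w ∈ M 0) (hwt : polar n w 1 ≠ 0)
    (hgen : ∀ c, doublingGenerator v u c ∈ A (deg (Multiplicative.ofAdd c)) ∧
      doublingGenerator v u c ∈ M c.2 ∧ n (doublingGenerator v u c) ≠ 0) :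
    ⨆ c, doublingGrading F w v u c = ⊤ := by
  let x : (ZMod 2 × ZMod 2) × Fin 2 → C := fun c => ![1, w] c.2 * doublingGenerator v u c.1
  let y : (ZMod 2 × ZMod 2) × Fin 2 → C := fun c => ![w, 1] c.2 * doublingGenerator v u c.1
  have hsub : ∀ k ∈ A 1, k ∈ M 0 → ∀ c,
      k * doublingGenerator v u c ∈ A (deg (Multiplicative.ofAdd c))
      ∧ k * doublingGenerator v u c ∈ M c.2 := by
    intro k hk hk0 c
    have h1 := hA.mul_mem _ _ k hk _ (hgen c).1
    have h2 := hM.mul_mem _ _ k hk0 _ (hgen c).2.1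
    rw [one_mul] at h1
    rw [zero_add] at h2
    exact ⟨h1, h2⟩
  have hx : ∀ c, x c ∈ A (deg (Multiplicative.ofAdd c.1)) ∧ x c ∈ M c.1.2 := by
    rintro ⟨c, s⟩
    fin_cases s
    · exact hsub 1 hA.one_mem hM.one_mem c
    · exact hsub w hw hw0 c
  have hy : ∀ c, y c ∈ A (deg (Multiplicative.ofAdd c.1)) ∧ y c ∈ M c.1.2 := by
    rintro ⟨c, s⟩
    fin_cases s
    · exact hsub w hw hw0 c
    · exact hsub 1 hA.one_mem hM.one_mem c
  have horth : ∀ c d, c.1 ≠ d.1 → polar n (x c) (y d) = 0 := by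
    intro c d hcd
    by_cases h2 : c.1.2 = d.1.2
    · apply hA.polar_eq_zero hM.toIsHurwitzNorm _ (hx c).1 (hy d).1
      -- Blocks of different parity are orthogonal anyway; distinct blocks of equal parity differ by
      -- (1,0), so nontriviality of that one degree suffices.
      have hadd : ∀ c d : ZMod 2 × ZMod 2, c ≠ d → c.2 = d.2 → c + d = (1, 0) := by decide
      rw [← map_mul, ← ofAdd_add, hadd _ _ hcd h2]
      exact hdeg
    · have h01 : ∀ i j : ZMod 2, i ≠ j → (i = 0 ∧ j = 1) ∨ (i = 1 ∧ j = 0) := by decide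
      have hxc := (hx c).2
      have hyd := (hy d).2
      rcases h01 _ _ h2 with ⟨h, h'⟩ | ⟨h, h'⟩ <;> rw [h] at hxc <;> rw [h'] at hyd
      · exact hM.polar_eq_zero _ hxc _ hyd
      · rw [QuadraticMap.polar_comm]
        exact hM.polar_eq_zero _ hyd _ hxc
  have hli : LinearIndependent F x := by
    apply linearIndependent_of_polar n x y
    · rintro ⟨c, s⟩ ⟨d, t⟩ hcd
      by_cases h : c = d
      · subst h
        have hst : s ≠ t := fun h => hcd (by rw [h])
        simp only [x, y, hM.polar_mul_right]
        fin_cases s <;> fin_cases t <;> simp_all [CharTwo.two_eq_zero]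
      · exact horth _ _ h
    · rintro ⟨c, s⟩
      simp only [x, y, hM.polar_mul_right]
      refine mul_ne_zero ?_ (hgen c).2.2
      fin_cases s
      · simpa [QuadraticMap.polar_comm n 1 w] using hwt
      · simpa using hwt
  have : FiniteDimensional F C := Module.finite_of_finrank_pos (by omega)
  have htop := hli.span_eq_top_of_card_eq_finrank' (by rw [h8]; rfl)
  rw [eq_top_iff, ← htop, Submodule.span_le]
  rintro _ ⟨⟨c, s⟩, rfl⟩
  apply Submodule.mem_iSup_of_mem c
  rw [doublingGrading_eq]
  apply mul_mem_planeMul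
  fin_cases s
  · exact one_mem_planeOf w
  · exact self_mem_planeOf w

theorem hasUniversalForm_doubling [Nontrivial C] (hA : IsGroupGrading A) (hM : IsHurwitzSuper n M)
    (h8 : Module.finrank F C = 8) {w v u : C} {g h : G} (hh : h ≠ 1)
    (hw : w ∈ A 1) (hw0 : w ∈ M 0) (hwt : polar n w 1 ≠ 0)
    (hv : v ∈ A h) (hv0 : v ∈ M 0) (hnv : n v ≠ 0)
    (hu : u ∈ A g) (hu1 : u ∈ M 1) (hnu : n u ≠ 0) :
    ∃ u' ∈ M 1, n u' ≠ 0 ∧ (HasUniversalForm A (doublingGrading F w v u') ∨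
      HasUniversalForm A (doublingCoarsening F w v u')) := by
  wlog hgh : g ≠ h generalizing u g
  -- If u and v share the degree h, replace u by vu, whose degree h² = 1 differs from h.
  · have hhh : h * h = 1 := by
      by_contra h'
      exact hnv (hA.norm_eq_zero hM.toIsHurwitzNorm h' hv)
    refine this (u := v * u) (g := 1) ?_ ?_ ?_ hh.symm
    · have := hA.mul_mem _ _ v hv u hu
      rwa [not_not.1 hgh, hhh] at this
    · exact hM.mul_mem _ _ v hv0 u hu1
    · rw [hM.map_mul]
      exact mul_ne_zero hnv hnu
  refine ⟨u, hu1, hnu, ?_⟩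
  have hnvu : n (v * u) ≠ 0 := by
    rw [hM.map_mul]
    exact mul_ne_zero hnv hnu
  have hsq : ∀ {k x}, x ∈ A k → n x ≠ 0 → k * k = 1 := fun {k x} hx hnx => by
    by_contra h'
    exact hnx (hA.norm_eq_zero hM.toIsHurwitzNorm h' hx)
  have hhh := hsq hv hnv
  have hgg := hsq hu hnu
  have hvu := hA.mul_mem _ _ v hv u hu
  -- The elements v, u and vu are all anisotropic, so h, g and hg are involutions, and hence h and g
  -- commute.
  have hcomm : Commute h g := by
    have := hsq hvu hnvu
    have h1 : (h * g)⁻¹ = h * g := inv_eq_of_mul_eq_one_left this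
    rw [mul_inv_rev, inv_eq_of_mul_eq_one_left hhh, inv_eq_of_mul_eq_one_left hgg] at h1
    exact h1.symm
  obtain ⟨f, hf⟩ := exists_hom_of_zpow_eq_one 2 (w := h) (by rw [pow_two, hhh])
  obtain ⟨f', hf'⟩ := exists_hom_of_zpow_eq_one 2 (w := g) (by rw [pow_two, hgg])
  have hf1 : f (Multiplicative.ofAdd 1) = h := by simpa using hf 1
  have hf1' : f' (Multiplicative.ofAdd 1) = g := by simpa using hf' 1
  obtain ⟨deg, hdeg⟩ := exists_hom_prod f f' (by
    intro a b
    induction a using Multiplicative.rec with | _ a => ?_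
    induction b using Multiplicative.rec with | _ b => ?_
    revert a b
    simp only [ZMod.forall_two]
    change (Commute (f 1) (f' 1) ∧ Commute (f 1) (f' (Multiplicative.ofAdd 1))) ∧
      Commute (f (Multiplicative.ofAdd 1)) (f' 1) ∧
      Commute (f (Multiplicative.ofAdd 1)) (f' (Multiplicative.ofAdd 1))
    simp [hf1, hf1', hcomm])
  have d00 : deg (Multiplicative.ofAdd (0, 0)) = 1 := by simp [hdeg]
  have d10 : deg (Multiplicative.ofAdd (1, 0)) = h := by simp [hdeg, hf1]
  have d01 : deg (Multiplicative.ofAdd (0, 1)) = g := by simp [hdeg, hf1']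
  have d11 : deg (Multiplicative.ofAdd (1, 1)) = h * g := by simp [hdeg, hf1, hf1']
  have hgen : ∀ c, doublingGenerator v u c ∈ A (deg (Multiplicative.ofAdd c)) ∧
      doublingGenerator v u c ∈ M c.2 ∧ n (doublingGenerator v u c) ≠ 0 := by
    rw [Prod.forall]
    simp only [ZMod.forall_two, d00, d10, d01, d11]
    simp only [doublingGenerator]
    refine ⟨⟨⟨hA.one_mem, hM.one_mem, ?_⟩, ⟨hu, hu1, hnu⟩⟩, ⟨hv, hv0, hnv⟩,
      ⟨hvu, hM.mul_mem _ _ v hv0 u hu1, hnvu⟩⟩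
    simp [hM.map_one]
  have htop := iSup_doublingGrading hA hM h8 deg (by rwa [d10]) hw hw0 hwt hgen
  have hmem : ∀ c, doublingGenerator v u c ∈ doublingGrading F w v u c := fun c => by
    rw [doublingGrading_eq]
    exact mem_planeMul_self _ _
  have hle : ∀ c, doublingGrading F w v u c ≤ A (deg (Multiplicative.ofAdd c)) := fun c => by
    rw [doublingGrading_eq]
    exact planeMul_le hA hw (hgen c).1
  by_cases hg : g = 1
  -- When u has degree 1, Ku joins K and K(vu) joins Kv, which is the coarsening; otherwise 1, h, g,
  -- hg are distinct.
  · subst hg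
    right
    refine hasUniversalForm_of_mul_ne_zero hA f (injective_of_ofAdd_one_ne f (by rwa [hf1]))
      ?_ ?_ ?_
    · intro m
      have h1 := hle (m, 0)
      have h2 := hle (m, 1)
      rw [hdeg] at h1 h2
      rw [hf1', mul_one] at h2
      rw [ofAdd_zero, map_one, mul_one] at h1
      rw [doublingCoarsening_eq]
      exact sup_le h1 h2
    · rw [eq_top_iff, ← htop]
      refine iSup_le fun c => ?_
      refine le_iSup_of_le c.1 ?_
      rw [doublingCoarsening_eq]
      have hc : c = (c.1, 0) ∨ c = (c.1, 1) := by
        revert c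
        decide
      rcases hc with h | h
      · exact h ▸ le_sup_left
      · exact h ▸ le_sup_right
    · intro i j
      refine ⟨_, ?_, _, ?_, mul_ne_zero_of_norm hM.toIsHurwitzNorm (hgen (i, 0)).2.2
        (hgen (j, 0)).2.2⟩ <;>
      · rw [doublingCoarsening_eq]
        exact Submodule.mem_sup_left (hmem _)
  · left
    refine hasUniversalForm_of_mul_ne_zero hA deg ?_ hle htop fun i j => ⟨_, hmem i, _, hmem j,
      mul_ne_zero_of_norm hM.toIsHurwitzNorm (hgen i).2.2 (hgen j).2.2⟩
    rw [injective_iff_map_eq_one]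
    intro a
    induction a using Multiplicative.rec with | _ a => ?_
    revert a
    change ∀ a, deg (Multiplicative.ofAdd a) = 1 → a = 0
    rw [Prod.forall]
    simp only [ZMod.forall_two, d00, d10, d01, d11]
    refine ⟨⟨fun _ => rfl, fun h' => absurd h' hg⟩, fun h' => absurd h' hh, fun h' => ?_⟩
    exact absurd ((eq_inv_of_mul_eq_one_right h').trans (inv_eq_of_mul_eq_one_left hhh)) hgh

end

/-! ### Peirce components and canonical bases -/

/-- The Peirce component `{x | e x = x = x (1 - e)}` of an idempotent `e`. -/
def peirceComponent (F : Type*) {C : Type*} [Field F] [NonAssocRing C] [Module F C]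
    [IsScalarTower F C C]
    [SMulCommClass F C C] (e : C) : Submodule F C where
  carrier := {x | e * x = x ∧ x * e = 0}
  add_mem' := fun {x y} hx hy =>
    ⟨by rw [mul_add, hx.1, hy.1], by rw [add_mul, hx.2, hy.2, add_zero]⟩
  zero_mem' := ⟨mul_zero e, zero_mul e⟩
  smul_mem' := fun a x hx => ⟨by rw [mul_smul_comm, hx.1], by rw [smul_mul_assoc, hx.2, smul_zero]⟩

section

variable {F C : Type*} [Field F] [NonAssocRing C] [Module F C]

/-- `e` is an idempotent of trace one and norm zero. -/
structure IsTraceOneIdempotent (n : QuadraticForm F C) (e : C) : Prop where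
  trace : polar n e 1 = 1
  norm : n e = 0

namespace IsTraceOneIdempotent

variable {n : QuadraticForm F C} {e : C}

theorem one_sub [CharP F 2] (he : IsTraceOneIdempotent n e) (hn : IsHurwitzNorm n) :
    IsTraceOneIdempotent n (1 - e) := by
  have : Nontrivial C := ⟨e, 0, fun h => by simpa [h] using he.trace⟩
  refine ⟨?_, ?_⟩
  · rw [QuadraticMap.polar_sub_left, polar_self_of_charTwo, he.trace, zero_sub,
      CharTwo.neg_eq]
  · rw [sub_eq_add_neg, QuadraticMap.map_add n, QuadraticMap.map_neg, he.norm, hn.map_one,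
      QuadraticMap.polar_neg_right, QuadraticMap.polar_comm, he.trace]
    ring

theorem mul_self (he : IsTraceOneIdempotent n e) (hn : IsHurwitzNorm n) : e * e = e := by
  rw [hn.mul_self, he.trace, he.norm, one_smul, zero_smul, sub_zero]

theorem polar_one_sub [CharP F 2] (he : IsTraceOneIdempotent n e) : polar n e (1 - e) = 1 := by
  rw [QuadraticMap.polar_sub_right, he.trace, polar_self_of_charTwo, sub_zero]

end IsTraceOneIdempotent

variable [IsScalarTower F C C] [SMulCommClass F C C]

theorem mem_peirceComponent {e x : C} : x ∈ peirceComponent F e ↔ e * x = x ∧ x * e = 0 := Iff.rfl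

theorem mem_peirceComponent_one_sub {e x : C} :
    x ∈ peirceComponent F (1 - e) ↔ e * x = 0 ∧ x * e = x := by
  rw [mem_peirceComponent, sub_mul, mul_sub, one_mul, mul_one, sub_eq_self, sub_eq_zero,
    eq_comm (a := x)]

namespace IsTraceOneIdempotent

variable {n : QuadraticForm F C} {e : C}

/-- Left multiplication by e fixes the Peirce component and scales the polar form by n(e) = 0. -/
theorem polar_peirce (he : IsTraceOneIdempotent n e) (hn : IsHurwitzNorm n) {x y : C}
    (hx : x ∈ peirceComponent F e) (hy : y ∈ peirceComponent F e) : polar n x y = 0 := by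
  rw [← hx.1, ← hy.1, hn.polar_mul_left, he.norm, zero_mul]

theorem trace_peirce (he : IsTraceOneIdempotent n e) (hn : IsHurwitzNorm n) {x : C}
    (hx : x ∈ peirceComponent F e) : polar n x 1 = 0 ∧ polar n e x = 0 := by
  have h1 : polar n e x = 0 := by
    have := hn.polar_mul_left e 1 x
    rwa [hx.1, mul_one, he.norm, zero_mul] at this
  have h := hn.mul_add_mul e x
  rw [hx.1, hx.2, he.trace, h1, one_smul, zero_smul, sub_zero, add_zero, left_eq_add] at h
  rcases smul_eq_zero.1 h with h | h
  · exact ⟨h, h1⟩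
  · simpa [h] using he.trace

/-- Orthogonality to 1 and e reduces the linearised quadratic equation to ex + xe = x, and these two
summands are the Peirce parts of x. -/
theorem mul_mem_peirce_of_orthogonal (he : IsTraceOneIdempotent n e) (hn : IsHurwitzNorm n) {x : C}
    (h1 : polar n x 1 = 0) (h2 : polar n x e = 0) :
    e * x ∈ peirceComponent F e ∧ x - e * x ∈ peirceComponent F (1 - e) := by
  have h3 : e * (e * x) = e * x := by
    rw [hn.mul_mul_left, he.trace, he.norm, one_smul, zero_smul, sub_zero]
  have h4 : x - e * x = x * e := by
    have := hn.mul_add_mul e x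
    rw [he.trace, h1, QuadraticMap.polar_comm, h2, one_smul, zero_smul, zero_smul, add_zero,
      sub_zero] at this
    rw [sub_eq_iff_eq_add', this]
  have h5 : e * x * e = 0 := by
    have h := hn.mul_add_mul e (e * x)
    have h6 : polar n (e * x) 1 = 0 := by
      rw [hn.polar_mul_conj_left, mul_one, hurwitzConj, QuadraticMap.polar_sub_right,
        QuadraticMap.polar_smul_right, h1, h2, smul_zero, sub_zero]
    have h7 : polar n e (e * x) = 0 := by
      have := hn.polar_mul_left e 1 x
      rwa [mul_one, he.norm, zero_mul] at this
    rwa [h3, h6, h7, he.trace, one_smul, zero_smul, zero_smul, add_zero, sub_zero,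
      add_eq_left] at h
  refine ⟨⟨h3, h5⟩, mem_peirceComponent_one_sub.2 ⟨?_, ?_⟩⟩
  · rw [mul_sub, h3, sub_self]
  · rw [h4, hn.mul_mul_right, he.trace, he.norm, one_smul, zero_smul, sub_zero]

theorem norm_peirce (he : IsTraceOneIdempotent n e) (hn : IsHurwitzNorm n) {x : C}
    (hx : x ∈ peirceComponent F e) : n x = 0 := by
  rw [← hx.1, hn.map_mul, he.norm, zero_mul]

theorem mul_self_peirce (he : IsTraceOneIdempotent n e) (hn : IsHurwitzNorm n) {x : C}
    (hx : x ∈ peirceComponent F e) : x * x = 0 := by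
  rw [hn.mul_self, he.norm_peirce hn hx, (he.trace_peirce hn hx).1, zero_smul, zero_smul, sub_zero]

/-- The linearised alternative laws give e(xy) + x(ey) = xy and (xy)e + (xe)y = xy; here ey = y and
xe = 0. -/
theorem mul_peirce (he : IsTraceOneIdempotent n e) (hn : IsHurwitzNorm n) {x y : C}
    (hx : x ∈ peirceComponent F e) (hy : y ∈ peirceComponent F e) :
    x * y ∈ peirceComponent F (1 - e) := by
  have hx1 := he.trace_peirce hn hx
  have hy1 := he.trace_peirce hn hy
  rw [mem_peirceComponent_one_sub]
  constructor
  · have := hn.mul_mul_left_add e x y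
    rwa [hy.1, he.trace, hx1.1, hx1.2, one_smul, zero_smul, add_zero, sub_zero,
      add_eq_right] at this
  · have := hn.mul_mul_right_add y e x
    rwa [hx.2, he.trace, hy1.1, QuadraticMap.polar_comm, hy1.2, one_smul, zero_smul, zero_smul,
      zero_add, sub_zero, zero_mul, add_zero] at this

theorem polar_peirce_of_mem (he : IsTraceOneIdempotent n e) (hn : IsHurwitzNorm n) {x : C}
    (hx : x ∈ peirceComponent F e) : polar n e x = 0 ∧ polar n x e = 0 ∧
      polar n (1 - e) x = 0 ∧ polar n x (1 - e) = 0 := by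
  have h := he.trace_peirce hn hx
  have h1 : polar n x (1 - e) = 0 := by
    rw [QuadraticMap.polar_sub_right, h.1, QuadraticMap.polar_comm, h.2, sub_zero]
  exact ⟨h.2, (QuadraticMap.polar_comm _ _ _).trans h.2,
    (QuadraticMap.polar_comm _ _ _).trans h1, h1⟩

variable [CharP F 2]

/-- Elements of a Peirce component have trace zero and are mutually orthogonal, so they anticommute;
in characteristic two that is commuting. -/
theorem mul_comm_peirce (he : IsTraceOneIdempotent n e) (hn : IsHurwitzNorm n) {x y : C}
    (hx : x ∈ peirceComponent F e) (hy : y ∈ peirceComponent F e) : x * y = y * x := by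
  have h := hn.mul_add_mul x y
  rw [he.polar_peirce hn hx hy, (he.trace_peirce hn hx).1, (he.trace_peirce hn hy).1, zero_smul,
    zero_smul, zero_smul, add_zero, sub_zero, add_eq_zero_iff_eq_neg, neg_of_charTwo F] at h
  exact h

/-- The product xy is fixed by e on both sides, so the linearised quadratic equation of e and xy
leaves xy = n(xy,1)e; moving x across the polar form turns this trace into n(x,y), up to a sign that
disappears here. -/
theorem mul_peirce_dual (he : IsTraceOneIdempotent n e) (hn : IsHurwitzNorm n) {x y : C}
    (hx : x ∈ peirceComponent F e) (hy : y ∈ peirceComponent F (1 - e)) :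
    x * y = polar n x y • e := by
  have hx1 := he.trace_peirce hn hx
  have hy1 := (he.one_sub hn).trace_peirce hn hy
  have hy2 := mem_peirceComponent_one_sub.1 hy
  have hey : polar n y e = 0 := by
    have := hy1.2
    rwa [QuadraticMap.polar_sub_left, QuadraticMap.polar_comm, hy1.1, zero_sub, neg_eq_zero,
      QuadraticMap.polar_comm] at this
  have h1 : e * (x * y) = x * y := by
    have := hn.mul_mul_left_add e x y
    rwa [hy2.1, he.trace, hx1.1, hx1.2, one_smul, zero_smul, zero_smul, mul_zero, add_zero,
      add_zero, sub_zero] at this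
  have h2 : x * y * e = x * y := by
    have := hn.mul_mul_right_add y e x
    rwa [hx.2, he.trace, hy1.1, hey, one_smul, zero_smul, zero_smul,
      zero_add, sub_zero, zero_mul, add_zero] at this
  have h3 : polar n e (x * y) = 0 := by
    have := hn.polar_mul_left e 1 (x * y)
    rwa [h1, mul_one, he.norm, zero_mul] at this
  have h4 := hn.mul_add_mul e (x * y)
  rw [h1, h2, h3, he.trace, one_smul, zero_smul, sub_zero, add_right_inj] at h4
  rw [h4, hn.polar_mul_conj_left, hurwitzConj, hx1.1, zero_smul, zero_sub, neg_mul,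
    mul_one, QuadraticMap.polar_neg_right, CharTwo.neg_eq, QuadraticMap.polar_comm]

/-- On a Peirce component conjugation is trivial in characteristic two, so n(ab, c) can be rotated
cyclically. -/
theorem polar_mul_rotate (he : IsTraceOneIdempotent n e) (hn : IsHurwitzNorm n) {a b c : C}
    (ha : a ∈ peirceComponent F e) (hb : b ∈ peirceComponent F e) :
    polar n (b * c) a = polar n (a * b) c := by
  rw [hn.polar_mul_conj_left, hurwitzConj, (he.trace_peirce hn hb).1, zero_smul, zero_sub,
    neg_of_charTwo F, he.mul_comm_peirce hn hb ha, QuadraticMap.polar_comm]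

/-- This yields the products inside V. Linearised right alternativity for b and ca, applied to a,
leaves (ab)(ca) = n(b, ca)a, because a(ca) = n(a, ca)e = 0. -/
theorem mul_mul_peirce (he : IsTraceOneIdempotent n e) (hn : IsHurwitzNorm n) {a b c : C}
    (ha : a ∈ peirceComponent F e) (hb : b ∈ peirceComponent F e) (hc : c ∈ peirceComponent F e)
    (h : polar n (a * b) c = 1) : a * b * (c * a) = a := by
  have hca := he.mul_peirce hn hc ha
  have h1 := hn.mul_mul_right_add b (c * a) a
  have h2 : polar n a (c * a) = 0 := by
    rw [QuadraticMap.polar_comm, he.polar_mul_rotate hn ha hc, he.polar_mul_rotate hn ha ha,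
      he.mul_self_peirce hn ha, QuadraticMap.polar_zero_left]
  have h3 : polar n b (c * a) = 1 := by
    rw [QuadraticMap.polar_comm, he.polar_mul_rotate hn hb hc, he.polar_mul_rotate hn ha hb, h]
  have hba := he.mul_comm_peirce hn hb ha
  have hbc : polar n (c * a) 1 = 0 := ((he.one_sub hn).trace_peirce hn hca).1
  rw [he.mul_peirce_dual hn ha hca, h2, zero_smul, zero_mul, add_zero, hbc,
    (he.trace_peirce hn hb).1, h3, zero_smul, zero_smul, one_smul, add_zero, zero_sub,
    neg_of_charTwo F] at h1
  exact h1

theorem polar_mul_self_peirce (he : IsTraceOneIdempotent n e) (hn : IsHurwitzNorm n) {a b : C}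
    (ha : a ∈ peirceComponent F e) (hb : b ∈ peirceComponent F e) :
    polar n a (a * b) = 0 ∧ polar n a (b * a) = 0 := by
  have h : polar n a (a * b) = 0 := by
    rw [QuadraticMap.polar_comm, he.polar_mul_rotate hn ha ha, he.mul_self_peirce hn ha,
      QuadraticMap.polar_zero_left]
  exact ⟨h, by rw [he.mul_comm_peirce hn hb ha, h]⟩

/-- Pairing a linear relation with 1 − e, e, the v's and the u's isolates one coefficient at a time,
as e and 1 − e are isotropic partners orthogonal to U and V. -/
theorem linearIndependent_of_dual (he : IsTraceOneIdempotent n e) (hn : IsHurwitzNorm n)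
    {u v : Fin 3 → C} (hu : ∀ i, u i ∈ peirceComponent F e)
    (hv : ∀ i, v i ∈ peirceComponent F (1 - e)) (huv : ∀ i, polar n (u i) (v i) = 1)
    (huv' : ∀ i j, i ≠ j → polar n (u i) (v j) = 0) :
    LinearIndependent F ![e, 1 - e, u 0, u 1, u 2, v 0, v 1, v 2] := by
  have hf := he.one_sub hn
  have hu' := fun i => he.polar_peirce_of_mem hn (hu i)
  have hv' := fun i => hf.polar_peirce_of_mem hn (hv i)
  simp only [sub_sub_cancel] at hv'
  have hcomm : ∀ i j, polar n (v i) (u j) = polar n (u j) (v i) :=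
    fun i j => QuadraticMap.polar_comm _ _ _
  have huu : ∀ i j, polar n (u i) (u j) = 0 := fun i j => he.polar_peirce hn (hu i) (hu j)
  have hvv : ∀ i j, polar n (v i) (v j) = 0 := fun i j => hf.polar_peirce hn (hv i) (hv j)
  have hpe' : polar n (1 - e) e = 1 := by rw [QuadraticMap.polar_comm, he.polar_one_sub]
  rw [Fintype.linearIndependent_iff]
  intro c hc
  have key : ∀ y, c 0 * polar n e y + c 1 * polar n (1 - e) y + c 2 * polar n (u 0) y +
      c 3 * polar n (u 1) y + c 4 * polar n (u 2) y + c 5 * polar n (v 0) y +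
      c 6 * polar n (v 1) y + c 7 * polar n (v 2) y = 0 := by
    intro y
    rw [Fin.sum_univ_eight] at hc
    change c 0 • e + c 1 • (1 - e) + c 2 • u 0 + c 3 • u 1 + c 4 • u 2 + c 5 • v 0 +
      c 6 • v 1 + c 7 • v 2 = 0 at hc
    have := congrArg (fun x => polar n x y) hc
    simpa only [QuadraticMap.polar_add_left, QuadraticMap.polar_smul_left, smul_eq_mul,
      QuadraticMap.polar_zero_left] using this
  have h0 := key (1 - e)
  have h1 := key e
  have hU : ∀ j, c 2 * polar n (u 0) (v j) + c 3 * polar n (u 1) (v j) +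
      c 4 * polar n (u 2) (v j) = 0 := fun j => by
    have := key (v j)
    simpa only [(hv' j).1, (hv' j).2.2.1, hvv, mul_zero, zero_add, add_zero] using this
  have hV : ∀ j, c 5 * polar n (u j) (v 0) + c 6 * polar n (u j) (v 1) +
      c 7 * polar n (u j) (v 2) = 0 := fun j => by
    have := key (u j)
    simpa only [(hu' j).1, (hu' j).2.2.1, huu, hcomm, mul_zero, zero_add, add_zero] using this
  simp only [hu', hv', he.polar_one_sub, hpe', polar_self_of_charTwo, mul_zero, mul_one, zero_add,
    add_zero] at h0 h1
  have hU0 := hU 0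
  have hU1 := hU 1
  have hU2 := hU 2
  have hV0 := hV 0
  have hV1 := hV 1
  have hV2 := hV 2
  rw [huv, huv' 1 0 (by decide), huv' 2 0 (by decide), mul_one, mul_zero, mul_zero, add_zero,
    add_zero] at hU0
  rw [huv, huv' 0 1 (by decide), huv' 2 1 (by decide), mul_one, mul_zero, mul_zero, zero_add,
    add_zero] at hU1
  rw [huv, huv' 0 2 (by decide), huv' 1 2 (by decide), mul_one, mul_zero, mul_zero, zero_add,
    zero_add] at hU2
  rw [huv, huv' 0 1 (by decide), huv' 0 2 (by decide), mul_one, mul_zero, mul_zero, add_zero,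
    add_zero] at hV0
  rw [huv, huv' 1 0 (by decide), huv' 1 2 (by decide), mul_one, mul_zero, mul_zero, zero_add,
    add_zero] at hV1
  rw [huv, huv' 2 0 (by decide), huv' 2 1 (by decide), mul_one, mul_zero, mul_zero, zero_add,
    zero_add] at hV2
  intro i
  fin_cases i <;> assumption

theorem isCanonicalBasis₈ (he : IsTraceOneIdempotent n e) (hn : IsHurwitzNorm n)
    (h8 : Module.finrank F C = 8) {u₁ u₂ u₃ v₁ v₂ v₃ : C} (h₁ : u₁ ∈ peirceComponent F e)
    (h₂ : u₂ ∈ peirceComponent F e) (h₃ : u₃ ∈ peirceComponent F e)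
    (h : polar n (u₁ * u₂) u₃ = 1) (c23 : u₂ * u₃ = v₁) (c31 : u₃ * u₁ = v₂) (c12 : u₁ * u₂ = v₃) :
    IsCanonicalBasis₈ F e (1 - e) u₁ u₂ u₃ v₁ v₂ v₃ := by
  have hf := he.one_sub hn
  have h' : polar n (u₂ * u₃) u₁ = 1 := by rw [he.polar_mul_rotate hn h₁ h₂, h]
  have h'' : polar n (u₃ * u₁) u₂ = 1 := by rw [he.polar_mul_rotate hn h₂ h₃, h']
  have k₁ := he.mul_peirce hn h₂ h₃
  have k₂ := he.mul_peirce hn h₃ h₁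
  have k₃ := he.mul_peirce hn h₁ h₂
  -- Below, `pij` is the pairing of u_i with v_j, `qij` the product v_i v_j and `cij` the product
  -- u_i u_j.
  have p11 : polar n u₁ (u₂ * u₃) = 1 := by rw [QuadraticMap.polar_comm, h']
  have p22 : polar n u₂ (u₃ * u₁) = 1 := by rw [QuadraticMap.polar_comm, h'']
  have p33 : polar n u₃ (u₁ * u₂) = 1 := by rw [QuadraticMap.polar_comm, h]
  have p12 := (he.polar_mul_self_peirce hn h₁ h₃).2
  have p13 := (he.polar_mul_self_peirce hn h₁ h₂).1
  have p21 := (he.polar_mul_self_peirce hn h₂ h₃).1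
  have p23 := (he.polar_mul_self_peirce hn h₂ h₁).2
  have p31 := (he.polar_mul_self_peirce hn h₃ h₂).2
  have p32 := (he.polar_mul_self_peirce hn h₃ h₁).1
  have q32 := he.mul_mul_peirce hn h₁ h₂ h₃ h
  have q13 := he.mul_mul_peirce hn h₂ h₃ h₁ h'
  have q21 := he.mul_mul_peirce hn h₃ h₁ h₂ h''
  have c21 := he.mul_comm_peirce hn h₂ h₁
  have c32 := he.mul_comm_peirce hn h₃ h₂
  have c13 := he.mul_comm_peirce hn h₁ h₃
  rw [c12] at c21 k₃ p33 p13 p23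
  rw [c23] at c32 k₁ p11 p21 p31
  rw [c31] at c13 k₂ p22 p12 p32
  rw [c12, c31] at q32
  rw [c23, c12] at q13
  rw [c31, c23] at q21
  clear h h' h''
  have q23 := (hf.mul_comm_peirce hn k₂ k₃).trans q32
  have q31 := (hf.mul_comm_peirce hn k₃ k₁).trans q13
  have q12 := (hf.mul_comm_peirce hn k₁ k₂).trans q21
  have duv : ∀ {x y}, x ∈ peirceComponent F e → y ∈ peirceComponent F (1 - e) →
      x * y = polar n x y • e ∧ y * x = polar n x y • (1 - e) := fun {x y} hx hy => by
    refine ⟨he.mul_peirce_dual hn hx hy, ?_⟩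
    have := hf.mul_peirce_dual hn hy (y := x) (by rwa [sub_sub_cancel])
    rwa [QuadraticMap.polar_comm] at this
  have hli := he.linearIndependent_of_dual hn (u := ![u₁, u₂, u₃]) (v := ![v₁, v₂, v₃])
    (by intro i; fin_cases i <;> assumption) (by intro i; fin_cases i <;> assumption)
    (by intro i; fin_cases i <;> assumption)
    (by intro i j hij; fin_cases i <;> fin_cases j <;> first | exact absurd rfl hij | assumption)
  have : FiniteDimensional F C := Module.finite_of_finrank_pos (by omega)
  have htop := hli.span_eq_top_of_card_eq_finrank' (by simp [h8])
  have hee := he.mul_self hn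
  have o1 := fun {x : C} (hx : x ∈ peirceComponent F (1 - e)) => mem_peirceComponent_one_sub.1 hx
  have o2 : ∀ {x : C}, x ∈ peirceComponent F e → (1 - e) * x = 0 ∧ x * (1 - e) = x := fun hx => by
    rw [sub_mul, mul_sub, one_mul, mul_one, hx.1, hx.2, sub_self, sub_zero]
    exact ⟨rfl, rfl⟩
  refine ⟨hli, ?_, ?_, ?_, ?_, ?_, ?_, ?_, ?_, ?_⟩
  · rw [← htop]
    congr 1
    simp only [Matrix.range_cons, Matrix.range_empty, Set.union_empty, Set.singleton_union]
    rfl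
  · exact ⟨hee, by rw [mul_sub, mul_one, hee, sub_self], h₁.1, h₂.1, h₃.1, (o1 k₁).1, (o1 k₂).1,
      (o1 k₃).1⟩
  · exact ⟨by rw [sub_mul, one_mul, hee, sub_self], hf.mul_self hn, (o2 h₁).1, (o2 h₂).1, (o2 h₃).1,
      k₁.1, k₂.1, k₃.1⟩
  all_goals simp only [neg_of_charTwo F]
  · refine ⟨h₁.2, (o2 h₁).2, he.mul_self_peirce hn h₁, c12, c13, ?_, ?_, ?_⟩
    · rw [(duv h₁ k₁).1, p11, one_smul]
    · rw [(duv h₁ k₂).1, p12, zero_smul]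
    · rw [(duv h₁ k₃).1, p13, zero_smul]
  · refine ⟨h₂.2, (o2 h₂).2, c21, he.mul_self_peirce hn h₂, c23, ?_, ?_, ?_⟩
    · rw [(duv h₂ k₁).1, p21, zero_smul]
    · rw [(duv h₂ k₂).1, p22, one_smul]
    · rw [(duv h₂ k₃).1, p23, zero_smul]
  · refine ⟨h₃.2, (o2 h₃).2, c31, c32, he.mul_self_peirce hn h₃, ?_, ?_, ?_⟩
    · rw [(duv h₃ k₁).1, p31, zero_smul]
    · rw [(duv h₃ k₂).1, p32, zero_smul]
    · rw [(duv h₃ k₃).1, p33, one_smul]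
  · refine ⟨(o1 k₁).2, k₁.2, ?_, ?_, ?_, hf.mul_self_peirce hn k₁, q12, q13⟩
    · rw [(duv h₁ k₁).2, p11, one_smul]
    · rw [(duv h₂ k₁).2, p21, zero_smul]
    · rw [(duv h₃ k₁).2, p31, zero_smul]
  · refine ⟨(o1 k₂).2, k₂.2, ?_, ?_, ?_, q21, hf.mul_self_peirce hn k₂, q23⟩
    · rw [(duv h₁ k₂).2, p12, zero_smul]
    · rw [(duv h₂ k₂).2, p22, one_smul]
    · rw [(duv h₃ k₂).2, p32, zero_smul]
  · refine ⟨(o1 k₃).2, k₃.2, ?_, ?_, ?_, q31, q32, hf.mul_self_peirce hn k₃⟩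
    · rw [(duv h₁ k₃).2, p13, zero_smul]
    · rw [(duv h₂ k₃).2, p23, zero_smul]
    · rw [(duv h₃ k₃).2, p33, one_smul]

end IsTraceOneIdempotent

end

/-! ### Universal groups of gradings with a multiplicative basis -/

theorem gradingOfDegrees_eq_iSup {F C T : Type*} [Field F] [NonUnitalNonAssocRing C] [Module F C]
    {k : ℕ} (b : Fin k → C) (d : Fin k → T) (m : T) :
    gradingOfDegrees F b d m = ⨆ i, ⨆ (_ : d i = m), Submodule.span F {b i} := by
  apply le_antisymm
  · rw [gradingOfDegrees, Submodule.span_le]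
    rintro _ ⟨i, hi, rfl⟩
    exact Submodule.mem_iSup_of_mem i (Submodule.mem_iSup_of_mem hi
      (Submodule.mem_span_singleton_self _))
  · refine iSup_le fun i => iSup_le fun hi => ?_
    rw [Submodule.span_singleton_le_iff_mem]
    exact Submodule.subset_span ⟨i, hi, rfl⟩

/-- The criterion `hasUniversalForm_of_homogeneous` for a basis that is closed under
multiplication up to zero. -/
theorem hasUniversalForm_of_basis {F C G T : Type*} [Field F] [NonUnitalNonAssocRing C]
    [Module F C] [IsScalarTower F C C] [SMulCommClass F C C] [Group G] [AddGroup T]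
    {A : G → Submodule F C} (hA : IsGroupGrading A) {k : ℕ} (b : Fin k → C) (deg : Fin k → G)
    (d : Fin k → T) (hb : ∀ i, b i ∈ A (deg i)) (hne : ∀ i, b i ≠ 0)
    (htop : Submodule.span F (Set.range b) = ⊤) (hker : ∀ i j, deg i = deg j ↔ d i = d j)
    (hrel : ∀ i j, b i * b j ≠ 0 → ∃ l, b i * b j = b l ∧ d i + d j = d l)
    (hlift : ∀ w : Fin k → UniversalGroup A, (∀ i j, d i = d j → w i = w j) →
      (∀ i j l, b i * b j = b l → w i * w j = w l) →
      ∃ f : Multiplicative T →* UniversalGroup A, ∀ i, f (Multiplicative.ofAdd (d i)) = w i)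
    (hgen : ∀ m, m ∈ AddSubgroup.closure (Set.range d)) :
    HasUniversalForm A (gradingOfDegrees F b d) := by
  have hmul : ∀ i j l, b i * b j = b l → deg i * deg j = deg l := by
    intro i j l h
    have h1 := hA.mul_mem _ _ _ (hb i) _ (hb j)
    rw [h] at h1
    exact hA.eq_of_mem_of_mem (hne l) h1 (hb l)
  refine hasUniversalForm_of_homogeneous hA (fun i => Submodule.span F {b i}) deg d ?_ ?_ ?_
    (gradingOfDegrees_eq_iSup b d) hker ?_ ?_ hgen
  · intro i
    rw [Submodule.span_singleton_le_iff_mem]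
    exact hb i
  · intro i
    rw [Ne, Submodule.span_singleton_eq_bot]
    exact hne i
  · rw [← htop, Submodule.span_range_eq_iSup]
  · rintro i j ⟨x, hx, y, hy, hxy⟩
    obtain ⟨c, rfl⟩ := Submodule.mem_span_singleton.1 hx
    obtain ⟨c', rfl⟩ := Submodule.mem_span_singleton.1 hy
    obtain ⟨l, hl, hd⟩ := hrel i j fun h => hxy (by rw [smul_mul_assoc, mul_smul_comm, h]; simp)
    exact ⟨l, hmul i j l hl, hd⟩
  · intro w hw hw'
    refine hlift w (fun i j h => hw i j ((hker i j).2 h)) fun i j l h => hw' i j l ?_ (hmul i j l h)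
    exact ⟨_, Submodule.mem_span_singleton_self _, _, Submodule.mem_span_singleton_self _,
      h ▸ hne l⟩

/-! ### Homogeneous Peirce decompositions and homogeneous canonical bases -/

section

variable {F C G : Type*} [Field F] [NonAssocRing C] [Module F C] [Group G]
  {n : QuadraticForm F C} {M : ZMod 2 → Submodule F C} {A : G → Submodule F C}

namespace IsHurwitzSuper

/-- Even and odd parts meet only in zero by nondegeneracy, so subspaces of them that together span
the algebra must fill them. -/
theorem eq_of_sup_eq_top (hM : IsHurwitzSuper n M) {S T : Submodule F C} (hS : S ≤ M 0)
    (hT : T ≤ M 1) (h : S ⊔ T = ⊤) : M 0 = S ∧ M 1 = T := by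
  have hdisj : ∀ x ∈ M 0, x ∈ M 1 → x = 0 := by
    intro x h0 h1
    apply hM.nondegenerate
    intro y
    have hy : y ∈ M 0 ⊔ M 1 := hM.sup_eq_top ▸ Submodule.mem_top
    obtain ⟨a, ha, b, hb, rfl⟩ := Submodule.mem_sup.1 hy
    rw [QuadraticMap.polar_add_right, hM.polar_eq_zero x h0 b hb, QuadraticMap.polar_comm,
      hM.polar_eq_zero a ha x h1, add_zero]
  have hdec : ∀ x, ∃ a ∈ S, ∃ b ∈ T, a + b = x := fun x => by
    have hx : x ∈ S ⊔ T := h ▸ Submodule.mem_top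
    exact Submodule.mem_sup.1 hx
  refine ⟨le_antisymm (fun x hx => ?_) hS, le_antisymm (fun x hx => ?_) hT⟩
  · obtain ⟨a, ha, b, hb, rfl⟩ := hdec x
    have hb0 := sub_mem hx (hS ha)
    rw [add_sub_cancel_left] at hb0
    rwa [hdisj b hb0 (hT hb), add_zero]
  · obtain ⟨a, ha, b, hb, rfl⟩ := hdec x
    have ha1 := sub_mem hx (hT hb)
    rw [add_sub_cancel_right] at ha1
    rwa [hdisj a (hS ha) ha1, zero_add]

theorem trace_eq_zero (hM : IsHurwitzSuper n M) {x : C} (hx : x ∈ M 1) : polar n x 1 = 0 := by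
  rw [QuadraticMap.polar_comm]
  exact hM.polar_eq_zero 1 hM.one_mem x hx

theorem conj_mem (hM : IsHurwitzSuper n M) {i : ZMod 2} {x : C} (hx : x ∈ M i) :
    hurwitzConj n x ∈ M i := by
  rw [hurwitzConj]
  rcases ZMod.eq_zero_or_one_of_two i with rfl | rfl
  · exact sub_mem ((M 0).smul_mem _ hM.one_mem) hx
  · rw [hM.trace_eq_zero hx, zero_smul, zero_sub]
    exact neg_mem hx

end IsHurwitzSuper

theorem IsSuperGrading.le_of_inf_le (hA : IsSuperGrading M A) (hM : IsHurwitzSuper n M)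
    {i : ZMod 2} {S : Submodule F C} (h : ∀ g, A g ⊓ M i ≤ S) : M i ≤ S := by
  obtain ⟨h0, h1⟩ := hM.eq_of_sup_eq_top (S := ⨆ g, A g ⊓ M 0) (T := ⨆ g, A g ⊓ M 1)
    (iSup_le fun g => inf_le_right) (iSup_le fun g => inf_le_right) (by
      rw [← iSup_sup_eq, ← hA.iSup_eq_top]
      exact iSup_congr fun g => (hA.compatible g).symm)
  rcases ZMod.eq_zero_or_one_of_two i with rfl | rfl
  · rw [h0]
    exact iSup_le h
  · rw [h1]
    exact iSup_le h

variable [SMulCommClass F C C] [CharP F 2]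

/-- Only an even element of degree 1 can fail to be orthogonal to the plane F1 + Fe. That plane is
itself even of degree 1, so its component can be subtracted without losing homogeneity. -/
theorem exists_homogeneous_orthogonal (hA : IsSuperGrading M A) (hM : IsHurwitzSuper n M) {e : C}
    (he : IsTraceOneIdempotent n e) (heA : e ∈ A 1) (heM : e ∈ M 0) {g : G} {i : ZMod 2} {y : C}
    (hy : y ∈ A g) (hyi : y ∈ M i) : ∃ z ∈ A g, z ∈ M i ∧ polar n z 1 = 0 ∧ polar n z e = 0 ∧
      ∀ x, polar n x 1 = 0 → polar n x e = 0 → polar n x z = polar n x y := by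
  by_cases hgi : g = 1 ∧ i = 0
  · obtain ⟨rfl, rfl⟩ := hgi
    obtain ⟨a, b, h1, h2⟩ := IsHurwitzNorm.exists_orthogonal_sub
      (by rw [he.trace]; exact one_ne_zero) y
    refine ⟨_, sub_mem hy (add_mem ((A 1).smul_mem a hA.one_mem) ((A 1).smul_mem b heA)),
      sub_mem hyi (add_mem ((M 0).smul_mem a hM.one_mem) ((M 0).smul_mem b heM)), h1, h2, ?_⟩
    intro x hx1 hx2
    simp [QuadraticMap.polar_sub_right, QuadraticMap.polar_add_right,
      QuadraticMap.polar_smul_right, hx1, hx2]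
  · refine ⟨y, hy, hyi, ?_, ?_, fun _ _ _ => rfl⟩ <;> by_cases hg : g = 1
    · have hi : ∀ i : ZMod 2, i ≠ 0 → i = 1 := by decide
      rw [hi i fun h => hgi ⟨hg, h⟩] at hyi
      exact hM.trace_eq_zero hyi
    · exact hA.trace_eq_zero hM.toIsHurwitzNorm hg hy
    · have hi : ∀ i : ZMod 2, i ≠ 0 → i = 1 := by decide
      rw [hi i fun h => hgi ⟨hg, h⟩] at hyi
      rw [QuadraticMap.polar_comm]
      exact hM.polar_eq_zero e heM y hyi
    · exact hA.polar_eq_zero hM.toIsHurwitzNorm (by rwa [mul_one]) hy heA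

variable [IsScalarTower F C C]

/-- Take a homogeneous partner of u, make it orthogonal to 1 and e, and keep its V-part; the U-part
pairs to zero with u because U is totally isotropic. -/
theorem exists_dual_peirce (hA : IsSuperGrading M A) (hM : IsHurwitzSuper n M) {e : C}
    (he : IsTraceOneIdempotent n e) (heA : e ∈ A 1) (heM : e ∈ M 0) {g : G} {i : ZMod 2} {u : C}
    (hu : u ∈ peirceComponent F e) (hug : u ∈ A g) (hui : u ∈ M i) (h0 : u ≠ 0) :
    ∃ v ∈ peirceComponent F (1 - e), v ∈ A g⁻¹ ∧ v ∈ M i ∧ polar n u v = 1 := by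
  obtain ⟨y, hy, hyi, huy⟩ := hA.exists_polar_eq_one hM hug hui h0
  obtain ⟨z, hz, hzi, hz1, hze, hyz⟩ := exists_homogeneous_orthogonal hA hM he heA heM hy hyi
  obtain ⟨h1, h2⟩ := he.mul_mem_peirce_of_orthogonal hM.toIsHurwitzNorm hz1 hze
  have hezA := hA.mul_mem _ _ e heA z hz
  have hezM := hM.mul_mem _ _ e heM z hzi
  rw [one_mul] at hezA
  rw [zero_add] at hezM
  refine ⟨_, h2, sub_mem hz hezA, sub_mem hzi hezM, ?_⟩
  rw [QuadraticMap.polar_sub_right, he.polar_peirce hM.toIsHurwitzNorm hu h1, sub_zero,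
    hyz u (he.trace_peirce hM.toIsHurwitzNorm hu).1
      (he.polar_peirce_of_mem hM.toIsHurwitzNorm hu).2.1, huy]

theorem exists_homogeneous_peirce (hA : IsSuperGrading M A) (hM : IsHurwitzSuper n M) {e : C}
    (he : IsTraceOneIdempotent n e) (heA : e ∈ A 1) (heM : e ∈ M 0) {i : ZMod 2} {x : C}
    (hxi : x ∈ M i) (hx0 : x ≠ 0) (hx1 : polar n x 1 = 0) (hxe : polar n x e = 0) :
    ∃ g, ∃ u ∈ peirceComponent F e, u ∈ A g ∧ u ∈ M i ∧ u ≠ 0 := by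
  have hf := he.one_sub hM.toIsHurwitzNorm
  obtain ⟨g, y, hy, hyi, hxy⟩ := hA.exists_polar_ne_zero hM hxi hx0
  obtain ⟨z, hz, hzi, hz1, hze, hyz⟩ := exists_homogeneous_orthogonal hA hM he heA heM hy hyi
  obtain ⟨h1, h2⟩ := he.mul_mem_peirce_of_orthogonal hM.toIsHurwitzNorm hz1 hze
  have hezA := hA.mul_mem _ _ e heA z hz
  have hezM := hM.mul_mem _ _ e heM z hzi
  rw [one_mul] at hezA
  rw [zero_add] at hezM
  -- If the U-part of z vanishes then z lies in V, and a dual partner of z lies in U.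
  by_cases hez : e * z = 0
  · rw [hez, sub_zero] at h2
    have hz0 : z ≠ 0 := by
      rintro rfl
      rw [← hyz x hx1 hxe, QuadraticMap.polar_zero_right] at hxy
      exact hxy rfl
    obtain ⟨v, hv, hvA, hvM, hzv⟩ := exists_dual_peirce hA hM hf (sub_mem hA.one_mem heA)
      (sub_mem hM.one_mem heM) h2 hz hzi hz0
    rw [sub_sub_cancel] at hv
    refine ⟨_, v, hv, hvA, hvM, ?_⟩
    rintro rfl
    rw [QuadraticMap.polar_zero_right] at hzv
    exact zero_ne_one hzv
  · exact ⟨g, _, h1, hezA, hezM, hez⟩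

/-- A canonical basis consists of homogeneous elements of the degrees `g i` and their inverses. -/
structure IsHomogeneousTriple (n : QuadraticForm F C) (M : ZMod 2 → Submodule F C)
    (A : G → Submodule F C) (e : C) (u : Fin 3 → C) (g : Fin 3 → G) : Prop where
  mem_peirce : ∀ i, u i ∈ peirceComponent F e
  mem_grading : ∀ i, u i ∈ A (g i)
  mem_one : u 0 ∈ M 1
  mem_one' : u 1 ∈ M 1
  mem_zero : u 2 ∈ M 0
  polar_eq : polar n (u 0 * u 1) (u 2) = 1

/-- An even u₃ in U exists because the even part is larger than the plane F1 + Fe, and an odd u₁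
because the odd part is nonzero and orthogonal to that plane. The last element u₂ is a dual partner
of u₃u₁, which fixes its degree. -/
theorem exists_isHomogeneousTriple (hA : IsSuperGrading M A) (hM : IsHurwitzSuper n M) {e : C}
    (he : IsTraceOneIdempotent n e) (heA : e ∈ A 1) (heM : e ∈ M 0)
    (h4 : Module.finrank F (M 0) = 4) : ∃ u g, IsHomogeneousTriple n M A e u g := by
  have hn := hM.toIsHurwitzNorm
  have het : polar n e 1 ≠ 0 := by rw [he.trace]; exact one_ne_zero
  have hf := he.one_sub hn
  obtain ⟨x, hx, hx0, hx1, hxe⟩ := IsHurwitzNorm.exists_orthogonal_of_not_le het hM.one_mem heM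
    (fun h => by
      have : FiniteDimensional F (Submodule.span F {1, e}) :=
        FiniteDimensional.span_of_finite F (Set.toFinite _)
      have h1 := Submodule.finrank_mono h
      rw [IsHurwitzNorm.finrank_span_one_pair het] at h1
      omega)
  obtain ⟨k, u₃, hu₃, hu₃A, hu₃M, hu₃0⟩ :=
    exists_homogeneous_peirce hA hM he heA heM hx hx0 hx1 hxe
  obtain ⟨v₃, hv₃, hv₃A, hv₃M, huv⟩ := exists_dual_peirce hA hM he heA heM hu₃ hu₃A hu₃M hu₃0
  obtain ⟨y, hy, hny⟩ := hM.exists_norm_ne_zero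
  obtain ⟨g, u₁, hu₁, hu₁A, hu₁M, hu₁0⟩ :=
    exists_homogeneous_peirce hA hM he heA heM hy (by rintro rfl; simp at hny)
      (hM.trace_eq_zero hy) (by rw [QuadraticMap.polar_comm]; exact hM.polar_eq_zero e heM y hy)
  have hmul : u₃ * u₁ ∈ peirceComponent F (1 - e) := he.mul_peirce hn hu₃ hu₁
  -- For v₃ dual to u₃, linearised alternativity gives v₃(u₃u₁) + u₃(v₃u₁) = −u₁, and v₃u₁ is a
  -- multiple of n(v₃,u₁), which vanishes by parity.
  have hne : u₃ * u₁ ≠ 0 := by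
    intro h
    have h1 := hn.mul_mul_left_add v₃ u₃ u₁
    have h2 : v₃ * u₁ = 0 := by
      rw [hf.mul_peirce_dual hn hv₃ (by rwa [sub_sub_cancel]), hM.polar_eq_zero v₃ hv₃M u₁ hu₁M,
        zero_smul]
    rw [h, h2, (he.trace_peirce hn hu₃).1, (hf.trace_peirce hn hv₃).1, QuadraticMap.polar_comm,
      huv, one_smul] at h1
    simp only [mul_zero, smul_zero, add_zero, zero_sub, zero_eq_neg] at h1
    exact hu₁0 h1
  have hmulM := hM.mul_mem _ _ u₃ hu₃M u₁ hu₁M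
  rw [zero_add] at hmulM
  obtain ⟨u₂, hu₂, hu₂A, hu₂M, h2⟩ := exists_dual_peirce hA hM hf (sub_mem hA.one_mem heA)
    (sub_mem hM.one_mem heM) hmul (hA.mul_mem _ _ _ hu₃A _ hu₁A) hmulM hne
  rw [sub_sub_cancel] at hu₂
  refine ⟨![u₁, u₂, u₃], ![g, (k * g)⁻¹, k], ?_, ?_, hu₁M, hu₂M, hu₃M, ?_⟩
  · intro i
    fin_cases i <;> assumption
  · intro i
    fin_cases i <;> assumption
  · change polar n (u₁ * u₂) u₃ = 1
    rw [← he.polar_mul_rotate hn hu₁ hu₂, ← he.polar_mul_rotate hn hu₂ hu₃, h2]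

end

/-! ### Triples of commuting degrees with product one -/

/-- `T` is the abelian group generated by `a 0`, `a 1`, `a 2` with the relation
`a 0 + a 1 + a 2 = 0` and those among `a i = 0`, `a i = a j`, `2 a i = 0` that hold in it. -/
structure IsUniversalTriple.{v, t} {T : Type t} [AddCommGroup T] (a : Fin 3 → T) : Prop where
  sum_eq : a 0 + a 1 + a 2 = 0
  lift : ∀ {W : Type v} [Group W] (w : Fin 3 → W), w 0 * w 1 * w 2 = 1 → Commute (w 0) (w 1) →
    (∀ i, a i = 0 → w i = 1) → (∀ i j, a i = a j → w i = w j) →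
    (∀ i, a i + a i = 0 → w i * w i = 1) →
    ∃ f : Multiplicative T →* W, ∀ i, f (Multiplicative.ofAdd (a i)) = w i
  gen : ∀ m, m ∈ AddSubgroup.closure (Set.range a)

theorem mul_eq_one_iff_of_mul_mul_eq_one {W : Type*} [Group W] {w : Fin 3 → W}
    (h : w 0 * w 1 * w 2 = 1) (hc : Commute (w 0) (w 1)) :
    (w 0 * w 1 = 1 ↔ w 2 = 1) ∧ (w 1 * w 0 = 1 ↔ w 2 = 1) ∧ (w 0 * w 2 = 1 ↔ w 1 = 1) ∧
      (w 2 * w 0 = 1 ↔ w 1 = 1) ∧ (w 1 * w 2 = 1 ↔ w 0 = 1) ∧ (w 2 * w 1 = 1 ↔ w 0 = 1) := by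
  have h2 : w 2 = (w 0 * w 1)⁻¹ := eq_inv_of_mul_eq_one_right h
  have h2' : w 2 = (w 1 * w 0)⁻¹ := by rw [h2, hc.eq]
  refine ⟨by rw [h2, inv_eq_one], by rw [h2', inv_eq_one], ?_, ?_, ?_, ?_⟩
  · rw [h2', mul_inv_rev, mul_inv_cancel_left, inv_eq_one]
  · rw [h2, mul_inv_rev, inv_mul_cancel_right, inv_eq_one]
  · rw [h2, mul_inv_rev, mul_inv_cancel_left, inv_eq_one]
  · rw [h2', mul_inv_rev, inv_mul_cancel_right, inv_eq_one]

/-- The relations are symmetric under reversal once the three elements commute; commutation of w 2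
with w 1 follows from w 2 = (w 0 w 1)⁻¹. This lets one model serve two systems of degrees. -/
theorem IsUniversalTriple.reverse.{v, t} {T : Type t} [AddCommGroup T] {a b c : T}
    (h : IsUniversalTriple.{v} ![a, b, c]) : IsUniversalTriple.{v} ![c, b, a] := by
  have hr : ∀ {X : Type _} (x y z : X) (i : Fin 3), ![x, y, z] (Fin.rev i) = ![z, y, x] i := by
    intro X x y z i
    fin_cases i <;> rfl
  have hr' : ∀ i : Fin 3, ![c, b, a] (Fin.rev i) = ![a, b, c] i := hr _ _ _
  refine ⟨?_, ?_, ?_⟩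
  · have := h.sum_eq
    change a + b + c = 0 at this
    change c + b + a = 0
    rw [← this]
    abel
  · intro W _ w h1 hc h2 h3 h4
    have h02 : w 2 = (w 0 * w 1)⁻¹ := eq_inv_of_mul_eq_one_right h1
    have hc21 : Commute (w 2) (w 1) := by
      rw [h02]
      exact ((hc.mul_left (Commute.refl _)).inv_left)
    obtain ⟨f, hf⟩ := h.lift (fun i => w (Fin.rev i)) (by
        change w 2 * w 1 * w 0 = 1
        rw [mul_assoc, ← hc.eq, h02, inv_mul_cancel]) hc21 (fun i hi => h2 _ (by rw [hr', hi]))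
      (fun i j hij => h3 _ _ (by rw [hr', hr', hij])) (fun i hi => h4 _ (by rw [hr', hi]))
    refine ⟨f, fun i => ?_⟩
    have := hf (Fin.rev i)
    rw [Fin.rev_rev] at this
    rw [← this, ← hr', Fin.rev_rev]
  · intro m
    refine AddSubgroup.closure_mono ?_ (h.gen m)
    rintro _ ⟨i, rfl⟩
    exact ⟨Fin.rev i, hr' i⟩

/-- For i ≠ j, a coincidence g_i = g_j⁻¹ says that the third degree is 1, and g_i = g_i⁻¹ says g_i²
= 1. Thus the three kinds of coincidence in the hypotheses control all eight degrees. -/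
theorem degree_eq_iff {G T : Type*} [Group G] [AddCommGroup T] {g : Fin 3 → G} {a : Fin 3 → T}
    (h : g 0 * g 1 * g 2 = 1) (hc : Commute (g 0) (g 1)) (ha : a 0 + a 1 + a 2 = 0)
    (h1 : ∀ i, g i = 1 ↔ a i = 0) (h2 : ∀ i j, g i = g j ↔ a i = a j)
    (h3 : ∀ i, g i * g i = 1 ↔ a i + a i = 0) (i j : Fin 8) :
    ![1, 1, g 0, g 1, g 2, (g 0)⁻¹, (g 1)⁻¹, (g 2)⁻¹] i =
      ![1, 1, g 0, g 1, g 2, (g 0)⁻¹, (g 1)⁻¹, (g 2)⁻¹] j ↔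
    ![0, 0, a 0, a 1, a 2, -a 0, -a 1, -a 2] i = ![0, 0, a 0, a 1, a 2, -a 0, -a 1, -a 2] j := by
  obtain ⟨p1, p2, p3, p4, p5, p6⟩ := mul_eq_one_iff_of_mul_mul_eq_one h hc
  obtain ⟨q1, q2, q3, q4, q5, q6⟩ := mul_eq_one_iff_of_mul_mul_eq_one
    (w := fun i => Multiplicative.ofAdd (a i)) ha (Commute.all _ _)
  change a 0 + a 1 = 0 ↔ a 2 = 0 at q1
  change a 1 + a 0 = 0 ↔ a 2 = 0 at q2
  change a 0 + a 2 = 0 ↔ a 1 = 0 at q3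
  change a 2 + a 0 = 0 ↔ a 1 = 0 at q4
  change a 1 + a 2 = 0 ↔ a 0 = 0 at q5
  change a 2 + a 1 = 0 ↔ a 0 = 0 at q6
  have h1' : ∀ i, 1 = g i ↔ 0 = a i := fun i => by rw [eq_comm, h1, eq_comm]
  fin_cases i <;> fin_cases j <;>
    simp [h1, h1', h2, h3, eq_inv_iff_mul_eq_one, inv_eq_iff_mul_eq_one,
      eq_neg_iff_add_eq_zero, neg_eq_iff_add_eq_zero, inv_mul_eq_one,
      neg_add_eq_zero, p1, p2, p3, p4, p5, p6, q1,
      q2, q3, q4, q5, q6]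

theorem forall_fin_eight {p : Fin 8 → Prop}
    (h : p 0 ∧ p 1 ∧ p 2 ∧ p 3 ∧ p 4 ∧ p 5 ∧ p 6 ∧ p 7) : ∀ i, p i := by
  intro i
  obtain ⟨h0, h1, h2, h3, h4, h5, h6, h7⟩ := h
  fin_cases i <;> assumption

/-- The index of the product of two members of a canonical basis, if it is not zero. -/
def canonicalMul : Fin 8 → Fin 8 → Option (Fin 8) :=
  ![![some 0, none, some 2, some 3, some 4, none, none, none],
    ![none, some 1, none, none, none, some 5, some 6, some 7],
    ![none, some 2, none, some 7, some 6, some 0, none, none],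
    ![none, some 3, some 7, none, some 5, none, some 0, none],
    ![none, some 4, some 6, some 5, none, none, none, some 0],
    ![some 5, none, some 1, none, none, none, some 4, some 3],
    ![some 6, none, none, some 1, none, some 4, none, some 2],
    ![some 7, none, none, none, some 1, some 3, some 2, none]]

/-- The signs of the multiplication table disappear in characteristic two, so the basis together
with 0 is closed under multiplication. -/
theorem IsCanonicalBasis₈.mul_eq {F C : Type*} [Field F] [CharP F 2] [NonUnitalNonAssocRing C]
    [Module F C] {e₁ e₂ u₁ u₂ u₃ v₁ v₂ v₃ : C}
    (h : IsCanonicalBasis₈ F e₁ e₂ u₁ u₂ u₃ v₁ v₂ v₃) (i j : Fin 8) :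
    ![e₁, e₂, u₁, u₂, u₃, v₁, v₂, v₃] i * ![e₁, e₂, u₁, u₂, u₃, v₁, v₂, v₃] j =
      (canonicalMul i j).elim 0 ![e₁, e₂, u₁, u₂, u₃, v₁, v₂, v₃] := by
  obtain ⟨-, -, h0, h1, h2, h3, h4, h5, h6, h7⟩ := h
  simp only [neg_of_charTwo F] at h0 h1 h2 h3 h4 h5 h6 h7
  revert j
  revert i
  exact forall_fin_eight ⟨forall_fin_eight h0, forall_fin_eight h1, forall_fin_eight h2,
    forall_fin_eight h3, forall_fin_eight h4, forall_fin_eight h5, forall_fin_eight h6,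
    forall_fin_eight h7⟩

theorem degree_add {T : Type*} [AddCommGroup T] {a : Fin 3 → T} (ha : a 0 + a 1 + a 2 = 0)
    (i j l : Fin 8) (hl : canonicalMul i j = some l) :
    ![0, 0, a 0, a 1, a 2, -a 0, -a 1, -a 2] i + ![0, 0, a 0, a 1, a 2, -a 0, -a 1, -a 2] j =
      ![0, 0, a 0, a 1, a 2, -a 0, -a 1, -a 2] l := by
  have ha2 : a 2 = -a 0 - a 1 := by
    rw [← sub_eq_zero, ← ha]
    abel
  fin_cases i <;> fin_cases j <;> cases hl <;> simp [ha2] <;> abel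

/-! ### The universal group attached to a homogeneous triple -/

namespace IsHomogeneousTriple

variable {F C G : Type*} [Field F] [NonAssocRing C] [Module F C] [IsScalarTower F C C]
  [SMulCommClass F C C] {n : QuadraticForm F C} {M : ZMod 2 → Submodule F C}
  {A : G → Submodule F C} {e : C} {u : Fin 3 → C} {g : Fin 3 → G}

theorem mul_ne_zero (h : IsHomogeneousTriple n M A e u g) : u 0 * u 1 ≠ 0 := by
  intro h0
  have := h.polar_eq
  rw [h0, QuadraticMap.polar_zero_left] at this
  exact zero_ne_one this

theorem degree_mul [Group G] (h : IsHomogeneousTriple n M A e u g)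
    (hA : IsGroupGrading A)
    (hn : IsHurwitzNorm n) : g 0 * g 1 * g 2 = 1 := by
  by_contra hg
  have := h.polar_eq
  rw [hA.polar_eq_zero hn hg (hA.mul_mem _ _ _ (h.mem_grading 0) _ (h.mem_grading 1))
    (h.mem_grading 2)] at this
  exact zero_ne_one this

/-- The nonzero product u 0 · u 1 = u 1 · u 0 is homogeneous of both degrees g 0 g 1 and g 1 g 0. -/
theorem degree_comm [CharP F 2] [Group G] (h : IsHomogeneousTriple n M A e u g)
    (hA : IsGroupGrading A)
    (hn : IsHurwitzNorm n) (he : IsTraceOneIdempotent n e) : Commute (g 0) (g 1) := by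
  refine hA.eq_of_mem_of_mem h.mul_ne_zero
    (hA.mul_mem _ _ _ (h.mem_grading 0) _ (h.mem_grading 1)) ?_
  rw [he.mul_comm_peirce hn (h.mem_peirce 0) (h.mem_peirce 1)]
  exact hA.mul_mem _ _ _ (h.mem_grading 1) _ (h.mem_grading 0)

theorem swap [CharP F 2] (h : IsHomogeneousTriple n M A e u g) (hn : IsHurwitzNorm n)
    (he : IsTraceOneIdempotent n e) :
    IsHomogeneousTriple n M A e ![u 1, u 0, u 2] ![g 1, g 0, g 2] := by
  refine ⟨?_, ?_, h.mem_one', h.mem_one, h.mem_zero, ?_⟩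
  · intro i
    fin_cases i
    exacts [h.mem_peirce 1, h.mem_peirce 0, h.mem_peirce 2]
  · intro i
    fin_cases i
    exacts [h.mem_grading 1, h.mem_grading 0, h.mem_grading 2]
  · change polar n (u 1 * u 0) (u 2) = 1
    rw [he.mul_comm_peirce hn (h.mem_peirce 1) (h.mem_peirce 0), h.polar_eq]

theorem isCanonicalBasis₈ [CharP F 2] (h : IsHomogeneousTriple n M A e u g) (hn : IsHurwitzNorm n)
    (h8 : Module.finrank F C = 8) (he : IsTraceOneIdempotent n e) :
    IsCanonicalBasis₈ F e (1 - e) (u 0) (u 1) (u 2) (u 1 * u 2) (u 2 * u 0) (u 0 * u 1) :=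
  he.isCanonicalBasis₈ hn h8 (h.mem_peirce 0) (h.mem_peirce 1) (h.mem_peirce 2) h.polar_eq rfl rfl
    rfl

theorem mem_grading_mul [Group G] (h : IsHomogeneousTriple n M A e u g)
    (hA : IsGroupGrading A)
    (hn : IsHurwitzNorm n) :
    u 1 * u 2 ∈ A (g 0)⁻¹ ∧ u 2 * u 0 ∈ A (g 1)⁻¹ ∧ u 0 * u 1 ∈ A (g 2)⁻¹ := by
  have h1 := h.degree_mul hA hn
  refine ⟨?_, ?_, ?_⟩
  · have : (g 0)⁻¹ = g 1 * g 2 := inv_eq_of_mul_eq_one_right (by rw [← mul_assoc, h1])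
    rw [this]
    exact hA.mul_mem _ _ _ (h.mem_grading 1) _ (h.mem_grading 2)
  · have : (g 1)⁻¹ = g 2 * g 0 := by
      apply inv_eq_of_mul_eq_one_left
      rw [mul_assoc, mul_eq_one_comm, h1]
    rw [this]
    exact hA.mul_mem _ _ _ (h.mem_grading 2) _ (h.mem_grading 0)
  · rw [inv_eq_of_mul_eq_one_left h1]
    exact hA.mul_mem _ _ _ (h.mem_grading 0) _ (h.mem_grading 1)

/-- A compatible assignment of group elements to the eight basis vectors sends the idempotents to 1
and each v_i to the inverse of the value at u_i. It is thus determined by three values that commute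
and have product 1, and the universal property of `T` applies to them. -/
theorem hasUniversalForm.{x, y, z, t} {F : Type x} {C : Type y} {G : Type z} [Field F] [CharP F 2]
    [NonAssocRing C] [Module F C] [IsScalarTower F C C] [SMulCommClass F C C] [Group G]
    {n : QuadraticForm F C} {M : ZMod 2 → Submodule F C}
    {A : G → Submodule F C} {e : C} {u : Fin 3 → C} {g : Fin 3 → G}
    (h : IsHomogeneousTriple n M A e u g)
    (hA : IsGroupGrading A)
    (hn : IsHurwitzNorm n) (h8 : Module.finrank F C = 8) (he : IsTraceOneIdempotent n e)
    (heA : e ∈ A 1) {T : Type t} [AddCommGroup T] {a : Fin 3 → T} (ha : IsUniversalTriple.{z} a)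
    (h1 : ∀ i, g i = 1 ↔ a i = 0) (h2 : ∀ i j, g i = g j ↔ a i = a j)
    (h3 : ∀ i, g i * g i = 1 ↔ a i + a i = 0) :
    HasUniversalForm A (gradingOfDegrees F
      ![e, 1 - e, u 0, u 1, u 2, u 1 * u 2, u 2 * u 0, u 0 * u 1]
      ![0, 0, a 0, a 1, a 2, -a 0, -a 1, -a 2]) := by
  have hb := h.isCanonicalBasis₈ hn h8 he
  have hv := h.mem_grading_mul hA hn
  have hne := fun i => hb.linearIndependent.ne_zero i
  have hdist := hb.mul_eq
  have : FiniteDimensional F C := Module.finite_of_finrank_pos (by omega)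
  refine hasUniversalForm_of_basis hA _
    ![1, 1, g 0, g 1, g 2, (g 0)⁻¹, (g 1)⁻¹, (g 2)⁻¹] _ ?_ hne
    (hb.linearIndependent.span_eq_top_of_card_eq_finrank' (by simp [h8]))
    (degree_eq_iff (h.degree_mul hA hn) (h.degree_comm hA hn he) ha.sum_eq h1 h2 h3) ?_ ?_ ?_
  · exact forall_fin_eight ⟨heA, sub_mem hA.one_mem heA, h.mem_grading 0, h.mem_grading 1,
      h.mem_grading 2, hv.1, hv.2.1, hv.2.2⟩
  · intro i j hij
    cases hl : canonicalMul i j with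
    | none => exact absurd (by rw [hdist, hl]; rfl) hij
    | some l => exact ⟨l, by rw [hdist, hl]; rfl, degree_add ha.sum_eq i j l hl⟩
  · intro w hw hw'
    have hmul : ∀ i j l, canonicalMul i j = some l → w i * w j = w l := fun i j l hl =>
      hw' i j l (by rw [hdist, hl]; rfl)
    have w0 : w 0 = 1 := mul_eq_left.1 (hmul 0 0 0 rfl)
    have w1 : w 1 = 1 := mul_eq_left.1 (hmul 1 1 1 rfl)
    have w5 : w 5 = (w 2)⁻¹ := eq_inv_of_mul_eq_one_right ((hmul 2 5 0 rfl).trans w0)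
    have w6 : w 6 = (w 3)⁻¹ := eq_inv_of_mul_eq_one_right ((hmul 3 6 0 rfl).trans w0)
    have w7 : w 7 = (w 4)⁻¹ := eq_inv_of_mul_eq_one_right ((hmul 4 7 0 rfl).trans w0)
    obtain ⟨f, hf⟩ := ha.lift ![w 2, w 3, w 4] (by
        change w 2 * w 3 * w 4 = 1
        rw [hmul 2 3 7 rfl, w7, inv_mul_cancel])
      ((hmul 2 3 7 rfl).trans (hmul 3 2 7 rfl).symm)
      (by
        intro i hi
        fin_cases i
        · exact (hw 2 0 hi).trans w0
        · exact (hw 3 0 hi).trans w0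
        · exact (hw 4 0 hi).trans w0)
      (by
        intro i j hij
        fin_cases i <;> fin_cases j
        exacts [rfl, hw 2 3 hij, hw 2 4 hij, hw 3 2 hij, rfl, hw 3 4 hij, hw 4 2 hij, hw 4 3 hij,
          rfl])
      (by
        intro i hi
        -- The relation 2a_i = 0 means that u_i and v_i share a degree, so their values, which are
        -- inverse to each other, are equal.
        rw [add_eq_zero_iff_eq_neg] at hi
        rw [mul_eq_one_iff_eq_inv]
        fin_cases i
        · exact (hw 2 5 hi).trans w5
        · exact (hw 3 6 hi).trans w6
        · exact (hw 4 7 hi).trans w7)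
    refine ⟨f, forall_fin_eight ⟨?_, ?_, hf 0, hf 1, hf 2, ?_, ?_, ?_⟩⟩
    · rw [w0]
      exact map_one f
    · rw [w1]
      exact map_one f
    · rw [w5]
      exact (map_inv f _).trans (congrArg _ (hf 0))
    · rw [w6]
      exact (map_inv f _).trans (congrArg _ (hf 1))
    · rw [w7]
      exact (map_inv f _).trans (congrArg _ (hf 2))
  · intro m
    refine AddSubgroup.closure_mono ?_ (ha.gen m)
    rintro _ ⟨i, rfl⟩
    fin_cases i
    exacts [⟨2, rfl⟩, ⟨3, rfl⟩, ⟨4, rfl⟩]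

end IsHomogeneousTriple

/-! ### The universal groups -/

theorem mem_closure_of_zsmul {T : Type*} [AddCommGroup T] {a : Fin 3 → T}
    (h : ∀ m, ∃ x y : ℤ, m = x • a 0 + y • a 1) (m : T) :
    m ∈ AddSubgroup.closure (Set.range a) := by
  obtain ⟨x, y, rfl⟩ := h m
  exact add_mem (zsmul_mem (AddSubgroup.subset_closure (Set.mem_range_self 0)) x)
    (zsmul_mem (AddSubgroup.subset_closure (Set.mem_range_self 1)) y)

theorem exists_hom_int {W : Type*} [Group W] (w : W) :
    ∃ f : Multiplicative ℤ →* W, ∀ m : ℤ, f (Multiplicative.ofAdd m) = w ^ m :=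
  ⟨zpowersHom W w, fun _ => rfl⟩

theorem isUniversalTriple_int_int :
    IsUniversalTriple ![((1, 0) : ℤ × ℤ), (0, 1), (-1, -1)] where
  sum_eq := rfl
  lift w h hc _ _ _ := by
    obtain ⟨f, hf⟩ := exists_hom_int (w 0)
    obtain ⟨f', hf'⟩ := exists_hom_int (w 1)
    obtain ⟨k, hk⟩ := exists_hom_prod f f' fun x y => by
      have h1 := hf x.toAdd
      have h2 := hf' y.toAdd
      rw [ofAdd_toAdd] at h1 h2
      rw [h1, h2]
      exact hc.zpow_zpow _ _
    refine ⟨k, fun i => ?_⟩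
    have h2 : w 2 = (w 0 * w 1)⁻¹ := eq_inv_of_mul_eq_one_right h
    fin_cases i <;> simp [hk, hf, hf', h2, hc.eq]
  gen := mem_closure_of_zsmul fun m => ⟨m.1, m.2, by ext <;> simp⟩

theorem isUniversalTriple_int_one_neg_one : IsUniversalTriple ![(1 : ℤ), -1, 0] where
  sum_eq := rfl
  lift w h hc h0 _ _ := by
    obtain ⟨f, hf⟩ := exists_hom_int (w 0)
    refine ⟨f, fun i => ?_⟩
    have h2 : w 2 = 1 := h0 2 rfl
    have h1 : w 1 = (w 0)⁻¹ := by
      rw [h2, mul_one] at h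
      exact eq_inv_of_mul_eq_one_right h
    fin_cases i <;> simp [hf, h2, h1]
  gen := mem_closure_of_zsmul fun m => ⟨m, 0, by simp⟩

theorem isUniversalTriple_int_one_one : IsUniversalTriple ![(1 : ℤ), 1, -2] where
  sum_eq := rfl
  lift w h hc _ he _ := by
    obtain ⟨f, hf⟩ := exists_hom_int (w 0)
    refine ⟨f, fun i => ?_⟩
    have h1 : w 1 = w 0 := he 1 0 rfl
    have h2 : w 2 = (w 0 * w 1)⁻¹ := eq_inv_of_mul_eq_one_right h
    fin_cases i <;> simp [hf, h2, h1, zpow_ofNat, pow_two]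
  gen := mem_closure_of_zsmul fun m => ⟨m, 0, by simp⟩

theorem isUniversalTriple_zmod_three : IsUniversalTriple ![(1 : ZMod 3), 1, 1] where
  sum_eq := rfl
  lift w h hc _ he _ := by
    have h1 : w 1 = w 0 := he 1 0 rfl
    have h2 : w 2 = w 0 := he 2 0 rfl
    obtain ⟨f, hf⟩ := exists_hom_of_zpow_eq_one 3 (w := w 0) (by
      rw [h1, h2] at h
      rw [pow_succ, pow_two, h])
    have hf1 := hf 1
    rw [Int.cast_one, zpow_one] at hf1
    refine ⟨f, fun i => ?_⟩
    fin_cases i <;> simp [hf1, h2, h1]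
  gen := mem_closure_of_zsmul fun m => ⟨m.val, 0, by simp⟩

theorem isUniversalTriple_zmod_four : IsUniversalTriple ![(1 : ZMod 4), 1, 2] where
  sum_eq := rfl
  lift w h hc _ he hs := by
    have h1 : w 1 = w 0 := he 1 0 rfl
    -- Here w 2 is an involution and w 0 w 1 w 2 = 1, so w 2 equals w 0 w 1.
    have h2 : w 2 = w 0 * w 0 := by
      rw [h1] at h
      have := hs 2 rfl
      exact (mul_right_cancel (this.trans h.symm))
    obtain ⟨f, hf⟩ := exists_hom_of_zpow_eq_one 4 (w := w 0) (by
      have := hs 2 rfl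
      rw [h2] at this
      rw [pow_succ, pow_succ, pow_two, mul_assoc, this])
    have hf1 := hf 1
    have hf2 := hf 2
    rw [Int.cast_one, zpow_one] at hf1
    rw [Int.cast_ofNat, zpow_ofNat, pow_two] at hf2
    refine ⟨f, fun i => ?_⟩
    fin_cases i <;> simp [hf1, hf2, h2, h1]
  gen := mem_closure_of_zsmul fun m => ⟨m.val, 0, by simp⟩

theorem isUniversalTriple_int_zmod_two :
    IsUniversalTriple ![((0, 1) : ℤ × ZMod 2), (1, 0), (-1, 1)] where
  sum_eq := rfl
  lift w h hc _ _ hs := by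
    have h00 : w 0 * w 0 = 1 := hs 0 rfl
    obtain ⟨f, hf⟩ := exists_hom_int (w 1)
    obtain ⟨f', hf'⟩ := exists_hom_of_zpow_eq_one 2 (w := w 0) (by rw [pow_two, h00])
    obtain ⟨k, hk⟩ := exists_hom_prod f f' fun x y => by
      have h1 := hf x.toAdd
      have h2 := hf' (y.toAdd.val : ℤ)
      rw [ofAdd_toAdd] at h1
      rw [Int.cast_natCast, ZMod.natCast_zmod_val, ofAdd_toAdd] at h2
      rw [h1, h2]
      exact hc.symm.zpow_zpow _ _
    have hf1 := hf' 1
    rw [Int.cast_one, zpow_one] at hf1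
    refine ⟨k, fun i => ?_⟩
    have h2 : w 2 = (w 1)⁻¹ * w 0 := by
      rw [eq_inv_of_mul_eq_one_right h, mul_inv_rev, inv_eq_of_mul_eq_one_left h00]
    fin_cases i <;> simp [hk, hf, hf1, h2]
  gen := mem_closure_of_zsmul fun m => ⟨m.2.val, m.1, by ext <;> simp⟩

/-- `A` is the grading of an iterated doubling, or its coarsening. -/
def HasDoublingForm {F C G : Type*} [Field F] [NonAssocRing C] [Module F C] [Group G]
    (n : QuadraticForm F C) (M : ZMod 2 → Submodule F C) (A : G → Submodule F C) : Prop :=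
  ∃ w v u : C, w ∈ M 0 ∧ polar n w 1 ≠ 0 ∧ v ∈ M 0 ∧ polar n v 1 = 0 ∧ polar n v w = 0 ∧
    n v ≠ 0 ∧ u ∈ M 1 ∧ n u ≠ 0 ∧ (HasUniversalForm A (doublingGrading F w v u) ∨
      HasUniversalForm A (doublingCoarsening F w v u))

/-- `A` has one of the ten standard systems of degrees in the basis `b`. -/
def HasStandardDegrees {F C G : Type*} [Field F] [NonUnitalNonAssocRing C] [Module F C] [Group G]
    (A : G → Submodule F C) (b : Fin 8 → C) : Prop :=
  HasUniversalForm A (gradingOfDegrees F b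
    ![((0, 0) : ℤ × ℤ), (0, 0), (1, 0), (0, 1), (-1, -1), (-1, 0), (0, -1), (1, 1)]) ∨
  HasUniversalForm A (gradingOfDegrees F b ![(0 : ℤ), 0, 1, -1, 0, -1, 1, 0]) ∨
  HasUniversalForm A (gradingOfDegrees F b ![(0 : ℤ), 0, 0, -1, 1, 0, 1, -1]) ∨
  HasUniversalForm A (gradingOfDegrees F b ![(0 : ℤ), 0, 1, 1, -2, -1, -1, 2]) ∨
  HasUniversalForm A (gradingOfDegrees F b ![(0 : ℤ), 0, -2, 1, 1, 2, -1, -1]) ∨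
  HasUniversalForm A (gradingOfDegrees F b ![(0 : ZMod 3), 0, 1, 1, 1, 2, 2, 2]) ∨
  HasUniversalForm A (gradingOfDegrees F b ![(0 : ZMod 4), 0, 1, 1, 2, 3, 3, 2]) ∨
  HasUniversalForm A (gradingOfDegrees F b ![(0 : ZMod 4), 0, 2, 1, 1, 2, 3, 3]) ∨
  HasUniversalForm A (gradingOfDegrees F b
    ![((0, 0) : ℤ × ZMod 2), (0, 0), (0, 1), (1, 0), (-1, 1), (0, 1), (-1, 0), (1, 1)]) ∨
  HasUniversalForm A (gradingOfDegrees F b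
    ![((0, 0) : ℤ × ZMod 2), (0, 0), (-1, 1), (1, 0), (0, 1), (1, 1), (-1, 0), (0, 1)])

/-- `A` has one of the ten standard systems of degrees in a canonical basis. -/
def HasCanonicalForm {F C G : Type*} [Field F] [NonAssocRing C] [Module F C] [Group G]
    (M : ZMod 2 → Submodule F C) (A : G → Submodule F C) : Prop :=
  ∃ e₁ e₂ u₁ u₂ u₃ v₁ v₂ v₃ : C, IsCanonicalBasis₈ F e₁ e₂ u₁ u₂ u₃ v₁ v₂ v₃ ∧
    M 0 = Submodule.span F {e₁, e₂, u₃, v₃} ∧ M 1 = Submodule.span F {u₁, u₂, v₁, v₂} ∧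
    HasStandardDegrees A ![e₁, e₂, u₁, u₂, u₃, v₁, v₂, v₃]

/-! ### Case analysis on the degrees of a homogeneous triple -/

theorem mul_self_eq_one_of_triple {W : Type*} [Group W] {x y z : W} (h : x * y * z = 1)
    (hc : Commute x y) (hx : x * x = 1) (hy : y * y = 1) : z * z = 1 := by
  rw [eq_inv_of_mul_eq_one_right h, ← mul_inv_rev, inv_eq_one, hc.symm.mul_mul_mul_comm, hx, hy,
    one_mul]

namespace IsHomogeneousTriple

variable {F C G : Type*} [Field F] [CharP F 2] [NonAssocRing C] [Module F C] [IsScalarTower F C C]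
  [SMulCommClass F C C] {n : QuadraticForm F C} {M : ZMod 2 → Submodule F C}
  {A : G → Submodule F C} {e : C} {u : Fin 3 → C} {g : Fin 3 → G}

theorem main_eq_span (h : IsHomogeneousTriple n M A e u g) (hM : IsHurwitzSuper n M)
    (h8 : Module.finrank F C = 8) (he : IsTraceOneIdempotent n e) (heM : e ∈ M 0) :
    M 0 = Submodule.span F {e, 1 - e, u 2, u 0 * u 1} ∧
      M 1 = Submodule.span F {u 0, u 1, u 1 * u 2, u 2 * u 0} := by
  apply hM.eq_of_sup_eq_top
  · rw [Submodule.span_le]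
    simp only [Set.insert_subset_iff, Set.singleton_subset_iff]
    exact ⟨heM, sub_mem hM.one_mem heM, h.mem_zero, hM.mul_mem _ _ _ h.mem_one _ h.mem_one'⟩
  · rw [Submodule.span_le]
    simp only [Set.insert_subset_iff, Set.singleton_subset_iff]
    exact ⟨h.mem_one, h.mem_one', hM.mul_mem _ _ _ h.mem_one' _ h.mem_zero,
      hM.mul_mem _ _ _ h.mem_zero _ h.mem_one⟩
  · rw [← Submodule.span_union, eq_top_iff, ← (h.isCanonicalBasis₈ hM.toIsHurwitzNorm h8
      he).span_eq_top]
    apply Submodule.span_mono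
    intro x
    simp only [Set.mem_insert_iff, Set.mem_singleton_iff, Set.mem_union]
    tauto

variable [Group G]

theorem hasCanonicalForm (h : IsHomogeneousTriple n M A e u g) (hM : IsHurwitzSuper n M)
    (h8 : Module.finrank F C = 8) (he : IsTraceOneIdempotent n e) (heM : e ∈ M 0)
    (hd : HasStandardDegrees A ![e, 1 - e, u 0, u 1, u 2, u 1 * u 2, u 2 * u 0, u 0 * u 1]) :
    HasCanonicalForm M A :=
  ⟨_, _, _, _, _, _, _, _, h.isCanonicalBasis₈ hM.toIsHurwitzNorm h8 he,
    (h.main_eq_span hM h8 he heM).1, (h.main_eq_span hM h8 he heM).2, hd⟩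

theorem hasUniversalForm_main (h : IsHomogeneousTriple n M A e u g) (hA : IsSuperGrading M A)
    (hM : IsHurwitzSuper n M) (h8 : Module.finrank F C = 8) (he : IsTraceOneIdempotent n e)
    (heA : e ∈ A 1) (heM : e ∈ M 0) (hnt : A 1 ≠ ⊤) (h2 : g 2 = 1) (h0 : g 0 * g 0 = 1) :
    HasUniversalForm A M := by
  have : Nontrivial C := ⟨e, 0, fun h0 => by simpa [h0] using he.trace⟩
  have hv := h.mem_grading_mul hA.toIsGroupGrading hM.toIsHurwitzNorm
  have hg := h.degree_mul hA.toIsGroupGrading hM.toIsHurwitzNorm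
  have hu := h.mem_grading
  -- With g 2 = 1 and g 0 an involution, all odd basis vectors have degree g 0 and all even ones
  -- have degree 1.
  have h1 : g 1 = g 0 := by
    rw [h2, mul_one] at hg
    exact mul_left_cancel (hg.trans h0.symm)
  have hi : (g 0)⁻¹ = g 0 := inv_eq_of_mul_eq_one_left h0
  obtain ⟨hM0, hM1⟩ := h.main_eq_span hM h8 he heM
  have hle0 : M 0 ≤ A 1 := by
    rw [hM0, Submodule.span_le]
    simp only [Set.insert_subset_iff, Set.singleton_subset_iff]
    have hu2 := hu 2
    have hv2 := hv.2.2
    rw [h2] at hu2 hv2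
    rw [inv_one] at hv2
    exact ⟨heA, sub_mem hA.one_mem heA, hu2, hv2⟩
  have hle1 : M 1 ≤ A (g 0) := by
    rw [hM1, Submodule.span_le]
    simp only [Set.insert_subset_iff, Set.singleton_subset_iff]
    have hu1 := hu 1
    rw [h1, hi] at hv
    rw [h1] at hu1
    exact ⟨hu 0, hu1, hv.1, hv.2.1⟩
  refine _root_.hasUniversalForm_main hA.toIsGroupGrading hM (g := g 0) ?_ hle0 hle1
  intro h0
  rw [h0] at hle1
  exact hnt (top_le_iff.1 (hM.sup_eq_top ▸ sup_le hle0 hle1))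

/-- When g 2 and g 0 are involutions, each u_i shares its degree with its dual v_i for i = 2, 0. The
sum of such a pair is homogeneous of norm n(u_i, v_i) = 1, and with w = e these sums serve as v and
u. -/
theorem hasDoublingForm (h : IsHomogeneousTriple n M A e u g) (hA : IsSuperGrading M A)
    (hM : IsHurwitzSuper n M) (h8 : Module.finrank F C = 8) (he : IsTraceOneIdempotent n e)
    (heA : e ∈ A 1) (heM : e ∈ M 0) (h2 : g 2 ≠ 1) (h22 : g 2 * g 2 = 1) (h0 : g 0 * g 0 = 1) :
    HasDoublingForm n M A := by
  have hn := hM.toIsHurwitzNorm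
  have hG := hA.toIsGroupGrading
  have : Nontrivial C := ⟨e, 0, fun h0 => by simpa [h0] using he.trace⟩
  have hu := h.mem_peirce
  have hv := h.mem_grading_mul hG hn
  rw [inv_eq_of_mul_eq_one_left h22, inv_eq_of_mul_eq_one_left h0] at hv
  have hnorm : ∀ x ∈ peirceComponent F e, ∀ y ∈ peirceComponent F (1 - e), polar n x y = 1 →
      n (x + y) ≠ 0 := by
    intro x hx y hy hxy
    rw [QuadraticMap.map_add n, he.norm_peirce hn hx, (he.one_sub hn).norm_peirce hn hy, hxy]
    simp
  have hvA : u 2 + u 0 * u 1 ∈ A (g 2) := add_mem (h.mem_grading 2) hv.2.2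
  have hvM : u 2 + u 0 * u 1 ∈ M 0 :=
    add_mem h.mem_zero (hM.mul_mem _ _ _ h.mem_one _ h.mem_one')
  have huM : u 0 + u 1 * u 2 ∈ M 1 :=
    add_mem h.mem_one (hM.mul_mem _ _ _ h.mem_one' _ h.mem_zero)
  have hnv := hnorm _ (hu 2) _ (he.mul_peirce hn (hu 0) (hu 1))
    (by rw [QuadraticMap.polar_comm, h.polar_eq])
  have hnu := hnorm _ (hu 0) _ (he.mul_peirce hn (hu 1) (hu 2))
    (by rw [QuadraticMap.polar_comm, he.polar_mul_rotate hn (hu 0) (hu 1), h.polar_eq])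
  have het : polar n e 1 ≠ 0 := by rw [he.trace]; exact one_ne_zero
  obtain ⟨u', hu', hnu', hform⟩ := hasUniversalForm_doubling hG hM h8 h2 heA heM het hvA hvM hnv
    (add_mem (h.mem_grading 0) hv.1) huM hnu
  exact ⟨e, _, u', heM, het, hvM, hG.trace_eq_zero hn h2 hvA,
    hG.polar_eq_zero hn (by rwa [mul_one]) hvA heA, hnv, hu', hnu', hform⟩

theorem hasUniversalForm_of_iff.{x, y, z, t} {F : Type x} {C : Type y} {G : Type z} [Field F]
    [CharP F 2] [NonAssocRing C] [Module F C] [IsScalarTower F C C] [SMulCommClass F C C] [Group G]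
    {n : QuadraticForm F C} {M : ZMod 2 → Submodule F C}
    {A : G → Submodule F C} {e : C} {u : Fin 3 → C} {g : Fin 3 → G}
    (h : IsHomogeneousTriple n M A e u g) (hA : IsGroupGrading A)
    (hn : IsHurwitzNorm n) (h8 : Module.finrank F C = 8) (he : IsTraceOneIdempotent n e)
    (heA : e ∈ A 1) {T : Type t} [AddCommGroup T] {a b c : T}
    (ha : IsUniversalTriple.{z} ![a, b, c]) {d : Fin 8 → T} (hd : ![0, 0, a, b, c, -a, -b, -c] = d)
    (h0 : g 0 = 1 ↔ a = 0) (h1 : g 1 = 1 ↔ b = 0) (h2 : g 2 = 1 ↔ c = 0)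
    (h01 : g 0 = g 1 ↔ a = b) (h12 : g 1 = g 2 ↔ b = c) (h02 : g 0 = g 2 ↔ a = c)
    (h00 : g 0 * g 0 = 1 ↔ a + a = 0) (h11 : g 1 * g 1 = 1 ↔ b + b = 0)
    (h22 : g 2 * g 2 = 1 ↔ c + c = 0) :
    HasUniversalForm A (gradingOfDegrees F
      ![e, 1 - e, u 0, u 1, u 2, u 1 * u 2, u 2 * u 0, u 0 * u 1] d) := by
  subst hd
  have h10 : g 1 = g 0 ↔ b = a := by rw [eq_comm, h01, eq_comm]
  have h20 : g 2 = g 0 ↔ c = a := by rw [eq_comm, h02, eq_comm]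
  have h21 : g 2 = g 1 ↔ c = b := by rw [eq_comm, h12, eq_comm]
  refine h.hasUniversalForm hA hn h8 he heA (a := ![a, b, c]) ha ?_ ?_ ?_
  · intro i
    fin_cases i <;> assumption
  · intro i j
    fin_cases i <;> fin_cases j
    exacts [iff_of_true rfl rfl, h01, h02, h10, iff_of_true rfl rfl, h12, h20, h21,
      iff_of_true rfl rfl]
  · intro i
    fin_cases i <;> assumption

/-- The conditions `c1`, `c2`, `c3` normalise the order of the two odd degrees: an asymmetric
coincidence g_i = 1 or g_i² = 1 falls on index 0, and an asymmetric coincidence with g 2 falls on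
index 1. The split is then on g 2 = 1, g 0 = 1, g 0 = g 1, g 1 = g 2 and the squares; the remaining
coincidences follow from g 0 g 1 g 2 = 1. -/
theorem classification_of_condition (h : IsHomogeneousTriple n M A e u g)
    (hA : IsSuperGrading M A) (hM : IsHurwitzSuper n M) (h8 : Module.finrank F C = 8)
    (he : IsTraceOneIdempotent n e) (heA : e ∈ A 1) (heM : e ∈ M 0) (hnt : A 1 ≠ ⊤)
    (c1 : g 1 = 1 → g 0 = 1 ∨ g 2 = 1) (c2 : g 0 = g 2 → g 1 = g 2)
    (c3 : g 1 * g 1 = 1 → g 0 * g 0 = 1 ∨ g 2 * g 2 = 1) :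
    HasUniversalForm A M ∨ HasDoublingForm n M A ∨ HasCanonicalForm M A := by
  have hn := hM.toIsHurwitzNorm
  have hG := hA.toIsGroupGrading
  have hg := h.degree_mul hG hn
  have hc := h.degree_comm hG hn he
  obtain ⟨m01, m10, m02, m20, m12, m21⟩ := mul_eq_one_iff_of_mul_mul_eq_one hg hc
  have hform := fun {T} [AddCommGroup T] {a b c : T} => h.hasUniversalForm_of_iff hG hn h8 he heA
    (T := T) (a := a) (b := b) (c := c)
  have hcan := h.hasCanonicalForm hM h8 he heM
  have s12 : g 1 * g 1 = 1 → g 2 * g 2 = 1 → g 0 * g 0 = 1 := by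
    have h12 : g 1 * g 2 = (g 0)⁻¹ :=
      eq_inv_of_mul_eq_one_right (by rw [← mul_assoc, hg])
    have h21 : g 2 * g 1 = (g 0)⁻¹ := by
      apply eq_inv_of_mul_eq_one_left
      rw [mul_assoc, mul_eq_one_comm, ← hc.eq, hg]
    refine mul_self_eq_one_of_triple (x := g 1) (y := g 2) ?_ (h12.trans h21.symm)
    rw [h12, inv_mul_cancel]
  have s02 : g 0 * g 0 = 1 → g 1 * g 1 = 1 → g 2 * g 2 = 1 := mul_self_eq_one_of_triple hg hc
  by_cases h2 : g 2 = 1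
  · by_cases h00 : g 0 * g 0 = 1
    · exact Or.inl (h.hasUniversalForm_main hA hM h8 he heA heM hnt h2 h00)
    · have n0 : g 0 ≠ 1 := by grind
      have n1 : g 1 ≠ 1 := by grind
      have n01 : g 0 ≠ g 1 := by grind
      have n02 : g 0 ≠ g 2 := by grind
      have n12 : g 1 ≠ g 2 := by grind
      have n11 : g 1 * g 1 ≠ 1 := by grind
      have h22 : g 2 * g 2 = 1 := by grind
      refine Or.inr (Or.inr (hcan (Or.inr (Or.inl ?_))))
      refine hform isUniversalTriple_int_one_neg_one ?_ ?_ ?_ ?_ ?_ ?_ ?_ ?_ ?_ ?_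
      · decide
      all_goals first
        | exact iff_of_true ‹_› (by decide)
        | exact iff_of_false ‹_› (by decide)
  by_cases h0 : g 0 = 1
  · have h00 : g 0 * g 0 = 1 := by grind
    by_cases h22 : g 2 * g 2 = 1
    · exact Or.inr (Or.inl (h.hasDoublingForm hA hM h8 he heA heM h2 h22 h00))
    · have n1 : g 1 ≠ 1 := by grind
      have n01 : g 0 ≠ g 1 := by grind
      have n02 : g 0 ≠ g 2 := by grind
      have n12 : g 1 ≠ g 2 := by grind
      have n11 : g 1 * g 1 ≠ 1 := by grind
      refine Or.inr (Or.inr (hcan (Or.inr (Or.inr (Or.inl ?_)))))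
      refine hform isUniversalTriple_int_one_neg_one.reverse ?_ ?_ ?_ ?_ ?_ ?_ ?_ ?_ ?_ ?_
      · decide
      all_goals first
        | exact iff_of_true ‹_› (by decide)
        | exact iff_of_false ‹_› (by decide)
  -- By `c1`, since g 0 and g 2 are both nontrivial.
  have h1 : g 1 ≠ 1 := by grind
  by_cases h01 : g 0 = g 1
  · have n00 : g 0 * g 0 ≠ 1 := by grind
    have n11 : g 1 * g 1 ≠ 1 := by grind
    by_cases h12 : g 1 = g 2
    · have h02 : g 0 = g 2 := by grind
      have n22 : g 2 * g 2 ≠ 1 := by grind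
      refine Or.inr (Or.inr (hcan (Or.inr (Or.inr (Or.inr (Or.inr (Or.inr
        (Or.inl ?_))))))))
      refine hform isUniversalTriple_zmod_three ?_ ?_ ?_ ?_ ?_ ?_ ?_ ?_ ?_ ?_
      · decide
      all_goals first
        | exact iff_of_true ‹_› (by decide)
        | exact iff_of_false ‹_› (by decide)
    have h02 : g 0 ≠ g 2 := by grind
    by_cases h22 : g 2 * g 2 = 1
    · refine Or.inr (Or.inr (hcan (Or.inr (Or.inr (Or.inr (Or.inr (Or.inr
        (Or.inr (Or.inl ?_)))))))))
      refine hform isUniversalTriple_zmod_four ?_ ?_ ?_ ?_ ?_ ?_ ?_ ?_ ?_ ?_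
      · decide
      all_goals first
        | exact iff_of_true ‹_› (by decide)
        | exact iff_of_false ‹_› (by decide)
    · refine Or.inr (Or.inr (hcan (Or.inr (Or.inr (Or.inr (Or.inl ?_))))))
      refine hform isUniversalTriple_int_one_one ?_ ?_ ?_ ?_ ?_ ?_ ?_ ?_ ?_ ?_
      · decide
      all_goals first
        | exact iff_of_true ‹_› (by decide)
        | exact iff_of_false ‹_› (by decide)
  by_cases h12 : g 1 = g 2
  · have h02 : g 0 ≠ g 2 := by grind
    have n11 : g 1 * g 1 ≠ 1 := by grind
    have n22 : g 2 * g 2 ≠ 1 := by grind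
    by_cases h00 : g 0 * g 0 = 1
    · refine Or.inr (Or.inr (hcan (Or.inr (Or.inr (Or.inr (Or.inr (Or.inr
        (Or.inr (Or.inr (Or.inl ?_))))))))))
      refine hform isUniversalTriple_zmod_four.reverse ?_ ?_ ?_ ?_ ?_ ?_ ?_ ?_ ?_ ?_
      · decide
      all_goals first
        | exact iff_of_true ‹_› (by decide)
        | exact iff_of_false ‹_› (by decide)
    · refine Or.inr (Or.inr (hcan (Or.inr (Or.inr (Or.inr (Or.inr (Or.inl ?_)))))))
      refine hform isUniversalTriple_int_one_one.reverse ?_ ?_ ?_ ?_ ?_ ?_ ?_ ?_ ?_ ?_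
      · decide
      all_goals first
        | exact iff_of_true ‹_› (by decide)
        | exact iff_of_false ‹_› (by decide)
  -- By `c2`. From here the three degrees are distinct and nontrivial, and only their squares remain
  -- to be examined.
  have h02 : g 0 ≠ g 2 := by grind
  by_cases h22 : g 2 * g 2 = 1
  · by_cases h00 : g 0 * g 0 = 1
    · exact Or.inr (Or.inl (h.hasDoublingForm hA hM h8 he heA heM h2 h22 h00))
    have n11 : g 1 * g 1 ≠ 1 := by grind
    refine Or.inr (Or.inr (hcan (Or.inr (Or.inr (Or.inr (Or.inr (Or.inr
        (Or.inr (Or.inr (Or.inr (Or.inr ?_)))))))))))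
    refine hform isUniversalTriple_int_zmod_two.reverse ?_ ?_ ?_ ?_ ?_ ?_ ?_ ?_ ?_ ?_
    · decide
    all_goals first
      | exact iff_of_true ‹_› (by decide)
      | exact iff_of_false ‹_› (by decide)
  by_cases h00 : g 0 * g 0 = 1
  · have n11 : g 1 * g 1 ≠ 1 := by grind
    refine Or.inr (Or.inr (hcan (Or.inr (Or.inr (Or.inr (Or.inr (Or.inr
        (Or.inr (Or.inr (Or.inr (Or.inl ?_)))))))))))
    refine hform isUniversalTriple_int_zmod_two ?_ ?_ ?_ ?_ ?_ ?_ ?_ ?_ ?_ ?_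
    · decide
    all_goals first
      | exact iff_of_true ‹_› (by decide)
      | exact iff_of_false ‹_› (by decide)
  -- By `c3`. No coincidence is left, so this is the Cartan grading.
  have n11 : g 1 * g 1 ≠ 1 := by grind
  refine Or.inr (Or.inr (hcan (Or.inl ?_)))
  refine hform isUniversalTriple_int_int ?_ ?_ ?_ ?_ ?_ ?_ ?_ ?_ ?_ ?_
  · decide
  all_goals exact iff_of_false ‹_› (by decide)

theorem classification (h : IsHomogeneousTriple n M A e u g)
    (hA : IsSuperGrading M A) (hM : IsHurwitzSuper n M) (h8 : Module.finrank F C = 8)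
    (he : IsTraceOneIdempotent n e) (heA : e ∈ A 1) (heM : e ∈ M 0) (hnt : A 1 ≠ ⊤) :
    HasUniversalForm A M ∨ HasDoublingForm n M A ∨ HasCanonicalForm M A := by
  by_cases hc : (g 1 = 1 → g 0 = 1 ∨ g 2 = 1) ∧ (g 0 = g 2 → g 1 = g 2) ∧
    (g 1 * g 1 = 1 → g 0 * g 0 = 1 ∨ g 2 * g 2 = 1)
  · exact h.classification_of_condition hA hM h8 he heA heM hnt hc.1 hc.2.1 hc.2.2
  -- Each of the three conditions fails only through an asymmetry between the two odd degrees, and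
  -- any such asymmetry makes all three mirrored conditions hold.
  · have hs : (g 0 = 1 → g 1 = 1 ∨ g 2 = 1) ∧ (g 1 = g 2 → g 0 = g 2) ∧
        (g 0 * g 0 = 1 → g 1 * g 1 = 1 ∨ g 2 * g 2 = 1) := by
      grind
    exact (h.swap hM.toIsHurwitzNorm he).classification_of_condition hA hM h8 he heA heM hnt hs.1
      hs.2.1 hs.2.2

end IsHomogeneousTriple

/-! ### The classifications in dimensions four and eight -/

theorem exists_isTraceOneIdempotent {F C G : Type*} [Field F] [NonAssocRing C] [Module F C]
    [Group G] {n : QuadraticForm F C} {M : ZMod 2 → Submodule F C} {A : G → Submodule F C} {w : C}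
    (hwA : w ∈ A 1) (hwM : w ∈ M 0) (hnw : n w = 0)
    (hwt : polar n w 1 ≠ 0) : ∃ e ∈ A 1, e ∈ M 0 ∧ IsTraceOneIdempotent n e :=
  ⟨(polar n w 1)⁻¹ • w, (A 1).smul_mem _ hwA, (M 0).smul_mem _ hwM,
    by rw [QuadraticMap.polar_smul_left, smul_eq_mul, inv_mul_cancel₀ hwt],
    by rw [QuadraticMap.map_smul, hnw, smul_zero]⟩

theorem forall_fin_four {p : Fin 4 → Prop} (h : p 0 ∧ p 1 ∧ p 2 ∧ p 3) : ∀ i, p i := by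
  intro i
  obtain ⟨h0, h1, h2, h3⟩ := h
  fin_cases i <;> assumption

/-- The index of the product of two members of a canonical basis, if it is not zero. -/
def canonicalMulFour : Fin 4 → Fin 4 → Option (Fin 4) :=
  ![![some 0, none, some 2, none], ![none, some 1, none, some 3], ![none, some 2, none, some 0],
    ![some 3, none, some 1, none]]

theorem IsCanonicalBasis₄.mul_eq {F C : Type*} [Field F] [CharP F 2] [NonAssocRing C]
    [Module F C] {e₁ e₂ u₁ v₁ : C} (h : IsCanonicalBasis₄ F e₁ e₂ u₁ v₁)
    (i j : Fin 4) : ![e₁, e₂, u₁, v₁] i * ![e₁, e₂, u₁, v₁] j =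
      (canonicalMulFour i j).elim 0 ![e₁, e₂, u₁, v₁] := by
  obtain ⟨-, -, h0, h1, h2, h3⟩ := h
  simp only [neg_of_charTwo F] at h2 h3
  revert j
  revert i
  exact forall_fin_four ⟨forall_fin_four h0, forall_fin_four h1, forall_fin_four h2,
    forall_fin_four h3⟩

section

variable {F C G : Type*} [Field F] [NonAssocRing C] [Module F C] [SMulCommClass F C C] [Group G]
  {n : QuadraticForm F C} {M : ZMod 2 → Submodule F C} {A : G → Submodule F C}

/-- If the homogeneous isotropic elements of `A 1 ⊓ M 0` have trace zero, then the homogeneous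
isotropic elements vanish. -/
theorem norm_ne_zero_of_homogeneous (hA : IsSuperGrading M A) (hM : IsHurwitzSuper n M)
    (h : ∀ w ∈ A 1, w ∈ M 0 → n w = 0 → polar n w 1 = 0) {g : G} {i : ZMod 2} {x : C}
    (hx : x ∈ A g) (hxi : x ∈ M i) (h0 : x ≠ 0) : n x ≠ 0 := by
  intro hnx
  obtain ⟨y, hy, hyi, hxy⟩ := hA.exists_polar_eq_one hM hx hxi h0
  have hn := hM.toIsHurwitzNorm
  have h1 := hA.mul_mem _ _ x hx _ (hA.conj_mem hn hy)
  have h2 := hM.mul_mem _ _ x hxi _ (hM.conj_mem hyi)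
  rw [mul_inv_cancel] at h1
  rw [CharTwo.add_self_eq_zero] at h2
  -- For isotropic x with partner y, the element xȳ is even of degree 1, isotropic, and of trace
  -- n(x,y) = 1.
  have h3 := h _ h1 h2 (by rw [hM.map_mul, hnx, zero_mul])
  rw [QuadraticMap.polar_comm, ← hn.polar_mul_conj_right, one_mul, QuadraticMap.polar_comm,
    hxy] at h3
  exact one_ne_zero h3

variable [IsScalarTower F C C]

/-- Right multiplication by a homogeneous odd u, anisotropic by assumption, maps the even part
injectively into the odd part of one degree. Even and odd parts have equal dimension, so the whole
odd part has that degree. -/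
theorem hasUniversalForm_main_of_le (hA : IsSuperGrading M A) (hM : IsHurwitzSuper n M)
    (hfin : 0 < Module.finrank F (M 0)) (hnt : A 1 ≠ ⊤)
    (h : ∀ w ∈ A 1, w ∈ M 0 → n w = 0 → polar n w 1 = 0) (hle : M 0 ≤ A 1) :
    HasUniversalForm A M := by
  obtain ⟨x, hx, hnx⟩ := hM.exists_norm_ne_zero
  have hx0 : x ≠ 0 := by
    rintro rfl
    simp at hnx
  have : Nontrivial C := ⟨x, 0, hx0⟩
  obtain ⟨g, u, hu, hu1, hxu⟩ := hA.exists_polar_ne_zero hM hx hx0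
  have hu0 : u ≠ 0 := by
    rintro rfl
    simp at hxu
  have hnu := norm_ne_zero_of_homogeneous hA hM h hu hu1 hu0
  have hmul : ∀ y : M 0, (y : C) * u ∈ A g ⊓ M 1 := by
    intro y
    have h1 := hA.mul_mem _ _ y (hle y.2) u hu
    have h2 := hM.mul_mem _ _ y y.2 u hu1
    rw [one_mul] at h1
    rw [zero_add] at h2
    exact ⟨h1, h2⟩
  let f : M 0 →ₗ[F] (A g ⊓ M 1 : Submodule F C) :=
    { toFun := fun y => ⟨y * u, hmul y⟩
      map_add' := fun y z => Subtype.ext (add_mul _ _ _)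
      map_smul' := fun a y => Subtype.ext (smul_mul_assoc _ _ _) }
  have hf : Function.Injective f := by
    rw [← LinearMap.ker_eq_bot, LinearMap.ker_eq_bot']
    intro y hy
    have hy' : (y : C) * u = 0 := congrArg Subtype.val hy
    have h1 := hM.mul_mul_right u y
    rw [hy', zero_mul, smul_zero, zero_sub, zero_eq_neg] at h1
    exact Subtype.ext ((smul_eq_zero.1 h1).resolve_left hnu)
  have : FiniteDimensional F (M 1) :=
    Module.finite_of_finrank_pos (by rw [← hM.finrank_eq]; exact hfin)
  have : FiniteDimensional F (A g ⊓ M 1 : Submodule F C) :=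
    Submodule.finiteDimensional_of_le inf_le_right
  have heq : A g ⊓ M 1 = M 1 := Submodule.eq_of_le_of_finrank_le inf_le_right (by
    rw [← hM.finrank_eq]
    exact LinearMap.finrank_le_finrank_of_injective hf)
  have hle1 : M 1 ≤ A g := inf_eq_right.1 heq
  refine hasUniversalForm_main hA.toIsGroupGrading hM (g := g) ?_ hle hle1
  rintro rfl
  exact hnt (top_le_iff.1 (hM.sup_eq_top ▸ sup_le hle hle1))

variable [CharP F 2]

/-- The dichotomy is whether the even part of degree 1 has an isotropic element of nonzero trace. If
not, anisotropic homogeneous elements give the main grading or a doubling; if so, such an element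
rescales to an idempotent and the analysis of triples applies. -/
theorem classification_of_finrank_eight (hA : IsSuperGrading M A) (hM : IsHurwitzSuper n M)
    (h4 : Module.finrank F (M 0) = 4) (hnt : A 1 ≠ ⊤) :
    HasUniversalForm A M ∨ HasDoublingForm n M A ∨
      (∃ e ∈ M 0, e ≠ 0 ∧ n e = 0) ∧ HasCanonicalForm M A := by
  have hn := hM.toIsHurwitzNorm
  have h8 : Module.finrank F C = 8 := by
    rw [hM.finrank_add, ← hM.finrank_eq, h4]
  have : Nontrivial C := Module.nontrivial_of_finrank_pos (R := F) (by omega)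
  by_cases h : ∀ w ∈ A 1, w ∈ M 0 → n w = 0 → polar n w 1 = 0
  · by_cases hle : M 0 ≤ A 1
    · exact Or.inl (hasUniversalForm_main_of_le hA hM (by omega) hnt h hle)
    · obtain ⟨k, hk⟩ : ∃ k, ¬ A k ⊓ M 0 ≤ A 1 := by
        by_contra! hcon
        exact hle (hA.le_of_inf_le hM hcon)
      obtain ⟨v, ⟨hvA, hvM⟩, hv1⟩ := SetLike.not_le_iff_exists.1 hk
      have hk1 : k ≠ 1 := by
        rintro rfl
        exact hv1 hvA
      have hv0 : v ≠ 0 := by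
        rintro rfl
        exact hv1 (zero_mem _)
      obtain ⟨w, hwA, hwM, hwt⟩ := hA.exists_polar_eq_one hM hA.one_mem hM.one_mem one_ne_zero
      rw [inv_one] at hwA
      rw [QuadraticMap.polar_comm] at hwt
      have hwt0 : polar n w 1 ≠ 0 := by rw [hwt]; exact one_ne_zero
      obtain ⟨x, hx, hnx⟩ := hM.exists_norm_ne_zero
      obtain ⟨g, u, hu, hu1, hxu⟩ := hA.exists_polar_ne_zero hM hx (by
        rintro rfl
        simp at hnx)
      have hu0 : u ≠ 0 := by
        rintro rfl
        simp at hxu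
      have hnv := norm_ne_zero_of_homogeneous hA hM h hvA hvM hv0
      have hnu := norm_ne_zero_of_homogeneous hA hM h hu hu1 hu0
      obtain ⟨u', hu', hnu', hform⟩ := hasUniversalForm_doubling hA.toIsGroupGrading hM h8 hk1
        hwA hwM hwt0 hvA hvM hnv hu hu1 hnu
      exact Or.inr (Or.inl ⟨w, v, u', hwM, hwt0, hvM, hA.trace_eq_zero hn hk1 hvA,
        hA.polar_eq_zero hn (by rwa [mul_one]) hvA hwA, hnv, hu', hnu', hform⟩)
  · push Not at h
    obtain ⟨w, hwA, hwM, hnw, hwt⟩ := h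
    obtain ⟨e, heA, heM, he⟩ := exists_isTraceOneIdempotent hwA hwM hnw hwt
    obtain ⟨u, g, ht⟩ := exists_isHomogeneousTriple hA hM he heA heM h4
    rcases ht.classification hA hM h8 he heA heM hnt with h | h | h
    · exact Or.inl h
    · exact Or.inr (Or.inl h)
    · refine Or.inr (Or.inr ⟨⟨e, heM, ?_, he.norm⟩, h⟩)
      rintro rfl
      simpa using he.trace

theorem IsTraceOneIdempotent.isCanonicalBasis₄ {e u v : C} (he : IsTraceOneIdempotent n e)
    (hn : IsHurwitzNorm n) (h4 : Module.finrank F C = 4) (hu : u ∈ peirceComponent F e)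
    (hv : v ∈ peirceComponent F (1 - e)) (huv : polar n u v = 1) :
    IsCanonicalBasis₄ F e (1 - e) u v := by
  have hf := he.one_sub hn
  have hu' := he.polar_peirce_of_mem hn hu
  have hv' := hf.polar_peirce_of_mem hn hv
  rw [sub_sub_cancel] at hv'
  have hvu : polar n v u = 1 := by rw [QuadraticMap.polar_comm, huv]
  have hpe' : polar n (1 - e) e = 1 := by rw [QuadraticMap.polar_comm, he.polar_one_sub]
  have hli : LinearIndependent F ![e, 1 - e, u, v] := by
    apply linearIndependent_of_polar n _ ![1 - e, e, v, u]
    · intro i j hij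
      fin_cases i <;> fin_cases j <;> first
        | exact absurd rfl hij
        | exact polar_self_of_charTwo n _
        | exact hu'.1
        | exact hu'.2.1
        | exact hu'.2.2.1
        | exact hu'.2.2.2
        | exact hv'.1
        | exact hv'.2.1
        | exact hv'.2.2.1
        | exact hv'.2.2.2
    · intro i
      fin_cases i <;> simp [he.polar_one_sub, hpe', huv, hvu]
  have : FiniteDimensional F C := Module.finite_of_finrank_pos (by omega)
  have htop := hli.span_eq_top_of_card_eq_finrank' (by simp [h4])
  have hee := he.mul_self hn
  have hu1 := mem_peirceComponent_one_sub (e := 1 - e) (x := u) (F := F)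
  rw [sub_sub_cancel] at hu1
  have hv1 := mem_peirceComponent_one_sub.1 hv
  refine ⟨hli, ?_, ?_, ?_, ?_, ?_⟩
  · rw [← htop]
    congr 1
    simp only [Matrix.range_cons, Matrix.range_empty, Set.union_empty, Set.singleton_union]
  · exact ⟨hee, by rw [mul_sub, mul_one, hee, sub_self], hu.1, hv1.1⟩
  · exact ⟨by rw [sub_mul, one_mul, hee, sub_self], hf.mul_self hn, (hu1.1 hu).1, hv.1⟩
  · refine ⟨hu.2, (hu1.1 hu).2, he.mul_self_peirce hn hu, ?_⟩
    rw [he.mul_peirce_dual hn hu hv, huv, one_smul, neg_of_charTwo F]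
  · refine ⟨hv1.2, hv.2, ?_, hf.mul_self_peirce hn hv⟩
    rw [hf.mul_peirce_dual hn hv (by rwa [sub_sub_cancel]), hvu, one_smul, neg_of_charTwo F]

theorem IsCanonicalBasis₄.hasUniversalForm {e₁ e₂ u v : C} (hb : IsCanonicalBasis₄ F e₁ e₂ u v)
    (hA : IsGroupGrading A) {g : G} (h1 : e₁ ∈ A 1) (h2 : e₂ ∈ A 1) (hu : u ∈ A g)
    (hv : v ∈ A g⁻¹) (hg : g ≠ 1) (hgg : g * g ≠ 1) :
    HasUniversalForm A (gradingOfDegrees F ![e₁, e₂, u, v] ![(0 : ℤ), 0, 1, -1]) := by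
  have hdist := hb.mul_eq
  have hadd : ∀ i j l : Fin 4, canonicalMulFour i j = some l →
      ![(0 : ℤ), 0, 1, -1] i + ![(0 : ℤ), 0, 1, -1] j = ![(0 : ℤ), 0, 1, -1] l := by decide
  refine hasUniversalForm_of_basis hA _ ![1, 1, g, g⁻¹] _ ?_
    (fun i => hb.linearIndependent.ne_zero i) ?_ ?_ ?_ ?_ ?_
  · exact forall_fin_four ⟨h1, h2, hu, hv⟩
  · rw [← hb.span_eq_top]
    congr 1
    simp only [Matrix.range_cons, Matrix.range_empty, Set.union_empty, Set.singleton_union]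
  · intro i j
    fin_cases i <;> fin_cases j <;>
      simp [hg, hg.symm, hgg, eq_inv_iff_mul_eq_one, inv_eq_iff_mul_eq_one]
  · intro i j hij
    cases hl : canonicalMulFour i j with
    | none => exact absurd (by rw [hdist, hl]; rfl) hij
    | some l =>
      exact ⟨l, by rw [hdist, hl]; rfl, hadd i j l hl⟩
  · intro w hw hw'
    have hmul : ∀ i j l, canonicalMulFour i j = some l → w i * w j = w l := fun i j l hl =>
      hw' i j l (by rw [hdist, hl]; rfl)
    have w0 : w 0 = 1 := mul_eq_left.1 (hmul 0 0 0 rfl)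
    have w1 : w 1 = 1 := mul_eq_left.1 (hmul 1 1 1 rfl)
    have w3 : w 3 = (w 2)⁻¹ := eq_inv_of_mul_eq_one_right ((hmul 2 3 0 rfl).trans w0)
    obtain ⟨f, hf⟩ := exists_hom_int (w 2)
    refine ⟨f, fun i => ?_⟩
    rw [hf]
    fin_cases i <;> simp [w0, w1, w3]
  · intro m
    have h := zsmul_mem (AddSubgroup.subset_closure (k := Set.range ![(0 : ℤ), 0, 1, -1])
      (Set.mem_range_self 2)) m
    simpa using h

theorem classification_of_finrank_four (hA : IsSuperGrading M A) (hM : IsHurwitzSuper n M)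
    (h2 : Module.finrank F (M 0) = 2) (hnt : A 1 ≠ ⊤) :
    HasUniversalForm A M ∨ (∃ e ∈ M 0, e ≠ 0 ∧ n e = 0) ∧
      ∃ e₁ e₂ u₁ v₁ : C, IsCanonicalBasis₄ F e₁ e₂ u₁ v₁ ∧ M 0 = Submodule.span F {e₁, e₂} ∧
        M 1 = Submodule.span F {u₁, v₁} ∧
        HasUniversalForm A (gradingOfDegrees F ![e₁, e₂, u₁, v₁] ![(0 : ℤ), 0, 1, -1]) := by
  have hn := hM.toIsHurwitzNorm
  have hG := hA.toIsGroupGrading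
  have h4 : Module.finrank F C = 4 := by
    rw [hM.finrank_add, ← hM.finrank_eq, h2]
  have : Nontrivial C := Module.nontrivial_of_finrank_pos (R := F) (by omega)
  by_cases h : ∀ w ∈ A 1, w ∈ M 0 → n w = 0 → polar n w 1 = 0
  · refine Or.inl (hasUniversalForm_main_of_le hA hM (by omega) hnt h ?_)
    -- The even part is two-dimensional, so it is spanned by 1 and its dual partner w, both of
    -- degree 1.
    obtain ⟨w, hwA, hwM, hwt⟩ := hA.exists_polar_eq_one hM hA.one_mem hM.one_mem one_ne_zero
    rw [inv_one] at hwA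
    rw [QuadraticMap.polar_comm] at hwt
    have hle : Submodule.span F {1, w} ≤ M 0 := by
      rw [Submodule.span_le, Set.insert_subset_iff, Set.singleton_subset_iff]
      exact ⟨hM.one_mem, hwM⟩
    have : FiniteDimensional F (M 0) := Module.finite_of_finrank_pos (by omega)
    rw [← Submodule.eq_of_le_of_finrank_eq hle ((IsHurwitzNorm.finrank_span_one_pair (by
      rw [hwt]; exact one_ne_zero)).trans h2.symm)]
    exact planeOf_le hG hwA
  · push Not at h
    obtain ⟨w, hwA, hwM, hnw, hwt⟩ := h
    obtain ⟨e, heA, heM, he⟩ := exists_isTraceOneIdempotent hwA hwM hnw hwt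
    obtain ⟨x, hx, hnx⟩ := hM.exists_norm_ne_zero
    obtain ⟨g, u, hu, huA, huM, hu0⟩ :=
      exists_homogeneous_peirce hA hM he heA heM hx (by rintro rfl; simp at hnx)
        (hM.trace_eq_zero hx) (by rw [QuadraticMap.polar_comm]; exact hM.polar_eq_zero e heM x hx)
    obtain ⟨v, hv, hvA, hvM, huv⟩ := exists_dual_peirce hA hM he heA heM hu huA huM hu0
    have hb := he.isCanonicalBasis₄ hn h4 hu hv huv
    have hfA := sub_mem hA.one_mem heA
    have hfM := sub_mem hM.one_mem heM
    obtain ⟨hM0, hM1⟩ := hM.eq_of_sup_eq_top (S := Submodule.span F {e, 1 - e})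
      (T := Submodule.span F {u, v})
      (by
        rw [Submodule.span_le, Set.insert_subset_iff, Set.singleton_subset_iff]
        exact ⟨heM, hfM⟩)
      (by
        rw [Submodule.span_le, Set.insert_subset_iff, Set.singleton_subset_iff]
        exact ⟨huM, hvM⟩)
      (by
        rw [← Submodule.span_union, ← hb.span_eq_top, Set.insert_union, Set.singleton_union])
    have hM0A : M 0 ≤ A 1 := by
      rw [hM0, Submodule.span_le, Set.insert_subset_iff, Set.singleton_subset_iff]
      exact ⟨heA, hfA⟩
    have hM1A : g⁻¹ = g → M 1 ≤ A g := fun hg => by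
      rw [hg] at hvA
      rw [hM1, Submodule.span_le, Set.insert_subset_iff, Set.singleton_subset_iff]
      exact ⟨huA, hvA⟩
    have hg1 : g ≠ 1 := by
      rintro rfl
      exact hnt (top_le_iff.1 (hM.sup_eq_top ▸ sup_le hM0A (hM1A inv_one)))
    -- If g² = 1 then u and v share a degree and the grading is the main one; otherwise 1, g, g⁻¹
    -- are distinct and the universal group is ℤ.
    by_cases hgg : g * g = 1
    · exact Or.inl (hasUniversalForm_main hG hM hg1 hM0A (hM1A (inv_eq_of_mul_eq_one_left hgg)))
    · refine Or.inr ⟨⟨e, heM, ?_, he.norm⟩, e, 1 - e, u, v, hb, hM0, hM1,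
        hb.hasUniversalForm hG heA hfA huA hvA hg1 hgg⟩
      rintro rfl
      simpa using he.trace

end

theorem CD.isSplitNorm_of_mem_main {F Q : Type*} [Field F] [NonAssocRing Q] [Module F Q]
    {q : QuadraticForm F Q} {α : F} (h : ∃ e ∈ CD.main q α 0, e ≠ 0 ∧ CD.norm q α e = 0) :
    IsSplitNorm q := by
  obtain ⟨e, heM, he0, hne⟩ := h
  rw [CD.mem_main_zero] at heM
  refine ⟨e.fst, fun h => he0 (CD.ext h heM), ?_⟩
  rwa [CD.norm_apply, heM, QuadraticMap.map_zero, mul_zero, add_zero] at hne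

/-- Nontrivial gradings on the Hurwitz superalgebra `CD(Q, α)` in characteristic two. The degree
vectors list the degrees of the members of the canonical basis in the order displayed. -/
theorem mainTheorem2 {F Q : Type*} [Field F] [CharP F 2]
    [NonAssocRing Q] [Module F Q] [IsScalarTower F Q Q] [SMulCommClass F Q Q]
    (q : QuadraticForm F Q) (hq : IsHurwitzNorm q) (α : F) (hα : α ≠ 0)
    {G : Type*} [Group G] (A : G → Submodule F (CD q α))
    (hA : IsSuperGrading (CD.main q α) A) (hnontrivial : A 1 ≠ ⊤) :
    (Module.finrank F Q = 2 →
      HasUniversalForm A (CD.main q α) ∨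
      (IsSplitNorm q ∧ ∃ e₁ e₂ u₁ v₁ : CD q α, IsCanonicalBasis₄ F e₁ e₂ u₁ v₁ ∧
        CD.main q α 0 = Submodule.span F {e₁, e₂} ∧
        CD.main q α 1 = Submodule.span F {u₁, v₁} ∧
        HasUniversalForm A
          (gradingOfDegrees F ![e₁, e₂, u₁, v₁] ![(0 : ℤ), 0, 1, -1]))) ∧
    (Module.finrank F Q = 4 →
      -- the universal grading group is `(ℤ/2)²`
      (∃ w v u : CD q α, IsDoubling q α w v u ∧
        HasUniversalForm A (doublingGrading F w v u)) ∨
      -- the universal grading group is `ℤ/2`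
      HasUniversalForm A (CD.main q α) ∨
      (∃ w v u : CD q α, IsDoubling q α w v u ∧
        HasUniversalForm A (doublingCoarsening F w v u)) ∨
      -- `Q` is split and the grading is given by a canonical basis
      (IsSplitNorm q ∧ ∃ e₁ e₂ u₁ u₂ u₃ v₁ v₂ v₃ : CD q α,
        IsCanonicalBasis₈ F e₁ e₂ u₁ u₂ u₃ v₁ v₂ v₃ ∧
        CD.main q α 0 = Submodule.span F {e₁, e₂, u₃, v₃} ∧
        CD.main q α 1 = Submodule.span F {u₁, u₂, v₁, v₂} ∧
        -- the Cartan grading by `ℤ²`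
        (HasUniversalForm A (gradingOfDegrees F ![e₁, e₂, u₁, u₂, u₃, v₁, v₂, v₃]
            ![((0, 0) : ℤ × ℤ), (0, 0), (1, 0), (0, 1), (-1, -1), (-1, 0), (0, -1), (1, 1)]) ∨
        -- the two 3-gradings by `ℤ`
        HasUniversalForm A (gradingOfDegrees F ![e₁, e₂, u₁, u₂, u₃, v₁, v₂, v₃]
            ![(0 : ℤ), 0, 1, -1, 0, -1, 1, 0]) ∨
        HasUniversalForm A (gradingOfDegrees F ![e₁, e₂, u₁, u₂, u₃, v₁, v₂, v₃]
            ![(0 : ℤ), 0, 0, -1, 1, 0, 1, -1]) ∨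
        -- the two 5-gradings by `ℤ`
        HasUniversalForm A (gradingOfDegrees F ![e₁, e₂, u₁, u₂, u₃, v₁, v₂, v₃]
            ![(0 : ℤ), 0, 1, 1, -2, -1, -1, 2]) ∨
        HasUniversalForm A (gradingOfDegrees F ![e₁, e₂, u₁, u₂, u₃, v₁, v₂, v₃]
            ![(0 : ℤ), 0, -2, 1, 1, 2, -1, -1]) ∨
        -- the grading by `ℤ/3`
        HasUniversalForm A (gradingOfDegrees F ![e₁, e₂, u₁, u₂, u₃, v₁, v₂, v₃]
            ![(0 : ZMod 3), 0, 1, 1, 1, 2, 2, 2]) ∨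
        -- the two gradings by `ℤ/4`
        HasUniversalForm A (gradingOfDegrees F ![e₁, e₂, u₁, u₂, u₃, v₁, v₂, v₃]
            ![(0 : ZMod 4), 0, 1, 1, 2, 3, 3, 2]) ∨
        HasUniversalForm A (gradingOfDegrees F ![e₁, e₂, u₁, u₂, u₃, v₁, v₂, v₃]
            ![(0 : ZMod 4), 0, 2, 1, 1, 2, 3, 3]) ∨
        -- the two gradings by `ℤ × ℤ/2`
        HasUniversalForm A (gradingOfDegrees F ![e₁, e₂, u₁, u₂, u₃, v₁, v₂, v₃]
            ![((0, 0) : ℤ × ZMod 2), (0, 0), (0, 1), (1, 0), (-1, 1), (0, 1), (-1, 0), (1, 1)]) ∨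
        HasUniversalForm A (gradingOfDegrees F ![e₁, e₂, u₁, u₂, u₃, v₁, v₂, v₃]
            ![((0, 0) : ℤ × ZMod 2), (0, 0), (-1, 1), (1, 0), (0, 1), (1, 1), (-1, 0), (0, 1)])))) := by
  refine ⟨fun h2 => ?_, fun h4 => ?_⟩
  · rcases classification_of_finrank_four hA (CD.isHurwitzSuper_main hq (Or.inl h2) hα)
      ((CD.finrank_main_zero q α).trans h2) hnontrivial with h | ⟨hs, h⟩
    · exact Or.inl h
    · exact Or.inr ⟨CD.isSplitNorm_of_mem_main hs, h⟩
  · rcases classification_of_finrank_eight hA (CD.isHurwitzSuper_main hq (Or.inr h4) hα)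
      ((CD.finrank_main_zero q α).trans h4) hnontrivial with h | h | ⟨hs, h⟩
    · exact Or.inr (Or.inl h)
    · obtain ⟨w, v, u, hw, hwt, hv, hv1, hvw, hnv, hu, hnu, h | h⟩ := h
      · exact Or.inl ⟨w, v, u, ⟨hw, hwt, hv, hv1, hvw, hnv, hu, hnu⟩, h⟩
      · exact Or.inr (Or.inr (Or.inl ⟨w, v, u, ⟨hw, hwt, hv, hv1, hvw, hnv, hu, hnu⟩, h⟩))
    · exact Or.inr (Or.inr (Or.inr ⟨CD.isSplitNorm_of_mem_main hs, h⟩))
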